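/- A decision tree over $\mathbb{R}^d$ is a finite binary tree whose inner nodes carry inequalities $x_i \ge b$ or $x_i \le b$ and whose leaves carry labels in $\{0,1\}$; it labels $x\in\mathbb{R}^d$ by the label of the leaf that $x$ reaches, and its size is its number of leaves. A learner receives i.i.d. unlabeled samples from an unknown distribution $D$ on $\mathbb{R}^d$ and may ask two kinds of queries about an unknown decision tree $h$, on points it currently stores: label queries ("what is $h(x)$?") and same-leaf queries ("do $x$ and $x'$ reach the same leaf of $h$?"). The learner is a finite program for a machine with a query tape that stores points, a work tape that stores bits, a fixed number of integer registers, a sample counter and a query counter. In one step it can draw a sample onto the query tape, remove, copy or overwrite a stored point, ask one query, compare one coordinate of two stored points, read, write, append or remove one bit, add, subtract or compare two registers, load a constant or $d$ into a register, or test the counters; the tests of the counters may be arbitrary predicates of their contents (depending on $d,\varepsilon,\delta$). The running time is the number of steps until the learner halts. The memory usage is the maximum over time of the number of stored points plus the number of bits on the work tape and in the registers (the counters are not charged). When the learner halts, it outputs the classifier $A:\mathbb{R}^d\to\{0,1,\bot\}$ computed from its final memory by a second program for this machine, which neither samples nor queries. Theorem. There are a learner, given by programs that do not depend on $d,\varepsilon,\delta$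 (only the counter tests do), a constant $C$ and a polynomial $p$ such that for all $d\ge 1$ and $\varepsilon,\delta\in(0,1)$, with suitable counter tests, the learner RPU-learns decision trees over $\mathbb{R}^d$: for every Borel probability distribution $D$ on $\mathbb{R}^d$ and every decision tree $h$ (whose size $s$ is not known to the learner), \begin{itemize} \item (probably useful) $\Pr\big[\Pr_{x\sim D}[A(x)=\bot]>\varepsilon\big]<\delta$, the outer probability being over the samples; \item (reliable) for every sequence of samples and every $x$, if $A(x)\ne\bot$ then $A(x)=h(x)$. \end{itemize} Moreover, in expectation over the samples, the learner \begin{enumerate} \item makes at most $C\,d s^2\left(1+\log\frac{s}{\varepsilon\delta}\right)$ queries, that is $O\left(ds^2\log\frac{s}{\varepsilon\delta}\right)$ for $\varepsilon,\delta\le\frac12$, \item runs in time at most $p(s,d,\varepsilon^{-1},\log(\delta^{-1}))$, \item uses at most $C\,ds$ memory. \end{enumerate} -/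

import Mathlib

open MeasureTheory
open scoped ENNReal

namespace LeafLearning

/-! ### Decision trees over `ℝ^d` -/

/-- A decision tree over `ℝ^d`: an inner node asks `x i ≥ b` or `x i ≤ b` and continues with the
first subtree if the inequality holds, with the second one otherwise; a leaf carries a label. -/
inductive DecisionTree (d : ℕ) : Type where
  | leaf (label : Bool) : DecisionTree d
  | nodeGe (i : Fin d) (b : ℝ) (yes no : DecisionTree d) : DecisionTree d
  | nodeLe (i : Fin d) (b : ℝ) (yes no : DecisionTree d) : DecisionTree d

namespace DecisionTree

/-- The size of a decision tree is its number of leaves. -/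
def size {d : ℕ} : DecisionTree d → ℕ
  | leaf _ => 1
  | nodeGe _ _ yes no => yes.size + no.size
  | nodeLe _ _ yes no => yes.size + no.size

open Classical in
/-- The leaf reached by `x`, given as the list of answers along the path from the root. -/
noncomputable def leafOf {d : ℕ} (x : Fin d → ℝ) : DecisionTree d → List Bool
  | leaf _ => []
  | nodeGe i b yes no => if x i ≥ b then true :: leafOf x yes else false :: leafOf x no
  | nodeLe i b yes no => if x i ≤ b then true :: leafOf x yes else false :: leafOf x no

open Classical in
/-- The label of the leaf reached by `x`. -/
noncomputable def label {d : ℕ} (x : Fin d → ℝ) : DecisionTree d → Bool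
  | leaf z => z
  | nodeGe i b yes no => if x i ≥ b then label x yes else label x no
  | nodeLe i b yes no => if x i ≤ b then label x yes else label x no

end DecisionTree

/-! ### The machine model

A machine has a query tape (a list of points), a work tape (a list of bits), finitely many registers
holding natural numbers, a sample counter and a query counter. It is driven by a finite program.
A program does not depend on the dimension; `R` is its number of registers. -/

/-- Elementary instructions. All arguments of type `Fin R` are names of registers; a register used
as an address refers to the tape cell whose (zero-based) index is the content of the register.
Instructions that address a cell which does not exist do nothing. -/
inductive Instr (R : ℕ) : Type where
  /-- draw the next sample point and append it to the query tape -/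
  | sample
  /-- remove the point in cell `i` from the query tape -/
  | remove (i : Fin R)
  /-- append a copy of the point in cell `i` to the query tape -/
  | copy (i : Fin R)
  /-- overwrite the point in cell `j` by the point in cell `i` -/
  | store (i j : Fin R)
  /-- label query on the point in cell `i`; the answer (0 or 1) is put into register `r` -/
  | label (i r : Fin R)
  /-- same-leaf query on the points in cells `i` and `j`; the answer is put into register `r` -/
  | sameLeaf (i j r : Fin R)
  /-- compare coordinate number `c` of the points in cells `i` and `j` (`≤`), result in `r` -/
  | compare (i j c r : Fin R)
  /-- append the bit "`r` is non-zero" to the work tape -/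
  | pushBit (r : Fin R)
  /-- remove the last bit of the work tape -/
  | popBit
  /-- read bit number `i` of the work tape into register `r` -/
  | readBit (i r : Fin R)
  /-- overwrite bit number `i` of the work tape by the bit "`r` is non-zero" -/
  | writeBit (i r : Fin R)
  /-- put a fixed number into register `r` -/
  | const (r : Fin R) (n : ℕ)
  /-- put the dimension into register `r` -/
  | dim (r : Fin R)
  /-- `r := a + b` -/
  | add (r a b : Fin R)
  /-- `r := max (a - b) 0` -/
  | sub (r a b : Fin R)

/-- Tests: comparison of two registers, or a test of the sample and query counters. -/
inductive Test (R : ℕ) : Type where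
  | lt (a b : Fin R)
  | counters (i : ℕ)

/-- Programs. -/
inductive Prog (R : ℕ) : Type where
  | instr (a : Instr R)
  | seq (p q : Prog R)
  | ite (t : Test R) (p q : Prog R)
  | loop (t : Test R) (p : Prog R)

/-- The instruction neither draws a sample nor asks a query. -/
def Instr.OracleFree {R : ℕ} : Instr R → Prop
  | .sample => False
  | .label _ _ => False
  | .sameLeaf _ _ _ => False
  | _ => True

/-- The program contains no instruction that draws a sample or asks a query. -/
def Prog.OracleFree {R : ℕ} : Prog R → Prop
  | .instr a => a.OracleFree
  | .seq p q => p.OracleFree ∧ q.OracleFree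
  | .ite _ p q => p.OracleFree ∧ q.OracleFree
  | .loop _ p => p.OracleFree

/-- What a machine interacts with: the stream of unlabeled sample points, the tree that answers the
queries, and the way in which transitions depend on the counters: test number `i` succeeds iff
`counterTest i (sample counter) (query counter) = true`. -/
structure Env (d : ℕ) where
  stream : ℕ → Fin d → ℝ
  tree : DecisionTree d
  counterTest : ℕ → ℕ → ℕ → Bool

/-- The contents of the tapes, registers and counters. -/
structure State (d R : ℕ) where
  queryTape : List (Fin d → ℝ)
  workTape : List Bool
  reg : Fin R → ℕ
  samples : ℕ
  queries : ℕ

namespace State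

variable {d R : ℕ}

/-- Empty tapes, all registers and counters zero. -/
def init : State d R := ⟨[], [], fun _ => 0, 0, 0⟩

/-- Assignment to a register. -/
def setReg (σ : State d R) (r : Fin R) (n : ℕ) : State d R :=
  { σ with reg := Function.update σ.reg r n }

/-- The point in the cell of the query tape addressed by register `i`. -/
def point (σ : State d R) (i : Fin R) : Option (Fin d → ℝ) := σ.queryTape[σ.reg i]?

/-- The memory in use: number of stored points, plus number of bits on the work tape, plus total
binary length of the registers. The counters are not charged. -/
def memory (σ : State d R) : ℕ :=
  σ.queryTape.length + σ.workTape.length + ∑ r, Nat.size (σ.reg r)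

end State

open Classical in
/-- The effect of an instruction. -/
noncomputable def Instr.exec {d R : ℕ} (E : Env d) (σ : State d R) : Instr R → State d R
  | .sample => { σ with
      queryTape := σ.queryTape ++ [E.stream σ.samples]
      samples := σ.samples + 1 }
  | .remove i => { σ with queryTape := σ.queryTape.eraseIdx (σ.reg i) }
  | .copy i =>
      match σ.point i with
      | some x => { σ with queryTape := σ.queryTape ++ [x] }
      | none => σ
  | .store i j =>
      match σ.point i with
      | some x => { σ with queryTape := σ.queryTape.set (σ.reg j) x }
      | none => σ
  | .label i r =>
      match σ.point i with
      | some x => { σ with queries := σ.queries + 1 }.setReg r (E.tree.label x).toNat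
      | none => σ
  | .sameLeaf i j r =>
      match σ.point i, σ.point j with
      | some x, some y => { σ with queries := σ.queries + 1 }.setReg r
          (if E.tree.leafOf x = E.tree.leafOf y then 1 else 0)
      | _, _ => σ
  | .compare i j c r =>
      match σ.point i, σ.point j with
      | some x, some y =>
          if h : σ.reg c < d then
            σ.setReg r (if x ⟨σ.reg c, h⟩ ≤ y ⟨σ.reg c, h⟩ then 1 else 0)
          else σ
      | _, _ => σ
  | .pushBit r => { σ with workTape := σ.workTape ++ [decide (σ.reg r ≠ 0)] }
  | .popBit => { σ with workTape := σ.workTape.dropLast }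
  | .readBit i r =>
      match σ.workTape[σ.reg i]? with
      | some z => σ.setReg r z.toNat
      | none => σ
  | .writeBit i r => { σ with workTape := σ.workTape.set (σ.reg i) (decide (σ.reg r ≠ 0)) }
  | .const r n => σ.setReg r n
  | .dim r => σ.setReg r d
  | .add r a b => σ.setReg r (σ.reg a + σ.reg b)
  | .sub r a b => σ.setReg r (σ.reg a - σ.reg b)

/-- The outcome of a test. -/
def Test.holds {d R : ℕ} (E : Env d) (σ : State d R) : Test R → Bool
  | .lt a b => decide (σ.reg a < σ.reg b)
  | .counters i => E.counterTest i σ.samples σ.queries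

/-- One step of the machine. The first component is the list of programs still to be executed; the
machine has halted when it is empty. -/
noncomputable def step {d R : ℕ} (E : Env d) :
    List (Prog R) × State d R → List (Prog R) × State d R
  | ([], σ) => ([], σ)
  | (.instr a :: K, σ) => (K, a.exec E σ)
  | (.seq p q :: K, σ) => (p :: q :: K, σ)
  | (.ite t p q :: K, σ) => ((if t.holds E σ then p else q) :: K, σ)
  | (.loop t p :: K, σ) => (if t.holds E σ then p :: .loop t p :: K else K, σ)

/-- The configuration after `n` steps of program `p` started in state `σ`. -/
noncomputable def run {d R : ℕ} (E : Env d) (p : Prog R) (σ : State d R) (n : ℕ) :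
    List (Prog R) × State d R :=
  (step E)^[n] ([p], σ)

/-- Program `p` started in state `σ` has halted after at most `n` steps. -/
def HaltsWithin {d R : ℕ} (E : Env d) (p : Prog R) (σ : State d R) (n : ℕ) : Prop :=
  (run E p σ n).1 = []

open Classical in
/-- The state in which program `p` started in `σ` halts, if it halts. -/
noncomputable def finalState {d R : ℕ} (E : Env d) (p : Prog R) (σ : State d R) :
    Option (State d R) :=
  if h : ∃ n, HaltsWithin E p σ n then some (run E p σ (Nat.find h)).2 else none

/-! ### Active learners -/

/-- An active learner: a program `train`, which draws samples and asks queries, and a program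
`classify`, which does neither and evaluates the resulting classifier. -/
structure Learner where
  numRegs : ℕ
  train : Prog numRegs
  classify : Prog numRegs
  out : Fin numRegs
  classify_oracleFree : classify.OracleFree

namespace Learner

variable (L : Learner) {d : ℕ} (E : Env d)

/-- The configuration after `n` steps of training. -/
noncomputable def config (n : ℕ) : List (Prog L.numRegs) × State d L.numRegs :=
  run E L.train State.init n

/-- The learned classifier, with `none` for "I don't know": `classify` is started with the memory
that training left behind and `x` appended to the query tape, and the result is read off the output
register (1 for label 0, 2 for label 1). If training does not halt, nothing is ever classified. -/
noncomputable def classifier (x : Fin d → ℝ) : Option Bool :=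
  match finalState E L.train State.init with
  | none => none
  | some σ =>
      match finalState E L.classify { σ with queryTape := σ.queryTape ++ [x] } with
      | none => none
      | some τ => if τ.reg L.out = 1 then some false else if τ.reg L.out = 2 then some true else none

/-- The number of queries asked during training. -/
noncomputable def queryCount : ℝ≥0∞ := ⨆ n : ℕ, ((L.config E n).2.queries : ℝ≥0∞)

/-- The number of steps that training takes, `∞` if it does not halt. -/
noncomputable def runningTime : ℝ≥0∞ :=
  ⨅ (n : ℕ) (_ : HaltsWithin E L.train State.init n), (n : ℝ≥0∞)

/-- The maximal memory in use at any time during training. -/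
noncomputable def memoryUsage : ℝ≥0∞ := ⨆ n : ℕ, ((L.config E n).2.memory : ℝ≥0∞)

/-- With the given counter tests, the learner RPU-learns decision trees over `ℝ^d` with accuracy `ε`
and confidence `δ`: for every distribution and every tree it is probably useful and reliable. -/
def RPULearns (counterTest : ℕ → ℕ → ℕ → Bool) (d : ℕ) (ε δ : ℝ) : Prop :=
  ∀ (D : Measure (Fin d → ℝ)) [IsProbabilityMeasure D] (T : DecisionTree d),
    Measure.infinitePi (fun _ : ℕ => D)
        {ω | D {x | L.classifier ⟨ω, T, counterTest⟩ x = none} > ENNReal.ofReal ε}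
      < ENNReal.ofReal δ ∧
    ∀ (ω : ℕ → Fin d → ℝ) (x : Fin d → ℝ),
      L.classifier ⟨ω, T, counterTest⟩ x ≠ none →
        L.classifier ⟨ω, T, counterTest⟩ x = some (T.label x)

end Learner

end LeafLearning

/-! A leaf of a decision tree is an intersection of axis-parallel half-spaces, so it contains the
bounding box of any of its points (`leafOf_eq_of_mem_box`). For each leaf met so far, the learner
keeps this box as `2d` sample points, a least and a greatest one per coordinate, together with one
label bit. It answers "don't know" outside the boxes; hence reliability and `O(ds)` memory hold for
every sequence of samples. A sample inside a stored box is discarded without a query. Any other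
sample is new: it costs one same-leaf query per known leaf and at most one label query, and it
enlarges or creates a box (`processProg_wp`).

New samples are rare by exchangeability. Among the first `t + 1` samples at most `2ds` would be new
if they came last, because each of them is strictly extreme within its leaf in one of `2d`
directions (`card_new_swap_le`). So sample `t` is new with probability at most `2ds/(t+1)`, and this
factor persists when intersecting with an event that is symmetric in these samples
(`measure_new_inter_le`).

Since `s` is unknown, the stopping rule uses windows. Window `k` starts after `2^k d n_k` samples
and has length `n_k`, about `(log(1/δ) + k)/ε`; the learner halts at its end if no sample in it was
new. If the boxes at the start miss mass more than `ε`, the window looks clean with probability at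
most `(1-ε)^(n_k) ≤ δ/2^(k+2)` (`measure_inHull_of_lt_le`), and these errors sum to `δ/2`.
Conversely, window `k` contains a new sample with probability at most `n_k · 2ds/(2^k d n_k) =
2s/2^k`. Such bounds multiply, because a later event is symmetric in the earlier samples
(`measure_fail_inter_le`).

For the queries, the harmonic sum up to the window with `2^k ≈ s` gives `O(ds log(s/(εδ)))` new
samples; later ones also require a failed window, so they contribute a geometric series
(`sum_measure_new_alive_le`). For the running time, one failed window only gives `2^-k`, against
sample counts that grow like `2^k`; two consecutive failures give `4^-k`, which is summable against
them (`measure_alive_le`).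

The program is verified by Hoare-style rules for `WP`, which carry a step bound and a memory
invariant. The result is that the learner halts exactly at the first time at which `Stops` holds
(`exists_path_of_alive`, `exists_path_of_stops`); from there on only the combinatorics of the sample
sequence matters. -/

namespace LeafLearning

/-! ### Executions with an invariant and a time bound -/

section Executions

variable {d R : ℕ} {E : Env d} {I : State d R → Prop}

/-- The machine goes from `a` to `b` in `n` steps, and all states on the way satisfy `I`. -/
def Path (E : Env d) (I : State d R → Prop) (a : List (Prog R) × State d R) (n : ℕ)
    (b : List (Prog R) × State d R) : Prop :=
  (step E)^[n] a = b ∧ ∀ j ≤ n, I ((step E)^[j] a).2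

theorem Path.refl {a : List (Prog R) × State d R} (h : I a.2) : Path E I a 0 a :=
  ⟨rfl, fun j hj => by obtain rfl : j = 0 := by omega
                       exact h⟩

theorem Path.trans {a b c : List (Prog R) × State d R} {m n : ℕ} (h₁ : Path E I a m b)
    (h₂ : Path E I b n c) : Path E I a (m + n) c := by
  refine ⟨by rw [Nat.add_comm, Function.iterate_add_apply, h₁.1, h₂.1], fun j hj => ?_⟩
  rcases le_total j m with h | h
  · exact h₁.2 j h
  · obtain ⟨i, rfl⟩ := Nat.exists_eq_add_of_le h
    rw [Nat.add_comm, Function.iterate_add_apply, h₁.1]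
    exact h₂.2 i (by omega)

theorem Path.single {a b : List (Prog R) × State d R} (h : step E a = b) (ha : I a.2)
    (hb : I b.2) : Path E I a 1 b := by
  refine ⟨h, fun j hj => ?_⟩
  rcases (by omega : j = 0 ∨ j = 1) with rfl | rfl
  · exact ha
  · simpa [h] using hb

theorem Path.start {a b : List (Prog R) × State d R} {n : ℕ} (h : Path E I a n b) : I a.2 :=
  h.2 0 (Nat.zero_le _)

theorem Path.finish {a b : List (Prog R) × State d R} {n : ℕ} (h : Path E I a n b) : I b.2 := by
  have := h.2 n le_rfl
  rwa [h.1] at this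

/-- Program `p` started in `σ` ends within `n` steps in a state that satisfies `Q`, and `I` holds
throughout. -/
def WP (E : Env d) (I : State d R → Prop) (p : Prog R) (σ : State d R) (n : ℕ)
    (Q : State d R → Prop) : Prop :=
  ∃ k ≤ n, ∃ τ, Q τ ∧ ∀ K, Path E I (p :: K, σ) k (K, τ)

variable {p q : Prog R} {σ : State d R} {n m : ℕ} {Q Q' : State d R → Prop}

theorem WP.mono (h : WP E I p σ n Q) (hn : n ≤ m) (hQ : ∀ τ, I τ → Q τ → Q' τ) :
    WP E I p σ m Q' := by
  obtain ⟨k, hk, τ, hτ, hp⟩ := h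
  exact ⟨k, hk.trans hn, τ, hQ τ (hp []).finish hτ, hp⟩

theorem WP.instr {a : Instr R} (h : I σ) (h' : I (a.exec E σ)) (hQ : Q (a.exec E σ)) :
    WP E I (.instr a) σ 1 Q :=
  ⟨1, le_rfl, _, hQ, fun _ => Path.single rfl h h'⟩

/-- Runs compose because `WP` asks for the same length and final state for every continuation `K`:
the run of `p` is used with `q :: K`. The extra step unfolds the sequence. -/
theorem WP.seq (h : WP E I p σ n fun τ => WP E I q τ m Q) : WP E I (.seq p q) σ (n + m + 1) Q := by
  obtain ⟨k, hk, τ, ⟨l, hl, υ, hυ, hq⟩, hp⟩ := h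
  refine ⟨1 + k + l, by omega, υ, hυ, fun K => ?_⟩
  have hI : I σ := (hp []).start
  exact ((Path.single rfl hI hI).trans (hp (q :: K))).trans (hq K)

theorem WP.seq_instr {a : Instr R} (h : WP E I (.instr a) σ 1 fun τ => WP E I q τ n Q) :
    WP E I (.seq (.instr a) q) σ (n + 2) Q :=
  (WP.seq h).mono (by omega) fun _ _ h => h

theorem WP.ite {t : Test R} (hI : I σ) (h₁ : t.holds E σ = true → WP E I p σ n Q)
    (h₂ : t.holds E σ = false → WP E I q σ n Q) : WP E I (.ite t p q) σ (n + 1) Q := by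
  have key : ∀ r : Prog R, (if t.holds E σ then p else q) = r → WP E I r σ n Q →
      WP E I (.ite t p q) σ (n + 1) Q := by
    rintro r hr ⟨k, hk, τ, hτ, hp⟩
    refine ⟨1 + k, by omega, τ, hτ, fun K => (Path.single ?_ hI hI).trans (hp K)⟩
    simp [step, ← hr]
  cases h : t.holds E σ
  · exact key q (by simp [h]) (h₂ h)
  · exact key p (by simp [h]) (h₁ h)

theorem Path.loop_iter {t : Test R} (hI : I σ) (ht : t.holds E σ = true) {τ : State d R} {k : ℕ}
    (hp : ∀ K, Path E I (p :: K, σ) k (K, τ)) (K : List (Prog R)) :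
    Path E I (.loop t p :: K, σ) (1 + k) (.loop t p :: K, τ) :=
  (Path.single (by simp [step, ht]) hI hI).trans (hp _)

theorem Path.loop_exit {t : Test R} (hI : I σ) (ht : t.holds E σ = false) (K : List (Prog R)) :
    Path E I (.loop t p :: K, σ) 1 (K, σ) :=
  Path.single (by simp [step, ht]) hI hI

/-- The invariant is indexed by the number of completed rounds, so the exact round count `N` is part
of the reasoning. Each round pays one step for its test, and the last failing test pays one more. -/
theorem WP.loop {t : Test R} {N : ℕ} (J : ℕ → State d R → Prop) (hI : I σ) (h0 : J 0 σ)
    (hstep : ∀ i < N, ∀ τ, I τ → J i τ → t.holds E τ = true ∧ WP E I p τ n (J (i + 1)))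
    (hend : ∀ τ, I τ → J N τ → t.holds E τ = false) :
    WP E I (.loop t p) σ (N * (n + 1) + 1) (J N) := by
  have key : ∀ i ≤ N, ∃ k ≤ i * (n + 1), ∃ τ, J i τ ∧
      ∀ K, Path E I (.loop t p :: K, σ) k (.loop t p :: K, τ) := by
    intro i
    induction i with
    | zero => exact fun _ => ⟨0, by simp, σ, h0, fun K => Path.refl hI⟩
    | succ i ih =>
      intro hi
      obtain ⟨k, hk, τ, hτ, hp⟩ := ih (by omega)
      obtain ⟨ht, l, hl, υ, hυ, hb⟩ := hstep i (by omega) τ (hp []).finish hτ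
      exact ⟨k + (1 + l), by rw [Nat.succ_mul]; omega, υ, hυ, fun K =>
        (hp K).trans (Path.loop_iter (hp []).finish ht hb K)⟩
  obtain ⟨k, hk, τ, hτ, hp⟩ := key N le_rfl
  exact ⟨k + 1, by omega, τ, hτ, fun K =>
    (hp K).trans (Path.loop_exit (hp []).finish (hend τ (hp []).finish hτ) K)⟩

theorem exec_queries_le (a : Instr R) (σ : State d R) : σ.queries ≤ (a.exec E σ).queries := by
  cases a <;> simp only [Instr.exec, State.setReg, le_refl] <;> split <;> (try split) <;> simp

theorem step_queries_le (a : List (Prog R) × State d R) : a.2.queries ≤ (step E a).2.queries := by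
  rcases a with ⟨_ | ⟨p, K⟩, σ⟩
  · rfl
  · cases p
    · exact exec_queries_le _ _
    all_goals exact le_rfl

/-- The query count at any time can thus be bounded by its value at a later time where an invariant
is known. -/
theorem iterate_queries_mono (a : List (Prog R) × State d R) :
    Monotone fun n => ((step E)^[n] a).2.queries :=
  monotone_nat_of_le_succ fun n => by
    simpa [Function.iterate_succ_apply'] using step_queries_le _

theorem iterate_halted (σ : State d R) (n : ℕ) : (step E)^[n] ([], σ) = ([], σ) :=
  Function.iterate_fixed rfl n

-- `finalState` looks at the first halting time, but a halted configuration is a fixed point of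
-- `step`, so any halting time shows the same state.
open Classical in
theorem finalState_eq {p : Prog R} {σ τ : State d R} {n : ℕ} (h : run E p σ n = ([], τ)) :
    finalState E p σ = some τ := by
  have hex : ∃ n, HaltsWithin E p σ n := ⟨n, by simp [HaltsWithin, h]⟩
  have hle : Nat.find hex ≤ n := Nat.find_min' hex (by simp [HaltsWithin, h])
  obtain ⟨m, hm⟩ := Nat.exists_eq_add_of_le hle
  have hspec : (run E p σ (Nat.find hex)).1 = [] := Nat.find_spec hex
  have : run E p σ n = run E p σ (Nat.find hex) := by
    rw [hm, run, Nat.add_comm, Function.iterate_add_apply]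
    change (step E)^[m] (run E p σ (Nat.find hex)) = _
    generalize run E p σ (Nat.find hex) = b at hspec
    obtain ⟨b1, b2⟩ := b
    obtain rfl : b1 = [] := hspec
    exact iterate_halted _ _
  rw [finalState, dif_pos hex, ← this, h]

theorem WP.finalState (h : WP E I p σ n Q) : ∃ τ, Q τ ∧ finalState E p σ = some τ := by
  obtain ⟨k, -, τ, hτ, hp⟩ := h
  exact ⟨τ, hτ, finalState_eq (hp []).1⟩

end Executions

/-! ### Bounded states -/

section Bounded

variable {d R : ℕ} {E : Env d}

/-- Tapes have length at most `B`, registers hold numbers up to `B`. -/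
structure Bdd (B : ℕ) (σ : State d R) : Prop where
  query : σ.queryTape.length ≤ B
  work : σ.workTape.length ≤ B
  reg : ∀ r, σ.reg r ≤ B

/-- Charging a register by its content instead of its binary length is affordable: there are
boundedly many registers, and `B` will be of order `ds`. -/
theorem Bdd.memory_le {B : ℕ} {σ : State d R} (h : Bdd B σ) : σ.memory ≤ (R + 2) * B := by
  have : ∑ r, Nat.size (σ.reg r) ≤ ∑ _r : Fin R, B :=
    Finset.sum_le_sum fun r _ => (Nat.size_le.2 (Nat.lt_two_pow_self)).trans (h.reg r)
  simp only [Finset.sum_const, Finset.card_univ, Fintype.card_fin, smul_eq_mul] at this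
  have := h.query
  have := h.work
  rw [State.memory]
  linarith

@[simp] theorem setReg_queryTape (σ : State d R) (r : Fin R) (v : ℕ) :
    (σ.setReg r v).queryTape = σ.queryTape := rfl
@[simp] theorem setReg_workTape (σ : State d R) (r : Fin R) (v : ℕ) :
    (σ.setReg r v).workTape = σ.workTape := rfl
@[simp] theorem setReg_samples (σ : State d R) (r : Fin R) (v : ℕ) :
    (σ.setReg r v).samples = σ.samples := rfl
@[simp] theorem setReg_queries (σ : State d R) (r : Fin R) (v : ℕ) :
    (σ.setReg r v).queries = σ.queries := rfl
@[simp] theorem setReg_reg (σ : State d R) (r : Fin R) (v : ℕ) (r' : Fin R) :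
    (σ.setReg r v).reg r' = if r' = r then v else σ.reg r' := by
  simp [State.setReg, Function.update_apply]

theorem Bdd.setReg {B : ℕ} {σ : State d R} (h : Bdd B σ) {v : ℕ} (hv : v ≤ B) (r : Fin R) :
    Bdd B (σ.setReg r v) :=
  ⟨h.query, h.work, fun r' => by
    rw [setReg_reg]; split_ifs
    exacts [hv, h.reg r']⟩

/-! ### Rules for single instructions under the memory bound -/

variable {B : ℕ} {σ : State d R} {Q : State d R → Prop}

theorem wp_const {r : Fin R} {v : ℕ} (hB : Bdd B σ) (hv : v ≤ B)
    (h : Bdd B (σ.setReg r v) → Q (σ.setReg r v)) :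
    WP E (Bdd B) (.instr (.const r v)) σ 1 Q :=
  WP.instr hB (hB.setReg hv r) (h (hB.setReg hv r))

/-- The new content is a separate `v` so that each use can supply a simplified expression; otherwise
register contents would pile up as nested updates. -/
theorem wp_add {r a b : Fin R} (hB : Bdd B σ) (v : ℕ) (hv : σ.reg a + σ.reg b = v) (hvB : v ≤ B)
    (h : Bdd B (σ.setReg r v) → Q (σ.setReg r v)) :
    WP E (Bdd B) (.instr (.add r a b)) σ 1 Q := by
  subst hv
  exact WP.instr hB (hB.setReg hvB r) (h (hB.setReg hvB r))

theorem wp_sub {r a b : Fin R} (hB : Bdd B σ) (v : ℕ) (hv : σ.reg a - σ.reg b = v)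
    (h : Bdd B (σ.setReg r v) → Q (σ.setReg r v)) :
    WP E (Bdd B) (.instr (.sub r a b)) σ 1 Q := by
  subst hv
  have := hB.setReg ((Nat.sub_le (σ.reg a) (σ.reg b)).trans (hB.reg a)) r
  exact WP.instr hB this (h this)

/-- The answer is an abstract `v ≤ 1` with a characterization of `v = 1`, which avoids a case
distinction until the answer is used. -/
theorem wp_compare {i j c r : Fin R} {x y : Fin d → ℝ} (hB : Bdd B σ) (hB1 : 1 ≤ B)
    (hx : σ.queryTape[σ.reg i]? = some x) (hy : σ.queryTape[σ.reg j]? = some y) (k : Fin d)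
    (hk : σ.reg c = k)
    (h : ∀ v ≤ 1, (v = 1 ↔ x k ≤ y k) → Bdd B (σ.setReg r v) → Q (σ.setReg r v)) :
    WP E (Bdd B) (.instr (.compare i j c r)) σ 1 Q := by
  have hlt : σ.reg c < d := hk ▸ k.2
  have hk' : (⟨σ.reg c, hlt⟩ : Fin d) = k := Fin.ext hk
  have he : (Instr.compare i j c r).exec E σ = σ.setReg r (if x k ≤ y k then 1 else 0) := by
    simp only [Instr.exec, State.point, hx, hy, hlt, dif_pos, hk']
  have h1 : (if x k ≤ y k then 1 else 0) ≤ 1 := by split_ifs <;> simp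
  have hb := hB.setReg (h1.trans hB1) r
  refine WP.instr hB (he ▸ hb) (he ▸ h _ h1 ?_ hb)
  split_ifs with hle <;> simp [hle]

theorem wp_sameLeaf {i j r : Fin R} {x y : Fin d → ℝ} (hB : Bdd B σ) (hB1 : 1 ≤ B)
    (hx : σ.queryTape[σ.reg i]? = some x) (hy : σ.queryTape[σ.reg j]? = some y)
    (h : ∀ v ≤ 1, (v = 1 ↔ E.tree.leafOf x = E.tree.leafOf y) →
      Bdd B ({ σ with queries := σ.queries + 1 }.setReg r v) →
      Q ({ σ with queries := σ.queries + 1 }.setReg r v)) :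
    WP E (Bdd B) (.instr (.sameLeaf i j r)) σ 1 Q := by
  classical
  have he : (Instr.sameLeaf i j r).exec E σ = { σ with queries := σ.queries + 1 }.setReg r
      (if E.tree.leafOf x = E.tree.leafOf y then 1 else 0) := by
    simp only [Instr.exec, State.point, hx, hy]
  have h1 : (if E.tree.leafOf x = E.tree.leafOf y then 1 else 0) ≤ 1 := by split_ifs <;> simp
  have hb : Bdd B { σ with queries := σ.queries + 1 } := ⟨hB.query, hB.work, hB.reg⟩
  have hb := hb.setReg (h1.trans hB1) r
  refine WP.instr hB (he ▸ hb) (he ▸ h _ h1 ?_ hb)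
  split_ifs with hle <;> simp [hle]

theorem wp_label {i r : Fin R} {x : Fin d → ℝ} (hB : Bdd B σ) (hB1 : 1 ≤ B)
    (hx : σ.queryTape[σ.reg i]? = some x)
    (h : Bdd B ({ σ with queries := σ.queries + 1 }.setReg r (E.tree.label x).toNat) →
      Q ({ σ with queries := σ.queries + 1 }.setReg r (E.tree.label x).toNat)) :
    WP E (Bdd B) (.instr (.label i r)) σ 1 Q := by
  have he : (Instr.label i r).exec E σ =
      { σ with queries := σ.queries + 1 }.setReg r (E.tree.label x).toNat := by
    simp only [Instr.exec, State.point, hx]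
  have hb : Bdd B { σ with queries := σ.queries + 1 } := ⟨hB.query, hB.work, hB.reg⟩
  have hb := hb.setReg ((Bool.toNat_le (E.tree.label x)).trans hB1) r
  exact WP.instr hB (he ▸ hb) (he ▸ h hb)

theorem wp_store {i j : Fin R} {x : Fin d → ℝ} (hB : Bdd B σ)
    (hx : σ.queryTape[σ.reg i]? = some x)
    (h : Bdd B { σ with queryTape := σ.queryTape.set (σ.reg j) x } →
      Q { σ with queryTape := σ.queryTape.set (σ.reg j) x }) :
    WP E (Bdd B) (.instr (.store i j)) σ 1 Q := by
  have he : (Instr.store i j).exec E σ =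
      { σ with queryTape := σ.queryTape.set (σ.reg j) x } := by
    simp only [Instr.exec, State.point, hx]
  have hb : Bdd B { σ with queryTape := σ.queryTape.set (σ.reg j) x } :=
    ⟨by simpa using hB.query, hB.work, hB.reg⟩
  exact WP.instr hB (he ▸ hb) (he ▸ h hb)

theorem wp_copy {i : Fin R} {x : Fin d → ℝ} (hB : Bdd B σ) (hl : σ.queryTape.length + 1 ≤ B)
    (hx : σ.queryTape[σ.reg i]? = some x)
    (h : Bdd B { σ with queryTape := σ.queryTape ++ [x] } →
      Q { σ with queryTape := σ.queryTape ++ [x] }) :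
    WP E (Bdd B) (.instr (.copy i)) σ 1 Q := by
  have he : (Instr.copy i).exec E σ = { σ with queryTape := σ.queryTape ++ [x] } := by
    simp only [Instr.exec, State.point, hx]
  have hb : Bdd B { σ with queryTape := σ.queryTape ++ [x] } :=
    ⟨by simpa using hl, hB.work, hB.reg⟩
  exact WP.instr hB (he ▸ hb) (he ▸ h hb)

theorem wp_sample (hB : Bdd B σ) (hl : σ.queryTape.length + 1 ≤ B)
    (h : Bdd B { σ with queryTape := σ.queryTape ++ [E.stream σ.samples]
                        samples := σ.samples + 1 } →
      Q { σ with queryTape := σ.queryTape ++ [E.stream σ.samples], samples := σ.samples + 1 }) :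
    WP E (Bdd B) (.instr .sample) σ 1 Q := by
  have hb : Bdd B { σ with queryTape := σ.queryTape ++ [E.stream σ.samples]
                           samples := σ.samples + 1 } :=
    ⟨by simpa using hl, hB.work, hB.reg⟩
  exact WP.instr hB hb (h hb)

theorem wp_remove {i : Fin R} (hB : Bdd B σ)
    (h : Bdd B { σ with queryTape := σ.queryTape.eraseIdx (σ.reg i) } →
      Q { σ with queryTape := σ.queryTape.eraseIdx (σ.reg i) }) :
    WP E (Bdd B) (.instr (.remove i)) σ 1 Q := by
  have hb : Bdd B { σ with queryTape := σ.queryTape.eraseIdx (σ.reg i) } :=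
    ⟨(List.length_eraseIdx_le _ _).trans hB.query, hB.work, hB.reg⟩
  exact WP.instr hB hb (h hb)

theorem wp_pushBit {r : Fin R} (hB : Bdd B σ) (hl : σ.workTape.length + 1 ≤ B)
    (h : Bdd B { σ with workTape := σ.workTape ++ [decide (σ.reg r ≠ 0)] } →
      Q { σ with workTape := σ.workTape ++ [decide (σ.reg r ≠ 0)] }) :
    WP E (Bdd B) (.instr (.pushBit r)) σ 1 Q := by
  have hb : Bdd B { σ with workTape := σ.workTape ++ [decide (σ.reg r ≠ 0)] } :=
    ⟨hB.query, by simpa using hl, hB.reg⟩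
  exact WP.instr hB hb (h hb)

theorem wp_readBit {i r : Fin R} {z : Bool} (hB : Bdd B σ) (hB1 : 1 ≤ B)
    (hz : σ.workTape[σ.reg i]? = some z)
    (h : Bdd B (σ.setReg r z.toNat) → Q (σ.setReg r z.toNat)) :
    WP E (Bdd B) (.instr (.readBit i r)) σ 1 Q := by
  have he : (Instr.readBit i r).exec E σ = σ.setReg r z.toNat := by
    simp only [Instr.exec, hz]
  have hb := hB.setReg ((Bool.toNat_le z).trans hB1) r
  exact WP.instr hB (he ▸ hb) (he ▸ h hb)

end Bounded

/-! ### Leaves of decision trees are boxes -/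

section Leaves

variable {d : ℕ}

namespace DecisionTree

theorem size_pos (T : DecisionTree d) : 1 ≤ T.size := by
  cases T with
  | leaf z => exact le_rfl
  | nodeGe i b p q => exact (size_pos p).trans (Nat.le_add_right _ _)
  | nodeLe i b p q => exact (size_pos p).trans (Nat.le_add_right _ _)

/-- The set of names of leaves. -/
def leafNames : DecisionTree d → Finset (List Bool)
  | leaf _ => {[]}
  | nodeGe _ _ p q => p.leafNames.image (List.cons true) ∪ q.leafNames.image (List.cons false)
  | nodeLe _ _ p q => p.leafNames.image (List.cons true) ∪ q.leafNames.image (List.cons false)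

theorem card_leafNames_le (T : DecisionTree d) : T.leafNames.card ≤ T.size := by
  induction T with
  | leaf z => simp [leafNames, size]
  | nodeGe i b p q hp hq =>
    exact (Finset.card_union_le _ _).trans
      (Nat.add_le_add (Finset.card_image_le.trans hp) (Finset.card_image_le.trans hq))
  | nodeLe i b p q hp hq =>
    exact (Finset.card_union_le _ _).trans
      (Nat.add_le_add (Finset.card_image_le.trans hp) (Finset.card_image_le.trans hq))

theorem leafOf_mem_leafNames (T : DecisionTree d) (x : Fin d → ℝ) :
    T.leafOf x ∈ T.leafNames := by
  induction T with
  | leaf z => simp [leafNames, leafOf]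
  | nodeGe i b p q hp hq => simp only [leafNames, leafOf]; split_ifs <;> simp [hp, hq]
  | nodeLe i b p q hp hq => simp only [leafNames, leafOf]; split_ifs <;> simp [hp, hq]

theorem label_eq_of_leafOf_eq (T : DecisionTree d) {x y : Fin d → ℝ}
    (h : T.leafOf x = T.leafOf y) : T.label x = T.label y := by
  induction T with
  | leaf z => rfl
  | nodeGe i b p q hp hq =>
    simp only [leafOf, label] at h ⊢
    split_ifs at h ⊢ <;> simp_all
  | nodeLe i b p q hp hq =>
    simp only [leafOf, label] at h ⊢
    split_ifs at h ⊢ <;> simp_all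

/-- At a node with test `x i ≥ b`, a positive answer for `x` is shared by the witness above `x` in
coordinate `i`, and a negative one by the witness below; for `≤` the roles are exchanged. Hence `l`
starts with the answer of `x`, all witnesses descend into the same subtree, and induction applies.
Some coordinate is needed to have a witness at a leaf. -/
theorem leafOf_eq_of_mem_box (T : DecisionTree d) (hd : 1 ≤ d) {x : Fin d → ℝ} {l : List Bool}
    (h : ∀ c, (∃ y, T.leafOf y = l ∧ y c ≤ x c) ∧ ∃ y, T.leafOf y = l ∧ x c ≤ y c) :
    T.leafOf x = l := by
  induction T generalizing l with
  | leaf z =>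
    obtain ⟨⟨y, hy, -⟩, -⟩ := h ⟨0, hd⟩
    simpa [leafOf] using hy
  | nodeGe i b p q hp hq =>
    have hi := h i
    simp only [leafOf] at h hi ⊢
    split_ifs with hx
    · obtain ⟨y, hy, hyx⟩ := hi.2
      rw [if_pos (ge_trans hyx hx)] at hy
      subst hy
      rw [hp (l := p.leafOf y)]
      refine fun c => ⟨?_, ?_⟩
      · obtain ⟨z, hz, hzx⟩ := (h c).1
        split_ifs at hz <;> simp at hz
        exact ⟨z, hz, hzx⟩
      · obtain ⟨z, hz, hzx⟩ := (h c).2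
        split_ifs at hz <;> simp at hz
        exact ⟨z, hz, hzx⟩
    · obtain ⟨y, hy, hyx⟩ := hi.1
      rw [if_neg fun hh => hx (ge_trans hyx hh)] at hy
      subst hy
      rw [hq (l := q.leafOf y)]
      refine fun c => ⟨?_, ?_⟩
      · obtain ⟨z, hz, hzx⟩ := (h c).1
        split_ifs at hz <;> simp at hz
        exact ⟨z, hz, hzx⟩
      · obtain ⟨z, hz, hzx⟩ := (h c).2
        split_ifs at hz <;> simp at hz
        exact ⟨z, hz, hzx⟩
  | nodeLe i b p q hp hq =>
    have hi := h i
    simp only [leafOf] at h hi ⊢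
    split_ifs with hx
    · obtain ⟨y, hy, hyx⟩ := hi.1
      rw [if_pos (hyx.trans hx)] at hy
      subst hy
      rw [hp (l := p.leafOf y)]
      refine fun c => ⟨?_, ?_⟩
      · obtain ⟨z, hz, hzx⟩ := (h c).1
        split_ifs at hz <;> simp at hz
        exact ⟨z, hz, hzx⟩
      · obtain ⟨z, hz, hzx⟩ := (h c).2
        split_ifs at hz <;> simp at hz
        exact ⟨z, hz, hzx⟩
    · obtain ⟨y, hy, hyx⟩ := hi.2
      rw [if_neg fun hh => hx (hyx.trans hh)] at hy
      subst hy
      rw [hq (l := q.leafOf y)]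
      refine fun c => ⟨?_, ?_⟩
      · obtain ⟨z, hz, hzx⟩ := (h c).1
        split_ifs at hz <;> simp at hz
        exact ⟨z, hz, hzx⟩
      · obtain ⟨z, hz, hzx⟩ := (h c).2
        split_ifs at hz <;> simp at hz
        exact ⟨z, hz, hzx⟩

end DecisionTree

variable {T : DecisionTree d} {S : Set (Fin d → ℝ)} {x : Fin d → ℝ}

/-- `x` lies in the bounding box of the points of `S` that share its leaf. -/
def InHull (T : DecisionTree d) (S : Set (Fin d → ℝ)) (x : Fin d → ℝ) : Prop :=
  ∀ c, (∃ y ∈ S, T.leafOf y = T.leafOf x ∧ y c ≤ x c) ∧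
    ∃ y ∈ S, T.leafOf y = T.leafOf x ∧ x c ≤ y c

theorem InHull.mono {S' : Set (Fin d → ℝ)} (h : InHull T S x) (hS : S ⊆ S') : InHull T S' x :=
  fun c => ⟨(h c).1.imp fun _ hy => ⟨hS hy.1, hy.2⟩, (h c).2.imp fun _ hy => ⟨hS hy.1, hy.2⟩⟩

theorem InHull.exists_leafOf_eq (hd : 1 ≤ d) (h : InHull T S x) :
    ∃ y ∈ S, T.leafOf y = T.leafOf x :=
  (h ⟨0, hd⟩).1.imp fun _ hy => ⟨hy.1, hy.2.1⟩

/-! ### Storing the bounding boxes of the known leaves -/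

/-- Cell `j` holds a point of `S` in leaf `l` whose coordinate `c` is least. -/
def LowOK (T : DecisionTree d) (S : Set (Fin d → ℝ)) (tape : List (Fin d → ℝ)) (l : List Bool)
    (c : Fin d) (j : ℕ) : Prop :=
  ∃ y, tape[j]? = some y ∧ y ∈ S ∧ T.leafOf y = l ∧ ∀ z ∈ S, T.leafOf z = l → y c ≤ z c

/-- Cell `j` holds a point of `S` in leaf `l` whose coordinate `c` is greatest. -/
def HighOK (T : DecisionTree d) (S : Set (Fin d → ℝ)) (tape : List (Fin d → ℝ)) (l : List Bool)
    (c : Fin d) (j : ℕ) : Prop :=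
  ∃ y, tape[j]? = some y ∧ y ∈ S ∧ T.leafOf y = l ∧ ∀ z ∈ S, T.leafOf z = l → z c ≤ y c

/-- The block of cells that starts at `base` stores the range of coordinate `c` on leaf `l`. -/
def SlotOK (T : DecisionTree d) (S : Set (Fin d → ℝ)) (tape : List (Fin d → ℝ)) (l : List Bool)
    (base : ℕ) (c : Fin d) : Prop :=
  LowOK T S tape l c (base + 2 * c) ∧ HighOK T S tape l c (base + 2 * c + 1)

theorem SlotOK.congr {tape tape' : List (Fin d → ℝ)} {l : List Bool} {base : ℕ} {c : Fin d}
    (h : SlotOK T S tape l base c) (h₁ : tape'[base + 2 * c]? = tape[base + 2 * c]?)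
    (h₂ : tape'[base + 2 * c + 1]? = tape[base + 2 * c + 1]?) : SlotOK T S tape' l base c := by
  rwa [SlotOK, LowOK, HighOK, h₁, h₂]

theorem SlotOK.insert_of_ne {tape : List (Fin d → ℝ)} {l : List Bool} {base : ℕ} {c : Fin d}
    (h : SlotOK T S tape l base c) (hx : T.leafOf x ≠ l) : SlotOK T (insert x S) tape l base c := by
  obtain ⟨⟨y, h1, h2, h3, h4⟩, w, k1, k2, k3, k4⟩ := h
  refine ⟨⟨y, h1, .inr h2, h3, ?_⟩, w, k1, .inr k2, k3, ?_⟩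
  · rintro z (rfl | hz) hzl
    exacts [absurd hzl hx, h4 z hz hzl]
  · rintro z (rfl | hz) hzl
    exacts [absurd hzl hx, k4 z hz hzl]

/-- A point in the hull is dominated on both sides by older points of its leaf, so minima and maxima
stay what they are. This is why the learner may discard it. -/
theorem SlotOK.insert_of_inHull {tape : List (Fin d → ℝ)} {l : List Bool} {base : ℕ} {c : Fin d}
    (h : SlotOK T S tape l base c) (hx : InHull T S x) : SlotOK T (insert x S) tape l base c := by
  obtain ⟨⟨y, h1, h2, h3, h4⟩, w, k1, k2, k3, k4⟩ := h
  refine ⟨⟨y, h1, .inr h2, h3, ?_⟩, w, k1, .inr k2, k3, ?_⟩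
  · rintro z (rfl | hz) hzl
    · obtain ⟨u, hu, hul, huz⟩ := (hx c).1
      exact (h4 u hu (hul.trans hzl)).trans huz
    · exact h4 z hz hzl
  · rintro z (rfl | hz) hzl
    · obtain ⟨u, hu, hul, huz⟩ := (hx c).2
      exact huz.trans (k4 u hu (hul.trans hzl))
    · exact k4 z hz hzl

end Leaves

/-! ### Searching the stored boxes for a point -/

notation "rOne" => (0 : Fin 14)
notation "rDim" => (1 : Fin 14)
notation "rWidth" => (2 : Fin 14)
notation "rLen" => (3 : Fin 14)
notation "rFin" => (4 : Fin 14)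
notation "rDirty" => (5 : Fin 14)
notation "rHit" => (6 : Fin 14)
notation "rBase" => (7 : Fin 14)
notation "rBlock" => (8 : Fin 14)
notation "rCoord" => (9 : Fin 14)
notation "rPos" => (10 : Fin 14)
notation "rMiss" => (11 : Fin 14)
notation "rTmp" => (12 : Fin 14)
notation "rOut" => (13 : Fin 14)
infixr:60 " ;; " => Prog.seq

/-- A program that does nothing relevant. -/
def skipProg : Prog 14 := .instr (.const rTmp 0)

/-- Compares one coordinate of the point in cell `rLen` with the range stored at `rPos`. -/
def checkBody : Prog 14 :=
  .instr (.compare rPos rLen rCoord rTmp) ;; .instr (.sub rTmp rOne rTmp) ;;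
  .instr (.add rMiss rMiss rTmp) ;; .instr (.add rPos rPos rOne) ;;
  .instr (.compare rLen rPos rCoord rTmp) ;; .instr (.sub rTmp rOne rTmp) ;;
  .instr (.add rMiss rMiss rTmp) ;; .instr (.add rPos rPos rOne) ;;
  .instr (.add rCoord rCoord rOne)

/-- Looks for a stored box that contains the point in cell `rLen`. Afterwards `rHit` is `0` if there
is none, and one more than the number of such a box otherwise. -/
def searchProg : Prog 14 :=
  .instr (.const rHit 0) ;; .instr (.const rBase 0) ;; .instr (.const rBlock 0) ;;
  .loop (.lt rBase rLen)
    (.instr (.const rCoord 0) ;; .instr (.add rPos rBase rCoord) ;; .instr (.const rMiss 0) ;;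
      .loop (.lt rCoord rDim) checkBody ;;
      .instr (.add rBlock rBlock rOne) ;;
      .ite (.lt rMiss rOne) (.instr (.add rHit rBlock rMiss)) skipProg ;;
      .instr (.add rBase rBase rWidth))

section Search

variable {d : ℕ} {E : Env d} {B : ℕ}

/-- The tapes, the counters and the registers with number below `m` are the same. -/
structure Same (m : ℕ) (σ τ : State d 14) : Prop where
  query : τ.queryTape = σ.queryTape
  work : τ.workTape = σ.workTape
  samples : τ.samples = σ.samples
  queries : τ.queries = σ.queries
  reg : ∀ r : Fin 14, (r : ℕ) < m → τ.reg r = σ.reg r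

theorem Same.refl (m : ℕ) (σ : State d 14) : Same m σ σ := ⟨rfl, rfl, rfl, rfl, fun _ _ => rfl⟩

theorem Same.trans {m : ℕ} {σ τ υ : State d 14} (h : Same m σ τ) (h' : Same m τ υ) : Same m σ υ :=
  ⟨h'.query.trans h.query, h'.work.trans h.work, h'.samples.trans h.samples,
    h'.queries.trans h.queries, fun r hr => (h'.reg r hr).trans (h.reg r hr)⟩

theorem Same.mono {m n : ℕ} {σ τ : State d 14} (h : Same m σ τ) (hn : n ≤ m) : Same n σ τ :=
  ⟨h.query, h.work, h.samples, h.queries, fun r hr => h.reg r (hr.trans_le hn)⟩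

theorem Same.setReg {m : ℕ} {σ τ : State d 14} (h : Same m σ τ) {r : Fin 14} (hr : m ≤ (r : ℕ))
    (v : ℕ) : Same m σ (τ.setReg r v) :=
  ⟨h.query, h.work, h.samples, h.queries, fun r' hr' => by
    rw [setReg_reg, if_neg (by rintro rfl; omega), h.reg r' hr']⟩

/-- The registers with fixed contents. -/
structure Fixed (N : ℕ) (σ : State d 14) : Prop where
  one : σ.reg rOne = 1
  dim : σ.reg rDim = d
  width : σ.reg rWidth = 2 * d
  len : σ.reg rLen = N

theorem Fixed.same {N m : ℕ} {σ τ : State d 14} (h : Fixed N σ) (hs : Same m σ τ) (hm : 4 ≤ m) :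
    Fixed N τ :=
  ⟨(hs.reg 0 (by simp; omega)).trans h.one, (hs.reg 1 (by simp; omega)).trans h.dim,
    (hs.reg 2 (by simp; omega)).trans h.width, (hs.reg 3 (by simp; omega)).trans h.len⟩

/-- State of the loop over the coordinates. -/
structure CheckInv (σ : State d 14) (base : ℕ) (x : Fin d → ℝ) (lo hi : Fin d → Fin d → ℝ) (i : ℕ)
    (τ : State d 14) : Prop where
  same : Same 9 σ τ
  coord : τ.reg rCoord = i
  pos : τ.reg rPos = base + 2 * i
  miss_le : τ.reg rMiss ≤ 2 * i
  miss : τ.reg rMiss = 0 ↔ ∀ c : Fin d, (c : ℕ) < i → lo c c ≤ x c ∧ x c ≤ hi c c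

/-- The ends of a range are stored as whole points, since the machine cannot store reals; only
coordinate `c` of `lo c` and `hi c` matters. `rMiss` counts the comparisons that fail. -/
theorem checkBody_wp {σ : State d 14} {base N : ℕ} {x : Fin d → ℝ} {lo hi : Fin d → Fin d → ℝ}
    (hF : Fixed N σ) (hbase : base + 2 * d ≤ N) (hNB : N + 1 ≤ B)
    (hx : σ.queryTape[N]? = some x)
    (hlo : ∀ c : Fin d, σ.queryTape[base + 2 * c]? = some (lo c))
    (hhi : ∀ c : Fin d, σ.queryTape[base + 2 * c + 1]? = some (hi c)) {i : ℕ} (hi' : i < d)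
    {τ : State d 14} (hB : Bdd B τ) (h : CheckInv σ base x lo hi i τ) :
    WP E (Bdd B) checkBody τ 17 (CheckInv σ base x lo hi (i + 1)) := by
  have hF' := hF.same h.same (by norm_num)
  obtain ⟨hs, hc, hp, hml, hm⟩ := h
  have hone := hF'.one
  have hlen := hF'.len
  rw [← hs.query] at hx hlo hhi
  have hlo' := hlo ⟨i, hi'⟩
  have hhi' := hhi ⟨i, hi'⟩
  simp only at hlo' hhi'
  unfold checkBody
  refine WP.seq_instr (wp_compare (k := ⟨i, hi'⟩) hB (by omega) (by rw [hp]; exact hlo')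
    (by rw [hlen]; exact hx) (by simp [hc]) fun v hv hvx hB => ?_)
  refine WP.seq_instr (wp_sub hB (1 - v) (by simp [hone]) fun hB => ?_)
  refine WP.seq_instr (wp_add hB (τ.reg rMiss + (1 - v)) (by simp) (by omega) fun hB => ?_)
  refine WP.seq_instr (wp_add hB (base + 2 * i + 1) (by simp [hone, hp]) (by omega) fun hB => ?_)
  refine WP.seq_instr (wp_compare (k := ⟨i, hi'⟩) (x := x) (y := hi ⟨i, hi'⟩) hB (by omega)
    (by simp [hlen, hx]) (by simp [hhi']) (by simp [hc]) fun w hw hwx hB => ?_)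
  refine WP.seq_instr (wp_sub hB (1 - w) (by simp [hone]) fun hB => ?_)
  refine WP.seq_instr (wp_add hB (τ.reg rMiss + (1 - v) + (1 - w)) (by simp) (by omega)
    fun hB => ?_)
  refine WP.seq_instr (wp_add hB (base + 2 * (i + 1)) (by simp [hone]; ring) (by omega)
    fun hB => ?_)
  refine wp_add hB (i + 1) (by simp [hone, hc]) (by omega) fun hB => ?_
  refine ⟨?_, by simp, by simp, by simp; omega, ?_⟩
  · exact ((((((((hs.setReg (by decide) _).setReg (by decide) _).setReg (by decide) _).setReg
      (by decide) _).setReg (by decide) _).setReg (by decide) _).setReg (by decide) _).setReg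
      (by decide) _).setReg (by decide) _
  · simp only [setReg_reg]
    simp only [Fin.reduceEq, if_true, if_false]
    constructor
    · intro h0 c hci
      rcases Nat.lt_succ_iff_lt_or_eq.1 hci with hlt | heq
      · exact hm.1 (by omega) c hlt
      · obtain rfl : c = ⟨i, hi'⟩ := Fin.ext heq
        exact ⟨hvx.1 (by omega), hwx.1 (by omega)⟩
    · intro hall
      have h1 := hm.2 fun c hci => hall c (by omega)
      have h2 := hall ⟨i, hi'⟩ (by simp)
      have := hvx.2 h2.1
      have := hwx.2 h2.2
      omega

/-- State of the loop over the stored boxes. -/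
structure SearchInv (T : DecisionTree d) (S : Set (Fin d → ℝ)) (leaves : List (List Bool))
    (x : Fin d → ℝ) (σ : State d 14) (b : ℕ) (τ : State d 14) : Prop where
  same : Same 6 σ τ
  base : τ.reg rBase = 2 * d * b
  block : τ.reg rBlock = b
  miss : τ.reg rHit = 0 → ∀ b' < b, leaves[b']? = some (T.leafOf x) → ¬ InHull T S x
  hit : ∀ b', τ.reg rHit = b' + 1 → b' < b ∧ leaves[b']? = some (T.leafOf x) ∧ InHull T S x

/-- Membership in the hull involves the unknown leaf of `x`, yet it is decided by coordinate
comparisons alone: a box that contains `x` must be the box of the leaf of `x`. -/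
theorem searchProg_wp {T : DecisionTree d} {S : Set (Fin d → ℝ)} {leaves : List (List Bool)}
    {x : Fin d → ℝ} {σ : State d 14} (hd : 1 ≤ d) (hB : Bdd B σ)
    (hF : Fixed (2 * d * leaves.length) σ) (hNB : 2 * d * leaves.length + 2 * d + 1 ≤ B)
    (hx : σ.queryTape[2 * d * leaves.length]? = some x)
    (hmem : ∀ y ∈ S, T.leafOf y ∈ leaves)
    (hslot : ∀ (b : ℕ) (l : List Bool), leaves[b]? = some l →
      ∀ c, SlotOK T S σ.queryTape l (2 * d * b) c) :
    WP E (Bdd B) searchProg σ (leaves.length * (18 * d + 15) + 7) fun τ =>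
      Same 6 σ τ ∧ (τ.reg rHit = 0 → ¬ InHull T S x) ∧
        ∀ b, τ.reg rHit = b + 1 → leaves[b]? = some (T.leafOf x) ∧ InHull T S x := by
  unfold searchProg
  refine WP.seq_instr (wp_const hB (by omega) fun hB => ?_)
  refine WP.seq_instr (wp_const hB (by omega) fun hB => ?_)
  refine WP.seq_instr (wp_const hB (by omega) fun hB => ?_)
  refine WP.mono (n := leaves.length * (18 * d + 14 + 1) + 1)
    (WP.loop (SearchInv T S leaves x σ) hB ?_ ?_ ?_) le_rfl ?_
  · exact ⟨(((Same.refl 6 σ).setReg (by decide) _).setReg (by decide) _).setReg (by decide) _,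
      by simp, by simp, by simp, by simp⟩
  · intro b hb τ hB h
    have hF' := hF.same h.same (by norm_num)
    obtain ⟨l, hl⟩ : ∃ l, leaves[b]? = some l := ⟨leaves[b], by simp [hb]⟩
    have hbl : 2 * d * b + 2 * d ≤ 2 * d * leaves.length := by
      have := Nat.mul_le_mul_left (2 * d) (Nat.succ_le_of_lt hb)
      rwa [Nat.mul_succ] at this
    have hkl : leaves.length ≤ 2 * d * leaves.length := Nat.le_mul_of_pos_left _ (by omega)
    refine ⟨by simp [Test.holds, h.base, hF'.len]; omega, ?_⟩
    choose lo hlo using fun c => (hslot b l hl c).1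
    choose hi hhi using fun c => (hslot b l hl c).2
    refine WP.seq_instr (wp_const hB (by omega) fun hB => ?_)
    refine WP.seq_instr (wp_add hB (2 * d * b) (by simp [h.base]) (by omega) fun hB => ?_)
    refine WP.seq_instr (wp_const hB (by omega) fun hB => ?_)
    refine WP.mono (n := (d * (17 + 1) + 1) + 6 + 1) (WP.seq (WP.mono (WP.loop
      (CheckInv τ (2 * d * b) x lo hi) hB ?_ ?_ ?_) le_rfl ?_)) (by omega) fun _ _ h => h
    · exact ⟨(((Same.refl 9 τ).setReg (by decide) _).setReg (by decide) _).setReg (by decide) _,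
        by simp, by simp, by simp, by simp⟩
    · intro i hi' υ hB hυ
      refine ⟨by simp [Test.holds, hυ.coord, (hF'.same hυ.same (by norm_num)).dim, hi'], ?_⟩
      exact checkBody_wp hF' hbl (by omega) (by rw [h.same.query, hx])
        (fun c => by rw [h.same.query]; exact (hlo c).1)
        (fun c => by rw [h.same.query]; exact (hhi c).1) hi' hB hυ
    · intro υ hB hυ
      simp [Test.holds, hυ.coord, (hF'.same hυ.same (by norm_num)).dim]
    · intro υ hB hυ
      have hFυ := hF'.same hυ.same (by norm_num)
      have hbase := (hυ.same.reg rBase (by decide)).trans h.base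
      have hblock := (hυ.same.reg rBlock (by decide)).trans h.block
      have hhit := hυ.same.reg rHit (by decide)
      have hsame := h.same.trans (hυ.same.mono (by norm_num))
      refine WP.seq_instr (wp_add hB (b + 1) (by simp [hblock, hFυ.one]) (by omega) fun hB => ?_)
      refine WP.seq (n := 2) (m := 1) (WP.ite hB (fun ht => ?_) fun ht => ?_)
      · have hm0 : υ.reg rMiss = 0 := by simpa [Test.holds, hFυ.one] using ht
        have hbox := fun c => hυ.miss.1 hm0 c c.2
        have hxl : T.leafOf x = l := T.leafOf_eq_of_mem_box hd fun c =>
          ⟨⟨lo c, (hlo c).2.2.1, (hbox c).1⟩, ⟨hi c, (hhi c).2.2.1, (hbox c).2⟩⟩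
        have hin : InHull T S x := fun c =>
          ⟨⟨lo c, (hlo c).2.1, (hlo c).2.2.1.trans hxl.symm, (hbox c).1⟩,
            ⟨hi c, (hhi c).2.1, (hhi c).2.2.1.trans hxl.symm, (hbox c).2⟩⟩
        -- There is no instruction that moves a register; `rBlock`, already incremented, is copied
        -- by adding `rMiss`, which is zero here.
        refine wp_add hB (b + 1) (by simp [hm0]) (by omega) fun hB => ?_
        refine wp_add hB (2 * d * (b + 1)) (by simp [hbase, hFυ.width]; ring)
          (by rw [Nat.mul_succ]; omega) fun hB => ?_
        refine ⟨((hsame.setReg (by decide) _).setReg (by decide) _).setReg (by decide) _, by simp,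
          by simp, by simp, fun b' hb' => ?_⟩
        obtain rfl : b = b' := by simpa using hb'
        exact ⟨by omega, hxl ▸ hl, hin⟩
      · have hm0 : ¬ υ.reg rMiss = 0 := by simpa [Test.holds, hFυ.one] using ht
        have hnot : leaves[b]? = some (T.leafOf x) → ¬ InHull T S x := by
          intro hxl hin
          obtain rfl : l = T.leafOf x := Option.some_injective _ (hl.symm.trans hxl)
          refine hm0 (hυ.miss.2 fun c _ => ⟨?_, ?_⟩)
          · obtain ⟨y, hy, hyl, hyx⟩ := (hin c).1
            exact ((hlo c).2.2.2 y hy hyl).trans hyx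
          · obtain ⟨y, hy, hyl, hyx⟩ := (hin c).2
            exact hyx.trans ((hhi c).2.2.2 y hy hyl)
        refine wp_const hB (by omega) fun hB => ?_
        refine wp_add hB (2 * d * (b + 1)) (by simp [hbase, hFυ.width]; ring)
          (by rw [Nat.mul_succ]; omega) fun hB => ?_
        refine ⟨((hsame.setReg (by decide) _).setReg (by decide) _).setReg (by decide) _, by simp,
          by simp, fun h0 b' hb' => ?_, fun b' hb' => ?_⟩
        · rcases Nat.lt_succ_iff_lt_or_eq.1 hb' with hlt | rfl
          · exact h.miss (by simpa [hhit] using h0) b' hlt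
          · exact hnot
        · have := h.hit b' (by simpa [hhit] using hb')
          exact ⟨by omega, this.2⟩
  · intro τ _ h
    simp [Test.holds, h.base, (hF.same h.same (by norm_num)).len]
  · intro τ _ h
    refine ⟨h.same, fun h0 hin => ?_, fun b hb => (h.hit b hb).2⟩
    -- A point in the hull shares its leaf with a stored one, so the block of this leaf was among
    -- those searched.
    obtain ⟨y, hy, hyl⟩ := hin.exists_leafOf_eq hd
    obtain ⟨b, hb, hbl⟩ := List.mem_iff_getElem.1 (hmem y hy)
    exact h.miss h0 b hb (by rw [List.getElem?_eq_getElem hb, hbl, hyl]) hin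

end Search

/-! ### Extending the stored boxes -/

/-- Stores the point in cell `rLen` as lower end at `rPos` if its coordinate is not larger. -/
def lowProg : Prog 14 :=
  .instr (.compare rLen rPos rCoord rTmp) ;;
  .ite (.lt rTmp rOne) skipProg (.instr (.store rLen rPos))

/-- Stores the point in cell `rLen` as upper end at `rPos` if its coordinate is not smaller. -/
def highProg : Prog 14 :=
  .instr (.compare rPos rLen rCoord rTmp) ;;
  .ite (.lt rTmp rOne) skipProg (.instr (.store rLen rPos))

/-- Extends the range of one coordinate. -/
def updateBody : Prog 14 :=
  lowProg ;; .instr (.add rPos rPos rOne) ;; highProg ;; .instr (.add rPos rPos rOne) ;;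
  .instr (.add rCoord rCoord rOne)

/-- Asks for all known leaves whether the point in cell `rLen` belongs to them and extends the box
of the leaf that does. -/
def passProg : Prog 14 :=
  .instr (.const rBase 0) ;;
  .loop (.lt rBase rLen)
    (.instr (.sameLeaf rBase rLen rTmp) ;;
      .ite (.lt rTmp rOne) skipProg
        (.instr (.const rHit 1) ;; .instr (.const rCoord 0) ;; .instr (.add rPos rBase rCoord) ;;
          .loop (.lt rCoord rDim) updateBody) ;;
      .instr (.add rBase rBase rWidth))

/-- Makes the point in cell `rLen` a new block. -/
def newLeafProg : Prog 14 :=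
  .instr (.label rLen rTmp) ;; .instr (.pushBit rTmp) ;; .instr (.const rCoord 0) ;;
  .loop (.lt rCoord rWidth) (.instr (.copy rLen) ;; .instr (.add rCoord rCoord rOne)) ;;
  .instr (.remove rLen) ;; .instr (.add rLen rLen rWidth)

section Update

variable {d : ℕ} {E : Env d} {B : ℕ}

/-- The work tape, the sample counter and the registers with number below `m` are the same. -/
structure Keep (m : ℕ) (σ τ : State d 14) : Prop where
  work : τ.workTape = σ.workTape
  samples : τ.samples = σ.samples
  reg : ∀ r : Fin 14, (r : ℕ) < m → τ.reg r = σ.reg r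

theorem Keep.refl (m : ℕ) (σ : State d 14) : Keep m σ σ := ⟨rfl, rfl, fun _ _ => rfl⟩

theorem Keep.trans {m : ℕ} {σ τ υ : State d 14} (h : Keep m σ τ) (h' : Keep m τ υ) : Keep m σ υ :=
  ⟨h'.work.trans h.work, h'.samples.trans h.samples,
    fun r hr => (h'.reg r hr).trans (h.reg r hr)⟩

theorem Keep.mono {m n : ℕ} {σ τ : State d 14} (h : Keep m σ τ) (hn : n ≤ m) : Keep n σ τ :=
  ⟨h.work, h.samples, fun r hr => h.reg r (hr.trans_le hn)⟩

theorem Keep.setReg {m : ℕ} {σ τ : State d 14} (h : Keep m σ τ) {r : Fin 14} (hr : m ≤ (r : ℕ))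
    (v : ℕ) : Keep m σ (τ.setReg r v) :=
  ⟨h.work, h.samples, fun r' hr' => by
    rw [setReg_reg, if_neg (by rintro rfl; omega), h.reg r' hr']⟩

theorem Fixed.keep {N m : ℕ} {σ τ : State d 14} (h : Fixed N σ) (hs : Keep m σ τ) (hm : 4 ≤ m) :
    Fixed N τ :=
  ⟨(hs.reg 0 (by simp; omega)).trans h.one, (hs.reg 1 (by simp; omega)).trans h.dim,
    (hs.reg 2 (by simp; omega)).trans h.width, (hs.reg 3 (by simp; omega)).trans h.len⟩

/-- Only cell `p` of the query tape has changed. -/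
structure CellStep (p : ℕ) (σ τ : State d 14) : Prop where
  keep : Keep 12 σ τ
  queries : τ.queries = σ.queries
  length : τ.queryTape.length = σ.queryTape.length
  cell : ∀ j, j ≠ p → τ.queryTape[j]? = σ.queryTape[j]?

variable {T : DecisionTree d} {S : Set (Fin d → ℝ)} {x : Fin d → ℝ} {l : List Bool} {N : ℕ}

theorem lowProg_wp {σ : State d 14} {p : ℕ} (c : Fin d) (hB : Bdd B σ) (hB1 : 1 ≤ B)
    (hF : Fixed N σ) (hx : σ.queryTape[N]? = some x) (hxl : T.leafOf x = l)
    (hc : σ.reg rCoord = c) (hp : σ.reg rPos = p) (h : LowOK T S σ.queryTape l c p) :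
    WP E (Bdd B) lowProg σ 4 fun τ =>
      CellStep p σ τ ∧ LowOK T (insert x S) τ.queryTape l c p := by
  obtain ⟨y, hy, hyS, hyl, hmin⟩ := h
  refine WP.seq_instr (n := 2) (wp_compare hB hB1 (by rw [hF.len]; exact hx) (by rw [hp]; exact hy)
    c hc fun v hv hvx hB => ?_)
  have hv' : (σ.setReg rTmp v).reg rLen = N := by simp [hF.len]
  refine WP.ite hB (fun ht => ?_) fun ht => ?_
  · have hlt : ¬ x c ≤ y c := by
      rw [← hvx]
      have : v < 1 := by simpa [Test.holds, hF.one] using ht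
      omega
    refine wp_const hB (by omega) fun _ => ⟨⟨((Keep.refl 12 σ).setReg (by decide) _).setReg
      (by decide) _, rfl, rfl, fun _ _ => rfl⟩, y, hy, .inr hyS, hyl, ?_⟩
    rintro z (rfl | hz) hzl
    exacts [(not_le.1 hlt).le, hmin z hz hzl]
  · have hle : x c ≤ y c := by
      rw [← hvx]
      have : ¬ v < 1 := by simpa [Test.holds, hF.one] using ht
      omega
    refine wp_store hB (x := x) (by rw [hv']; exact hx) fun _ => ⟨⟨?_, rfl, by simp, ?_⟩, x, ?_,
      .inl rfl, hxl, ?_⟩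
    · have := (Keep.refl 12 σ).setReg (r := rTmp) (by decide) v
      exact ⟨this.work, this.samples, this.reg⟩
    · intro j hj
      simp [hp, hj.symm]
    · have : p < σ.queryTape.length := (List.getElem?_eq_some_iff.1 hy).1
      simp [hp, this]
    · rintro z (rfl | hz) hzl
      exacts [le_rfl, hle.trans (hmin z hz hzl)]

theorem highProg_wp {σ : State d 14} {p : ℕ} (c : Fin d) (hB : Bdd B σ) (hB1 : 1 ≤ B)
    (hF : Fixed N σ) (hx : σ.queryTape[N]? = some x) (hxl : T.leafOf x = l)
    (hc : σ.reg rCoord = c) (hp : σ.reg rPos = p) (h : HighOK T S σ.queryTape l c p) :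
    WP E (Bdd B) highProg σ 4 fun τ =>
      CellStep p σ τ ∧ HighOK T (insert x S) τ.queryTape l c p := by
  obtain ⟨y, hy, hyS, hyl, hmax⟩ := h
  refine WP.seq_instr (n := 2) (wp_compare hB hB1 (by rw [hp]; exact hy) (by rw [hF.len]; exact hx)
    c hc fun v hv hvx hB => ?_)
  have hv' : (σ.setReg rTmp v).reg rLen = N := by simp [hF.len]
  refine WP.ite hB (fun ht => ?_) fun ht => ?_
  · have hlt : ¬ y c ≤ x c := by
      rw [← hvx]
      have : v < 1 := by simpa [Test.holds, hF.one] using ht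
      omega
    refine wp_const hB (by omega) fun _ => ⟨⟨((Keep.refl 12 σ).setReg (by decide) _).setReg
      (by decide) _, rfl, rfl, fun _ _ => rfl⟩, y, hy, .inr hyS, hyl, ?_⟩
    rintro z (rfl | hz) hzl
    exacts [(not_le.1 hlt).le, hmax z hz hzl]
  · have hle : y c ≤ x c := by
      rw [← hvx]
      have : ¬ v < 1 := by simpa [Test.holds, hF.one] using ht
      omega
    refine wp_store hB (x := x) (by rw [hv']; exact hx) fun _ => ⟨⟨?_, rfl, by simp, ?_⟩, x, ?_,
      .inl rfl, hxl, ?_⟩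
    · have := (Keep.refl 12 σ).setReg (r := rTmp) (by decide) v
      exact ⟨this.work, this.samples, this.reg⟩
    · intro j hj
      simp [hp, hj.symm]
    · have : p < σ.queryTape.length := (List.getElem?_eq_some_iff.1 hy).1
      simp [hp, this]
    · rintro z (rfl | hz) hzl
      exacts [le_rfl, (hmax z hz hzl).trans hle]

/-- State of the loop that extends a box. -/
structure UpdateInv (T : DecisionTree d) (S : Set (Fin d → ℝ)) (x : Fin d → ℝ) (l : List Bool)
    (base : ℕ) (σ : State d 14) (i : ℕ) (τ : State d 14) : Prop where
  keep : Keep 9 σ τ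
  queries : τ.queries = σ.queries
  length : τ.queryTape.length = σ.queryTape.length
  cell : ∀ j, j < base ∨ base + 2 * d ≤ j → τ.queryTape[j]? = σ.queryTape[j]?
  coord : τ.reg rCoord = i
  pos : τ.reg rPos = base + 2 * i
  done : ∀ c : Fin d, (c : ℕ) < i → SlotOK T (insert x S) τ.queryTape l base c
  todo : ∀ c : Fin d, i ≤ (c : ℕ) → SlotOK T S τ.queryTape l base c

theorem updateBody_wp {σ τ : State d 14} {base i : ℕ} (hi : i < d) (hB : Bdd B τ)
    (hNB : N + 1 ≤ B) (hF : Fixed N σ) (hx : σ.queryTape[N]? = some x) (hxl : T.leafOf x = l)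
    (hbase : base + 2 * d ≤ N) (h : UpdateInv T S x l base σ i τ) :
    WP E (Bdd B) updateBody τ 15 (UpdateInv T S x l base σ (i + 1)) := by
  have hFτ := hF.keep h.keep (by norm_num)
  have hxτ := (h.cell N (.inr hbase)).trans hx
  have hslot := h.todo ⟨i, hi⟩ le_rfl
  refine WP.seq (n := 4) (m := 10) ((lowProg_wp ⟨i, hi⟩ hB (by omega) hFτ hxτ hxl h.coord h.pos
    hslot.1).mono le_rfl ?_)
  rintro υ hB ⟨hυ, hlow⟩
  have hFυ := hFτ.keep hυ.keep (by norm_num)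
  have hpos := (hυ.keep.reg rPos (by decide)).trans h.pos
  have hcoord := (hυ.keep.reg rCoord (by decide)).trans h.coord
  refine WP.seq_instr (n := 8) (wp_add hB (base + 2 * i + 1) (by simp [hpos, hFυ.one]) (by omega)
    fun hB => ?_)
  have hFυ' : Fixed N (υ.setReg rPos (base + 2 * i + 1)) :=
    hFυ.keep ((Keep.refl 10 υ).setReg (by decide) _) (by norm_num)
  refine WP.seq (n := 4) (m := 3) ((highProg_wp (T := T) (S := S) (x := x) (l := l)
    (p := base + 2 * i + 1) ⟨i, hi⟩ hB (by omega) hFυ' ?_ hxl (by simpa using hcoord) (by simp)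
    ?_).mono le_rfl ?_)
  · simpa [hυ.cell N (by omega)] using hxτ
  · obtain ⟨y, hy, hr⟩ := hslot.2
    exact ⟨y, by simpa [hυ.cell (base + 2 * i + 1) (by omega)] using hy, hr⟩
  rintro φ hB ⟨hφ, hhigh⟩
  have hkeep : Keep 9 σ φ := ((h.keep.trans (hυ.keep.mono (by norm_num))).setReg (by decide)
    _).trans (hφ.keep.mono (by norm_num))
  have hFφ := hFυ'.keep hφ.keep (by norm_num)
  have hpos' : φ.reg rPos = base + 2 * i + 1 := by
    rw [hφ.keep.reg rPos (by decide)]; simp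
  have hcoord' : φ.reg rCoord = i := by
    rw [hφ.keep.reg rCoord (by decide)]; simpa using hcoord
  have hcell : ∀ j, j ≠ base + 2 * i → j ≠ base + 2 * i + 1 →
      φ.queryTape[j]? = τ.queryTape[j]? := fun j h1 h2 => by
    rw [hφ.cell j h2, setReg_queryTape, hυ.cell j h1]
  refine WP.seq_instr (n := 1) (wp_add hB (base + 2 * (i + 1)) (by simp [hpos', hFφ.one]; ring)
    (by omega) fun hB => ?_)
  refine wp_add hB (i + 1) (by simp [hcoord', hFφ.one]) (by omega) fun hB => ?_
  refine ⟨(hkeep.setReg (by decide) _).setReg (by decide) _, ?_, ?_, fun j hj => ?_, by simp,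
    by simp, fun c hc => ?_, fun c hc => ?_⟩
  · simp [hφ.queries, hυ.queries, h.queries]
  · simp [hφ.length, hυ.length, h.length]
  · simp only [setReg_queryTape]
    rw [hcell j (by omega) (by omega), h.cell j hj]
  · simp only [setReg_queryTape]
    rcases Nat.lt_succ_iff_lt_or_eq.1 hc with hlt | heq
    · exact (h.done c hlt).congr (hcell _ (by omega) (by omega)) (hcell _ (by omega) (by omega))
    · obtain rfl : c = ⟨i, hi⟩ := Fin.ext heq
      refine ⟨?_, hhigh⟩
      obtain ⟨y, hy, hr⟩ := hlow
      exact ⟨y, by rw [hφ.cell _ (by simp)]; exact hy, hr⟩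
  · simp only [setReg_queryTape]
    exact (h.todo c (by omega)).congr (hcell _ (by omega) (by omega))
      (hcell _ (by omega) (by omega))

/-- State of the loop over the known leaves. -/
structure PassInv (T : DecisionTree d) (S : Set (Fin d → ℝ)) (leaves : List (List Bool))
    (x : Fin d → ℝ) (σ : State d 14) (b : ℕ) (τ : State d 14) : Prop where
  keep : Keep 6 σ τ
  queries : τ.queries = σ.queries + b
  length : τ.queryTape.length = σ.queryTape.length
  cell : ∀ j, 2 * d * leaves.length ≤ j → τ.queryTape[j]? = σ.queryTape[j]?
  base : τ.reg rBase = 2 * d * b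
  done : ∀ b' < b, ∀ l, leaves[b']? = some l →
    ∀ c, SlotOK T (insert x S) τ.queryTape l (2 * d * b') c
  todo : ∀ b', b ≤ b' → ∀ l, leaves[b']? = some l → ∀ c, SlotOK T S τ.queryTape l (2 * d * b') c
  miss : τ.reg rHit = 0 → ∀ b' < b, leaves[b']? ≠ some (T.leafOf x)
  hit : τ.reg rHit ≠ 0 → T.leafOf x ∈ leaves

/-- The first cell of a block serves as representative of its leaf, so one same-leaf query per block
suffices. Only the block of the leaf of `x` is rewritten; for the others, adding `x` to the sample
set changes nothing. -/
theorem passProg_wp {leaves : List (List Bool)} {σ : State d 14} (hd : 1 ≤ d)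
    (hB : Bdd B σ) (hF : Fixed (2 * d * leaves.length) σ)
    (hNB : 2 * d * leaves.length + 2 * d + 1 ≤ B)
    (hx : σ.queryTape[2 * d * leaves.length]? = some x) (hhit : σ.reg rHit = 0)
    (hslot : ∀ (b : ℕ) (l : List Bool), leaves[b]? = some l →
      ∀ c, SlotOK E.tree S σ.queryTape l (2 * d * b) c) :
    WP E (Bdd B) passProg σ (leaves.length * (16 * d + 13) + 3)
      (PassInv E.tree S leaves x σ leaves.length) := by
  refine WP.seq_instr (wp_const hB (by omega) fun hB => ?_)
  refine WP.mono (n := leaves.length * ((16 * d + 12) + 1) + 1)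
    (WP.loop (PassInv E.tree S leaves x σ) hB ?_ ?_ ?_) le_rfl fun _ _ h => h
  · exact ⟨(Keep.refl 6 σ).setReg (by decide) _, rfl, rfl, fun _ _ => rfl, by simp, by simp,
      fun b _ l hl c => hslot b l hl c, by simp, by simp [hhit]⟩
  · intro b hb τ hB h
    have hFτ := hF.keep h.keep (by norm_num)
    obtain ⟨l, hl⟩ : ∃ l, leaves[b]? = some l := ⟨leaves[b], by simp [hb]⟩
    have hbl : 2 * d * b + 2 * d ≤ 2 * d * leaves.length := by
      have := Nat.mul_le_mul_left (2 * d) (Nat.succ_le_of_lt hb)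
      rwa [Nat.mul_succ] at this
    refine ⟨by simp [Test.holds, h.base, hFτ.len]; omega, ?_⟩
    have hxτ := (h.cell _ le_rfl).trans hx
    obtain ⟨y, hy, -, hyl, -⟩ := (h.todo b le_rfl l hl ⟨0, hd⟩).1
    refine WP.seq_instr (n := 16 * d + 10) (wp_sameLeaf (x := y) (y := x) hB (by omega)
      (by rw [h.base]; simpa using hy) (by rw [hFτ.len]; exact hxτ) fun v hv hvx hB => ?_)
    have hkeep : Keep 6 σ ({ τ with queries := τ.queries + 1 }.setReg rTmp v) := by
      have : Keep 6 σ { τ with queries := τ.queries + 1 } :=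
        ⟨h.keep.work, h.keep.samples, h.keep.reg⟩
      exact this.setReg (by decide) _
    refine WP.mono (n := (16 * d + 8) + 1 + 1) (m := 16 * d + 10)
      (WP.seq (n := 16 * d + 8) (m := 1) (WP.ite (n := 16 * d + 7) hB (fun ht => ?_) fun ht => ?_))
      (by omega) fun _ _ h => h
    · have hne : E.tree.leafOf x ≠ l := by
        have : v < 1 := by simpa [Test.holds, hFτ.one] using ht
        intro hxl
        have := hvx.2 (hyl.trans hxl.symm)
        omega
      refine WP.mono (n := 1) (wp_const hB (by omega) fun hB => ?_) (by omega) fun _ _ h => h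
      refine wp_add hB (2 * d * (b + 1)) (by simp [h.base, hFτ.width]; ring)
        (by rw [Nat.mul_succ]; omega) fun hB => ?_
      refine ⟨(hkeep.setReg (by decide) _).setReg (by decide) _, ?_, h.length, h.cell, by simp,
        fun b' hb' l' hl' c => ?_, fun b' hb' l' hl' c => ?_, fun h0 b' hb' => ?_, fun h0 => ?_⟩
      · simp [h.queries]; ring
      · rcases Nat.lt_succ_iff_lt_or_eq.1 hb' with hlt | rfl
        · exact h.done b' hlt l' hl' c
        · obtain rfl : l = l' := Option.some_injective _ (hl.symm.trans hl')
          exact (h.todo b' le_rfl l hl c).insert_of_ne hne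
      · exact h.todo b' (by omega) l' hl' c
      · rcases Nat.lt_succ_iff_lt_or_eq.1 hb' with hlt | rfl
        · exact h.miss (by simpa using h0) b' hlt
        · rw [hl]
          simpa using hne.symm
      · exact h.hit (by simpa using h0)
    · have hxl : E.tree.leafOf x = l := by
        have : ¬ v < 1 := by simpa [Test.holds, hFτ.one] using ht
        exact (hvx.1 (by omega)).symm.trans hyl
      refine WP.seq_instr (n := 16 * d + 5) (wp_const hB (by omega) fun hB => ?_)
      refine WP.seq_instr (n := 16 * d + 3) (wp_const hB (by omega) fun hB => ?_)
      refine WP.mono (n := (d * (15 + 1) + 1) + 2) (m := 16 * d + 3) ?_ (by omega) fun _ _ h => h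
      refine WP.seq_instr (wp_add hB (2 * d * b) (by simp [h.base]) (by omega) fun hB => ?_)
      set σ₁ := (((({ τ with queries := τ.queries + 1 }.setReg rTmp v).setReg rHit 1).setReg rCoord
        0).setReg rPos (2 * d * b)) with hσ₁
      have hk₁ : Keep 6 σ σ₁ := ((hkeep.setReg (by decide) _).setReg (by decide) _).setReg
        (by decide) _
      have hF₁ := hF.keep hk₁ (by norm_num)
      refine WP.mono (WP.loop (UpdateInv E.tree S x l (2 * d * b) σ₁) (n := 15) (N := d) hB ?_ ?_
        ?_) le_rfl ?_
      · exact ⟨Keep.refl 9 σ₁, rfl, rfl, fun _ _ => rfl, by simp [hσ₁], by simp [hσ₁], by simp,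
          fun c _ => h.todo b le_rfl l hl c⟩
      · intro i hi υ hB hυ
        refine ⟨by simp [Test.holds, hυ.coord, (hF₁.keep hυ.keep (by norm_num)).dim, hi], ?_⟩
        exact updateBody_wp hi hB (by omega) hF₁ hxτ hxl hbl hυ
      · intro υ hB hυ
        simp [Test.holds, hυ.coord, (hF₁.keep hυ.keep (by norm_num)).dim]
      · intro υ hB hυ
        have hFυ := hF₁.keep hυ.keep (by norm_num)
        have hbase : υ.reg rBase = 2 * d * b := by
          rw [hυ.keep.reg rBase (by decide)]; simp [hσ₁, h.base]
        have hhit' : υ.reg rHit = 1 := by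
          rw [hυ.keep.reg rHit (by decide)]; simp [hσ₁]
        have hother : ∀ b', b' ≠ b → ∀ (c : Fin d) (e : ℕ), e < 2 →
            υ.queryTape[2 * d * b' + 2 * c + e]? = τ.queryTape[2 * d * b' + 2 * c + e]? := by
          intro b' hb' c e he
          refine hυ.cell _ ?_
          have hc := c.2
          rcases lt_or_gt_of_ne hb' with hlt | hlt
          · have := Nat.mul_le_mul_left (2 * d) (Nat.succ_le_of_lt hlt)
            rw [Nat.mul_succ] at this
            left; omega
          · have := Nat.mul_le_mul_left (2 * d) (Nat.succ_le_of_lt hlt)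
            rw [Nat.mul_succ] at this
            right; omega
        refine wp_add hB (2 * d * (b + 1)) (by simp [hbase, hFυ.width]; ring)
          (by rw [Nat.mul_succ]; omega) fun hB => ?_
        refine ⟨(hk₁.trans (hυ.keep.mono (by norm_num))).setReg (by decide) _, ?_, ?_,
          fun j hj => ?_, by simp, fun b' hb' l' hl' c => ?_, fun b' hb' l' hl' c => ?_,
          fun h0 => ?_, fun _ => ?_⟩
        · simp [hυ.queries, hσ₁, h.queries]; ring
        · simp [hυ.length, hσ₁, h.length]
        · exact (hυ.cell j (.inr (hbl.trans hj))).trans (h.cell j hj)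
        · by_cases hbb : b' = b
          · subst hbb
            obtain rfl : l = l' := Option.some_injective _ (hl.symm.trans hl')
            exact hυ.done c c.2
          · exact (h.done b' (by omega) l' hl' c).congr (hother b' hbb c 0 (by norm_num))
              (hother b' hbb c 1 (by norm_num))
        · have hbb : b' ≠ b := by omega
          exact (h.todo b' (by omega) l' hl' c).congr (hother b' hbb c 0 (by norm_num))
            (hother b' hbb c 1 (by norm_num))
        · simp [hhit'] at h0
        · rw [hxl]
          exact List.mem_iff_getElem?.2 ⟨b, hl⟩
  · intro τ _ h
    simp [Test.holds, h.base, (hF.keep h.keep (by norm_num)).len]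

/-- State of the loop that copies a point. -/
structure CopyInv (x : Fin d → ℝ) (σ : State d 14) (i : ℕ) (τ : State d 14) : Prop where
  keep : Keep 9 σ τ
  queries : τ.queries = σ.queries
  tape : τ.queryTape = σ.queryTape ++ List.replicate i x
  coord : τ.reg rCoord = i

/-- The only known point of a leaf is extreme in all `2d` directions, so its block consists of
copies of it. The original is removed after copying; for a moment the tape has `N + 2d + 1` cells.
-/
theorem newLeafProg_wp {σ : State d 14} {tape : List (Fin d → ℝ)} (hB : Bdd B σ) (hF : Fixed N σ)
    (hNB : N + 2 * d + 1 ≤ B) (htape : σ.queryTape = tape ++ [x]) (hlen : tape.length = N)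
    (hwork : σ.workTape.length + 1 ≤ B) :
    WP E (Bdd B) newLeafProg σ (8 * d + 11) fun τ =>
      τ.workTape = σ.workTape ++ [E.tree.label x] ∧
      τ.queryTape = tape ++ List.replicate (2 * d) x ∧ τ.samples = σ.samples ∧
      τ.queries = σ.queries + 1 ∧ Fixed (N + 2 * d) τ ∧ τ.reg rFin = σ.reg rFin ∧
      τ.reg rDirty = σ.reg rDirty := by
  have hx : σ.queryTape[N]? = some x := by simp [htape, ← hlen]
  unfold newLeafProg
  refine WP.seq_instr (n := 8 * d + 9) (wp_label (x := x) hB (by omega) (by rw [hF.len]; exact hx)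
    fun hB => ?_)
  refine WP.seq_instr (n := 8 * d + 7) (wp_pushBit hB hwork fun hB => ?_)
  refine WP.seq_instr (n := 8 * d + 5) (wp_const hB (by omega) fun hB => ?_)
  set σ₁ := _
  change Bdd B σ₁ at hB
  change WP E (Bdd B) _ σ₁ _ _
  have hF₁ : Fixed N σ₁ := ⟨by simp [σ₁, hF.one], by simp [σ₁, hF.dim], by simp [σ₁, hF.width],
    by simp [σ₁, hF.len]⟩
  refine WP.mono (n := (2 * d * (3 + 1) + 1) + 3 + 1) (m := 8 * d + 5) (WP.seq
    (n := 2 * d * (3 + 1) + 1) (m := 3) (WP.mono (WP.loop (CopyInv x σ₁) (n := 3) (N := 2 * d) hB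
    ?_ ?_ ?_) le_rfl ?_)) (by omega)
    fun _ _ h => h
  · exact ⟨Keep.refl 9 σ₁, rfl, by simp, by simp [σ₁]⟩
  · intro i hi τ hB h
    have hFτ := hF₁.keep h.keep (by norm_num)
    have htape' : τ.queryTape = tape ++ [x] ++ List.replicate i x := by
      rw [h.tape]; simp [σ₁, htape]
    refine ⟨by simp [Test.holds, h.coord, hFτ.width, hi], ?_⟩
    refine WP.seq_instr (n := 1) (wp_copy (x := x) hB ?_ ?_ fun hB => ?_)
    · simp [htape', hlen]; omega
    · rw [hFτ.len, htape', List.getElem?_append_left (by simp [hlen])]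
      simp [← hlen]
    refine wp_add hB (i + 1) (by simp [h.coord, hFτ.one]) (by omega) fun hB => ?_
    refine ⟨?_, h.queries, ?_, by simp⟩
    · have : Keep 9 σ₁ { τ with queryTape := τ.queryTape ++ [x] } :=
        ⟨h.keep.work, h.keep.samples, h.keep.reg⟩
      exact this.setReg (by decide) _
    · simp [h.tape, List.replicate_succ']
  · intro τ hB h
    have hFτ := hF₁.keep h.keep (by norm_num)
    simp [Test.holds, h.coord, hFτ.width]
  · intro τ hB h
    have hFτ := hF₁.keep h.keep (by norm_num)
    have htape' : τ.queryTape = tape ++ [x] ++ List.replicate (2 * d) x := by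
      rw [h.tape]; simp [σ₁, htape]
    refine WP.seq_instr (n := 1) (wp_remove hB fun hB => ?_)
    refine wp_add hB (N + 2 * d) (by simp [hFτ.len, hFτ.width]) (by omega) fun hB => ?_
    refine ⟨?_, ?_, ?_, ?_, ?_, ?_, ?_⟩
    · simp only [setReg_workTape, h.keep.work]
      cases hlab : E.tree.label x <;> simp [σ₁, hlab]
    · simp [htape', hFτ.len, ← hlen, List.eraseIdx_append_of_length_le]
    · simp [h.keep.samples, σ₁]
    · simp [h.queries, σ₁]
    · exact ⟨by simp [hFτ.one], by simp [hFτ.dim], by simp [hFτ.width], by simp⟩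
    · simp [h.keep.reg rFin (by decide), σ₁]
    · simp [h.keep.reg rDirty (by decide), σ₁]

end Update

/-! ### The learner -/

/-- Draws a sample and, unless a stored box contains it, asks queries and extends the boxes. -/
def processProg : Prog 14 :=
  .instr .sample ;; searchProg ;;
  .ite (.lt rHit rOne)
    (passProg ;; .instr (.const rDirty 1) ;;
      .ite (.lt rHit rOne) newLeafProg (.instr (.remove rLen)))
    (.instr (.remove rLen))

/-- Processes a sample. At the beginning of a window `rDirty` is reset; the learner stops at the end
of a window if no sample in it was new. -/
def bodyProg : Prog 14 :=
  processProg ;; .ite (.counters 0) (.instr (.const rDirty 0)) skipProg ;;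
  .ite (.counters 1) (.ite (.lt rDirty rOne) (.instr (.const rFin 1)) skipProg) skipProg

def mainLoop : Prog 14 := .loop (.lt rFin rOne) bodyProg

def trainProg : Prog 14 :=
  .instr (.const rOne 1) ;; .instr (.dim rDim) ;; .instr (.add rWidth rDim rDim) ;; mainLoop

def classifyProg : Prog 14 :=
  searchProg ;;
  .ite (.lt rHit rOne) (.instr (.const rOut 0))
    (.instr (.sub rHit rHit rOne) ;; .instr (.readBit rHit rOut) ;;
      .instr (.add rOut rOut rOne))

def boxLearner : Learner where
  numRegs := 14
  train := trainProg
  classify := classifyProg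
  out := rOut
  classify_oracleFree := by
    simp [classifyProg, searchProg, checkBody, skipProg, Prog.OracleFree, Instr.OracleFree]

section ProcessSample

variable {d : ℕ} {E : Env d} {T : DecisionTree d} {S : Set (Fin d → ℝ)}

/-- The memory contents describe the bounding boxes of the points in `S`. -/
structure Stored (T : DecisionTree d) (S : Set (Fin d → ℝ)) (leaves : List (List Bool))
    (σ : State d 14) : Prop where
  fixed : Fixed (2 * d * leaves.length) σ
  length : σ.queryTape.length = 2 * d * leaves.length
  mem : ∀ l, l ∈ leaves ↔ ∃ y ∈ S, T.leafOf y = l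
  nodup : leaves.Nodup
  work_length : σ.workTape.length = leaves.length
  work : ∀ (b : ℕ) (y : Fin d → ℝ), leaves[b]? = some (T.leafOf y) →
    σ.workTape[b]? = some (T.label y)
  slot : ∀ (b : ℕ) (l : List Bool), leaves[b]? = some l →
    ∀ c, SlotOK T S σ.queryTape l (2 * d * b) c

theorem card_leaves_le {leaves : List (List Bool)} (hn : leaves.Nodup)
    (h : ∀ l ∈ leaves, ∃ y, T.leafOf y = l) : leaves.length ≤ T.size := by
  rw [← List.toFinset_card_of_nodup hn]
  refine (Finset.card_le_card fun l hl => ?_).trans T.card_leafNames_le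
  obtain ⟨y, rfl⟩ := h l (by simpa using hl)
  exact T.leafOf_mem_leafNames y

theorem Stored.length_le {leaves : List (List Bool)} {σ : State d 14} (h : Stored T S leaves σ) :
    leaves.length ≤ T.size :=
  card_leaves_le h.nodup fun l hl => ((h.mem l).1 hl).imp fun _ hy => hy.2

/-- A bound for the lengths of the tapes and the contents of the registers. -/
def tapeBound (T : DecisionTree d) : ℕ := 2 * d * T.size + 2 * d + 1

theorem SlotOK.append {tape : List (Fin d → ℝ)} {l : List Bool} {base : ℕ}
    {c : Fin d} (h : SlotOK T S tape l base c) (ext : List (Fin d → ℝ)) :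
    SlotOK T S (tape ++ ext) l base c := by
  obtain ⟨⟨y, h1, h2⟩, w, k1, k2⟩ := h
  exact ⟨⟨y, by rw [List.getElem?_append_left (List.getElem?_eq_some_iff.1 h1).1, h1], h2⟩, w,
    by rw [List.getElem?_append_left (List.getElem?_eq_some_iff.1 k1).1, k1], k2⟩

/-- A bound for the time needed to process a sample. -/
def processTime (T : DecisionTree d) : ℕ := T.size * (34 * d + 28) + 8 * d + 40

/-- The search costs no queries. If it fails, there is one query per known leaf, and the number of
known leaves is at most the size of the tree; a label query is added only for an unknown leaf. -/
theorem processProg_wp {leaves : List (List Bool)} {σ : State d 14} (hd : 1 ≤ d)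
    (hB : Bdd (tapeBound E.tree) σ) (h : Stored E.tree S leaves σ) :
    WP E (Bdd (tapeBound E.tree)) processProg σ (processTime E.tree) fun τ =>
      (∃ leaves', Stored E.tree (insert (E.stream σ.samples) S) leaves' τ) ∧
      τ.samples = σ.samples + 1 ∧ τ.reg rFin = σ.reg rFin ∧
      (InHull E.tree S (E.stream σ.samples) →
        τ.reg rDirty = σ.reg rDirty ∧ τ.queries = σ.queries) ∧
      (¬ InHull E.tree S (E.stream σ.samples) →
        τ.reg rDirty = 1 ∧ τ.queries ≤ σ.queries + (E.tree.size + 1)) := by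
  set x := E.stream σ.samples with hxdef
  have hks := h.length_le
  have hkd : 2 * d * leaves.length ≤ 2 * d * E.tree.size := Nat.mul_le_mul_left _ hks
  have htime : leaves.length * (34 * d + 28) ≤ E.tree.size * (34 * d + 28) :=
    Nat.mul_le_mul_right _ hks
  have hkB : E.tree.size ≤ 2 * d * E.tree.size := Nat.le_mul_of_pos_left _ (by omega)
  have hNB : 2 * d * leaves.length + 2 * d + 1 ≤ tapeBound E.tree := by
    unfold tapeBound; omega
  refine WP.mono (n := (leaves.length * (18 * d + 15) + 7 +
    (leaves.length * (16 * d + 13) + 8 * d + 20) + 1) + 2) ?_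
    (by unfold processTime; linarith) fun _ _ h => h
  refine WP.seq_instr (wp_sample hB (by rw [h.length]; omega) fun hB => ?_)
  set σ₁ := _
  change Bdd (tapeBound E.tree) σ₁ at hB
  change WP E (Bdd (tapeBound E.tree)) _ σ₁ _ _
  have htape₁ : σ₁.queryTape = σ.queryTape ++ [x] := rfl
  have hF₁ : Fixed (2 * d * leaves.length) σ₁ :=
    ⟨h.fixed.one, h.fixed.dim, h.fixed.width, h.fixed.len⟩
  have hx₁ : σ₁.queryTape[2 * d * leaves.length]? = some x := by simp [htape₁, ← h.length]
  refine WP.seq ((searchProg_wp (T := E.tree) (S := S) (leaves := leaves) (x := x) hd hB hF₁ hNB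
    hx₁ (fun y hy => (h.mem _).2 ⟨y, hy, rfl⟩) fun b l hl c =>
      (h.slot b l hl c).append [x]).mono le_rfl ?_)
  rintro τ hB ⟨hsame, hmiss, hhit⟩
  have hFτ := hF₁.same hsame (by norm_num)
  have htapeτ : τ.queryTape = σ.queryTape ++ [x] := hsame.query.trans htape₁
  have hxτ : τ.queryTape[2 * d * leaves.length]? = some x := by simp [htapeτ, ← h.length]
  have hsub : ∀ l, (∃ y ∈ S, E.tree.leafOf y = l) → ∃ y ∈ insert x S, E.tree.leafOf y = l :=
    fun l hl => hl.imp fun y hy => ⟨.inr hy.1, hy.2⟩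
  have hmem : E.tree.leafOf x ∈ leaves →
      ∀ l, l ∈ leaves ↔ ∃ y ∈ insert x S, E.tree.leafOf y = l := by
    refine fun hxl l => ⟨fun hl => hsub l ((h.mem l).1 hl), ?_⟩
    rintro ⟨y, rfl | hy, rfl⟩
    exacts [hxl, (h.mem _).2 ⟨y, hy, rfl⟩]
  refine WP.mono (n := leaves.length * (16 * d + 13) + 3 + (8 * d + 12 + 2) + 1 + 1) (WP.ite hB
    (fun ht => ?_) fun ht => ?_) (by omega) fun _ _ h => h
  · have hh0 : τ.reg rHit = 0 := by simpa [Test.holds, hFτ.one] using ht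
    have hnot := hmiss hh0
    refine WP.seq ((passProg_wp (S := S) (leaves := leaves) (x := x) hd hB hFτ hNB hxτ hh0 fun b l
      hl c => ?_).mono le_rfl fun υ hB hυ => ?_)
    · rw [htapeτ]
      exact (h.slot b l hl c).append [x]
    have hFυ := hFτ.keep hυ.keep (by norm_num)
    have hlenυ : υ.queryTape.length = 2 * d * leaves.length + 1 := by
      rw [hυ.length, htapeτ]; simp [h.length]
    have hworkυ : υ.workTape = σ.workTape := hυ.keep.work.trans hsame.work
    have hsamplesυ : υ.samples = σ.samples + 1 := hυ.keep.samples.trans hsame.samples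
    have hfinυ : υ.reg rFin = σ.reg rFin :=
      (hυ.keep.reg rFin (by decide)).trans (hsame.reg rFin (by decide))
    have hqυ : υ.queries = σ.queries + leaves.length := by rw [hυ.queries, hsame.queries]
    obtain ⟨tape, z, htape⟩ : ∃ tape z, υ.queryTape = tape ++ [z] := by
      rcases List.eq_nil_or_concat υ.queryTape with h0 | ⟨a, b, hab⟩
      · simp [h0] at hlenυ
      · exact ⟨a, b, by rw [hab, List.concat_eq_append]⟩
    have htl : tape.length = 2 * d * leaves.length := by
      rw [htape] at hlenυ; simpa using hlenυ
    obtain rfl : z = x := by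
      have := (hυ.cell _ le_rfl).trans hxτ
      rw [htape, List.getElem?_append_right (by omega)] at this
      simpa [htl] using this
    have hslot : ∀ (b : ℕ) (l : List Bool), leaves[b]? = some l →
        ∀ c, SlotOK E.tree (insert x S) tape l (2 * d * b) c := by
      intro b l hl c
      have hb : b < leaves.length := (List.getElem?_eq_some_iff.1 hl).1
      have hbl := Nat.mul_le_mul_left (2 * d) (Nat.succ_le_of_lt hb)
      rw [Nat.mul_succ] at hbl
      have hc := c.2
      refine (hυ.done b hb l hl c).congr ?_ ?_ <;>
        rw [htape, List.getElem?_append_left (by omega)]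
    refine WP.seq_instr (n := 8 * d + 12) (wp_const hB (by omega) fun hB => ?_)
    have hF₂ : Fixed (2 * d * leaves.length) (υ.setReg rDirty 1) :=
      hFυ.keep ((Keep.refl 5 υ).setReg (by decide) _) (by norm_num)
    refine WP.ite (n := 8 * d + 11) hB (fun ht => ?_) fun ht => ?_
    · have hh : υ.reg rHit = 0 := by simpa [Test.holds, hFυ.one] using ht
      have hnew : E.tree.leafOf x ∉ leaves := fun hm => by
        obtain ⟨b, hb⟩ := List.mem_iff_getElem?.1 hm
        exact hυ.miss hh b (List.getElem?_eq_some_iff.1 hb).1 hb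
      have hnd : (leaves ++ [E.tree.leafOf x]).Nodup := by
        refine List.nodup_append.2 ⟨h.nodup, List.nodup_singleton _, fun a ha b hb hab => ?_⟩
        obtain rfl := List.mem_singleton.1 hb
        exact hnew (hab ▸ ha)
      have hmem' : ∀ l, l ∈ leaves ++ [E.tree.leafOf x] ↔
          ∃ y ∈ insert x S, E.tree.leafOf y = l := by
        intro l
        simp only [List.mem_append, List.mem_singleton, h.mem l]
        constructor
        · rintro (hl | rfl)
          exacts [hsub l hl, ⟨x, .inl rfl, rfl⟩]
        · rintro ⟨y, rfl | hy, rfl⟩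
          exacts [.inr rfl, .inl ⟨y, hy, rfl⟩]
      -- The new leaf counts among the leaves of the tree, so there is room for its label bit.
      have hk1 : leaves.length + 1 ≤ E.tree.size := by
        simpa using card_leaves_le hnd fun l hl => ((hmem' l).1 hl).imp fun _ hy => hy.2
      refine (newLeafProg_wp (x := x) (tape := tape) hB hF₂ hNB htape htl ?_).mono le_rfl ?_
      · simp only [setReg_workTape, hworkυ, h.work_length]
        unfold tapeBound; omega
      rintro φ - ⟨hwork, htapeφ, hsamp, hq, hFφ, hfin, hdirty⟩
      simp only [setReg_workTape, setReg_samples, setReg_queries, setReg_reg]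
        at hwork hsamp hq hfin hdirty
      have hlenφ : 2 * d * (leaves ++ [E.tree.leafOf x]).length =
          2 * d * leaves.length + 2 * d := by simp [Nat.mul_succ]
      refine ⟨⟨leaves ++ [E.tree.leafOf x], ?_, ?_, hmem', hnd, ?_, ?_, ?_⟩, ?_, ?_, ?_, ?_⟩
      · rwa [hlenφ]
      · rw [hlenφ, htapeφ]; simp [htl]
      · simp [hwork, hworkυ, h.work_length]
      · intro b y hby
        rw [hwork, hworkυ]
        rcases lt_or_ge b leaves.length with hlt | hge
        · rw [List.getElem?_append_left (by rwa [h.work_length])]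
          rw [List.getElem?_append_left hlt] at hby
          exact h.work b y hby
        · rw [List.getElem?_append_right hge] at hby
          rw [List.getElem?_append_right (by rwa [h.work_length]), h.work_length]
          have hb0 : b - leaves.length = 0 := by
            by_contra hne
            simp [hne] at hby
          simp only [hb0, List.length_singleton, Nat.zero_lt_one, List.getElem?_eq_getElem,
            List.getElem_cons_zero, Option.some.injEq] at hby ⊢
          exact E.tree.label_eq_of_leafOf_eq hby
      · intro b l hbl c
        rw [htapeφ]
        rcases lt_or_ge b leaves.length with hlt | hge
        · rw [List.getElem?_append_left hlt] at hbl
          exact (hslot b l hbl c).append _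
        · have hb0 : b = leaves.length := by
            have := (List.getElem?_eq_some_iff.1 hbl).1
            simp at this
            omega
          subst hb0
          obtain rfl : E.tree.leafOf x = l := by simpa using hbl
          have honly : ∀ w ∈ insert x S, E.tree.leafOf w = E.tree.leafOf x → w = x := by
            rintro w (rfl | hw) hwl
            exacts [rfl, absurd ((h.mem _).2 ⟨w, hw, hwl⟩) hnew]
          have hc := c.2
          refine ⟨⟨x, ?_, .inl rfl, rfl, fun w hw hwl => (honly w hw hwl ▸ le_rfl)⟩, x, ?_,
            .inl rfl, rfl, fun w hw hwl => (honly w hw hwl ▸ le_rfl)⟩ <;>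
          · rw [List.getElem?_append_right (by omega), List.getElem?_replicate, if_pos (by omega)]
      · rw [hsamp, hsamplesυ]
      · rw [hfin]; simpa using hfinυ
      · exact fun hin => absurd hin hnot
      · refine fun _ => ⟨by rw [hdirty]; simp, by rw [hq, hqυ]; omega⟩
    · have hh : υ.reg rHit ≠ 0 := by simpa [Test.holds, hFυ.one] using ht
      refine WP.mono (n := 1) (wp_remove hB fun hB => ?_) (by omega) fun _ _ h => h
      have htape' : (υ.setReg rDirty 1).queryTape.eraseIdx ((υ.setReg rDirty 1).reg rLen) =
          tape := by
        rw [hF₂.len, setReg_queryTape, htape, ← htl,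
          List.eraseIdx_append_of_length_le le_rfl]
        simp
      refine ⟨⟨leaves, ⟨hF₂.one, hF₂.dim, hF₂.width, hF₂.len⟩, ?_, hmem (hυ.hit hh), h.nodup, ?_,
        ?_, ?_⟩, hsamplesυ, ?_, fun hin => absurd hin hnot, fun _ => ⟨by simp, ?_⟩⟩
      · simp only [htape', htl]
      · simp [hworkυ, h.work_length]
      · simpa [hworkυ] using h.work
      · simp only [htape']
        exact hslot
      · simpa using hfinυ
      · simp [hqυ]; omega
  · have hh : τ.reg rHit ≠ 0 := by simpa [Test.holds, hFτ.one] using ht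
    obtain ⟨b, hb⟩ := Nat.exists_eq_succ_of_ne_zero hh
    obtain ⟨hbl, hin⟩ := hhit b hb
    refine WP.mono (n := 1) (wp_remove hB fun hB => ?_) (by omega) fun _ _ h => h
    have htape' : τ.queryTape.eraseIdx (τ.reg rLen) = σ.queryTape := by
      rw [hFτ.len, htapeτ, ← h.length, List.eraseIdx_append_of_length_le le_rfl]
      simp
    refine ⟨⟨leaves, ⟨hFτ.one, hFτ.dim, hFτ.width, hFτ.len⟩, ?_,
      hmem (List.mem_iff_getElem?.2 ⟨b, hbl⟩), h.nodup, ?_, ?_, ?_⟩, hsame.samples, ?_,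
      fun _ => ⟨?_, hsame.queries⟩, fun hn => absurd hin hn⟩
    · simp only [htape', h.length]
    · simp only [hsame.work]; exact h.work_length
    · simp only [hsame.work]; exact h.work
    · simp only [htape']
      exact fun b l hl c => (h.slot b l hl c).insert_of_inHull hin
    · exact hsame.reg rFin (by decide)
    · exact hsame.reg rDirty (by decide)

/-- Bit `b` of the work tape is the label of the leaf of block `b`. One is subtracted from `rHit` to
get the block number, and one is added to the bit to get the output code, in which 0 is left for
"don't know". -/
theorem classifyProg_wp {leaves : List (List Bool)} {σ : State d 14} (hd : 1 ≤ d)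
    (hB : Bdd (tapeBound E.tree) σ) (h : Stored E.tree S leaves σ) (x : Fin d → ℝ) :
    ∃ n, WP E (Bdd (tapeBound E.tree)) classifyProg { σ with queryTape := σ.queryTape ++ [x] } n
      fun τ => (InHull E.tree S x → τ.reg rOut = (E.tree.label x).toNat + 1) ∧
        (¬ InHull E.tree S x → τ.reg rOut = 0) := by
  set σ₁ : State d 14 := { σ with queryTape := σ.queryTape ++ [x] }
  have hks := h.length_le
  have hkd : 2 * d * leaves.length ≤ 2 * d * E.tree.size := Nat.mul_le_mul_left _ hks
  have hpos := Nat.mul_le_mul (Nat.mul_le_mul_left 2 hd) E.tree.size_pos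
  have hNB : 2 * d * leaves.length + 2 * d + 1 ≤ tapeBound E.tree := by
    unfold tapeBound; omega
  have hB : Bdd (tapeBound E.tree) σ₁ := ⟨by simp [σ₁, h.length]; omega, hB.work, hB.reg⟩
  have hF₁ : Fixed (2 * d * leaves.length) σ₁ :=
    ⟨h.fixed.one, h.fixed.dim, h.fixed.width, h.fixed.len⟩
  have hx₁ : σ₁.queryTape[2 * d * leaves.length]? = some x := by simp [σ₁, ← h.length]
  refine ⟨_, WP.seq (m := 6) ((searchProg_wp (T := E.tree) (S := S) (leaves := leaves) (x := x) hd
    hB hF₁ hNB hx₁ (fun y hy => (h.mem _).2 ⟨y, hy, rfl⟩) fun b l hl c =>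
      (h.slot b l hl c).append [x]).mono le_rfl ?_)⟩
  rintro τ hB ⟨hsame, hmiss, hhit⟩
  have hFτ := hF₁.same hsame (by norm_num)
  refine WP.ite hB (fun ht => ?_) fun ht => ?_
  · have hh0 : τ.reg rHit = 0 := by simpa [Test.holds, hFτ.one] using ht
    refine WP.mono (n := 1) (wp_const hB (by omega) fun hB => ?_) (by omega) fun _ _ h => h
    exact ⟨fun hin => absurd hin (hmiss hh0), fun _ => by simp⟩
  · have hh : τ.reg rHit ≠ 0 := by simpa [Test.holds, hFτ.one] using ht
    obtain ⟨b, hb⟩ := Nat.exists_eq_succ_of_ne_zero hh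
    obtain ⟨hbl, hin⟩ := hhit b hb
    refine WP.seq_instr (n := 3) (wp_sub hB b (by simp [hb, hFτ.one]) fun hB => ?_)
    refine WP.seq_instr (n := 1) (wp_readBit (z := E.tree.label x) hB (by omega) ?_ fun hB => ?_)
    · simpa [hsame.work] using h.work b x hbl
    have := Bool.toNat_le (E.tree.label x)
    refine wp_add hB ((E.tree.label x).toNat + 1) (by simp [hFτ.one])
      (by unfold tapeBound; omega) fun hB => ?_
    exact ⟨fun _ => by simp, fun hn => absurd hin hn⟩

end ProcessSample

/-! ### The training loop -/

section Training

variable {d : ℕ}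

/-- Test `0` recognizes the beginnings of windows, all other tests their ends. -/
noncomputable def windowTest (starts ends : Set ℕ) : ℕ → ℕ → ℕ → Bool :=
  open Classical in fun i m _ => if i = 0 then decide (m ∈ starts) else decide (m ∈ ends)

/-- The first `t` samples. -/
def seen (ω : ℕ → Fin d → ℝ) (t : ℕ) : Set (Fin d → ℝ) := {y | ∃ i < t, ω i = y}

theorem seen_succ (ω : ℕ → Fin d → ℝ) (t : ℕ) : seen ω (t + 1) = insert (ω t) (seen ω t) := by
  ext y
  simp only [seen, Set.mem_ofPred_eq, Set.mem_insert_iff, Nat.lt_succ_iff_lt_or_eq]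
  constructor
  · rintro ⟨i, hi | rfl, rfl⟩
    exacts [.inr ⟨i, hi, rfl⟩, .inl rfl]
  · rintro (rfl | ⟨i, hi, rfl⟩)
    exacts [⟨t, .inr rfl, rfl⟩, ⟨i, .inl hi, rfl⟩]

/-- Sample number `t` is not in the bounding box of the earlier samples in its leaf. -/
def New (T : DecisionTree d) (ω : ℕ → Fin d → ℝ) (t : ℕ) : Prop := ¬ InHull T (seen ω t) (ω t)

/-- There was a new sample since the last beginning of a window. -/
def Dirty (T : DecisionTree d) (ω : ℕ → Fin d → ℝ) (starts : Set ℕ) (t : ℕ) : Prop :=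
  ∃ i < t, New T ω i ∧ ∀ a ∈ starts, ¬ (i < a ∧ a ≤ t)

/-- After `t` samples the learner halts, unless it has done so before. -/
def Stops (T : DecisionTree d) (ω : ℕ → Fin d → ℝ) (starts ends : Set ℕ) (t : ℕ) : Prop :=
  t ∈ ends ∧ ¬ Dirty T ω starts t

/-- The learner draws more than `t` samples. -/
def Alive (T : DecisionTree d) (ω : ℕ → Fin d → ℝ) (starts ends : Set ℕ) (t : ℕ) : Prop :=
  ∀ j < t, ¬ Stops T ω starts ends (j + 1)

variable {T : DecisionTree d} {ω : ℕ → Fin d → ℝ} {starts ends : Set ℕ}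

theorem Alive.mono {s t : ℕ} (h : Alive T ω starts ends t) (hs : s ≤ t) :
    Alive T ω starts ends s := fun j hj => h j (hj.trans_le hs)

/-- The recursion that `bodyProg` carries out on `rDirty`: a new sample sets the flag, and a window
that starts at `t + 1` clears it afterwards. -/
theorem dirty_succ (t : ℕ) :
    Dirty T ω starts (t + 1) ↔ t + 1 ∉ starts ∧ (New T ω t ∨ Dirty T ω starts t) := by
  constructor
  · rintro ⟨i, hi, hn, ha⟩
    refine ⟨fun h => ha _ h ⟨hi, le_rfl⟩, ?_⟩
    rcases Nat.lt_succ_iff_lt_or_eq.1 hi with hlt | rfl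
    · exact .inr ⟨i, hlt, hn, fun a h hh => ha a h ⟨hh.1, by omega⟩⟩
    · exact .inl hn
  · rintro ⟨hs, hn | ⟨i, hi, hn, ha⟩⟩
    · refine ⟨t, by omega, hn, fun a h hh => hs ?_⟩
      obtain rfl : a = t + 1 := by omega
      exact h
    · refine ⟨i, by omega, hn, fun a h hh => ?_⟩
      rcases Nat.le_succ_iff.1 hh.2 with hle | rfl
      · exact ha a h ⟨hh.1, hle⟩
      · exact hs h

open Classical in
/-- A bound for the number of queries on the first `t` samples. -/
noncomputable def queryBound (T : DecisionTree d) (ω : ℕ → Fin d → ℝ) (t : ℕ) : ℕ :=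
  ∑ i ∈ Finset.range t, if New T ω i then T.size + 1 else 0

/-- The situation after `t` samples. -/
structure TrainInv (T : DecisionTree d) (ω : ℕ → Fin d → ℝ) (starts : Set ℕ) (t : ℕ)
    (σ : State d 14) : Prop where
  stored : ∃ leaves, Stored T (seen ω t) leaves σ
  samples : σ.samples = t
  dirty_le : σ.reg rDirty ≤ 1
  dirty : σ.reg rDirty = 1 ↔ Dirty T ω starts t
  queries : σ.queries ≤ queryBound T ω t

theorem Stored.congr {S : Set (Fin d → ℝ)} {leaves : List (List Bool)} {σ τ : State d 14}
    (h : Stored T S leaves σ) (hs : Same 4 σ τ) : Stored T S leaves τ :=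
  ⟨h.fixed.same hs le_rfl, by rw [hs.query, h.length], h.mem, h.nodup,
    by rw [hs.work, h.work_length], by rw [hs.work]; exact h.work, by rw [hs.query]; exact h.slot⟩

theorem bodyProg_wp {t : ℕ} {σ : State d 14} (hd : 1 ≤ d) (hB : Bdd (tapeBound T) σ)
    (h : TrainInv T ω starts t σ) (hfin : σ.reg rFin = 0) :
    WP ⟨ω, T, windowTest starts ends⟩ (Bdd (tapeBound T)) bodyProg σ (processTime T + 7) fun τ =>
      TrainInv T ω starts (t + 1) τ ∧ τ.reg rFin ≤ 1 ∧
        (τ.reg rFin = 1 ↔ Stops T ω starts ends (t + 1)) := by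
  set E : Env d := ⟨ω, T, windowTest starts ends⟩ with hE
  have hB1 : 1 ≤ tapeBound T := by unfold tapeBound; omega
  obtain ⟨leaves, hst⟩ := h.stored
  refine WP.seq (n := processTime T) (m := 6) ((processProg_wp (E := E) hd hB hst).mono le_rfl ?_)
  rintro τ hB ⟨⟨leaves', hst'⟩, hsamp, hfin', hin, hnew⟩
  have hxE : E.stream σ.samples = ω t := by rw [h.samples]
  rw [hxE] at hst' hin hnew
  change Stored T _ _ _ at hst'
  rw [← seen_succ] at hst'
  rw [h.samples] at hsamp
  have hdle : τ.reg rDirty ≤ 1 := by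
    by_cases hh : InHull T (seen ω t) (ω t)
    · rw [(hin hh).1]; exact h.dirty_le
    · rw [(hnew hh).1]
  have hd1 : τ.reg rDirty = 1 ↔ New T ω t ∨ Dirty T ω starts t := by
    by_cases hh : InHull T (seen ω t) (ω t)
    · rw [(hin hh).1, h.dirty, New]; tauto
    · rw [(hnew hh).1, New]; tauto
  have hq : τ.queries ≤ queryBound T ω (t + 1) := by
    rw [queryBound, Finset.sum_range_succ, ← queryBound]
    have := h.queries
    by_cases hh : InHull T (seen ω t) (ω t)
    · rw [(hin hh).2, New, if_neg (not_not.2 hh)]; omega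
    · have h2 := (hnew hh).2
      rw [New, if_pos hh]
      change τ.queries ≤ σ.queries + (T.size + 1) at h2
      omega
  refine WP.mono (n := 2 + 3 + 1) (WP.seq (n := 2) (m := 3) (WP.mono (n := 2)
    (Q := TrainInv T ω starts (t + 1) ⊓ fun υ => υ.reg rFin = 0)
    (WP.ite hB (fun ht => ?_) fun ht => ?_) le_rfl ?_)) le_rfl fun _ _ h => h
  · have hmem : t + 1 ∈ starts := by
      simpa [Test.holds, hE, windowTest, hsamp] using ht
    refine wp_const hB (by omega) fun hB => ⟨⟨⟨leaves', hst'.congr ((Same.refl 4 τ).setReg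
      (by decide) _)⟩, hsamp, by simp, ?_, hq⟩, by simp [hfin', hfin]⟩
    rw [dirty_succ]
    simp [hmem]
  · have hmem : t + 1 ∉ starts := by
      simpa [Test.holds, hE, windowTest, hsamp] using ht
    refine wp_const hB (by omega) fun hB => ⟨⟨⟨leaves', hst'.congr ((Same.refl 4 τ).setReg
      (by decide) _)⟩, hsamp, by simpa using hdle, ?_, hq⟩, by simp [hfin', hfin]⟩
    rw [dirty_succ, ← hd1]
    simp [hmem]
  rintro υ hB ⟨hυ, hfinυ⟩
  change υ.reg rFin = 0 at hfinυ
  obtain ⟨lv, hlv⟩ := hυ.stored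
  refine WP.ite (n := 2) hB (fun ht => WP.ite (n := 1) hB (fun ht' => ?_) fun ht' => ?_)
    fun ht => ?_
  · have hmem : t + 1 ∈ ends := by
      simpa [Test.holds, hE, windowTest, hυ.samples] using ht
    have h0 : υ.reg rDirty = 0 := by simpa [Test.holds, hlv.fixed.one] using ht'
    refine wp_const hB (by omega) fun hB => ⟨⟨⟨lv, hlv.congr ((Same.refl 4 υ).setReg
      (by decide) _)⟩, hυ.samples, by simpa using hυ.dirty_le, by simpa using hυ.dirty,
      hυ.queries⟩, by simp, ?_⟩
    simp [Stops, hmem, ← hυ.dirty, h0]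
  · have h0 : υ.reg rDirty ≠ 0 := by simpa [Test.holds, hlv.fixed.one] using ht'
    have h1 := hυ.dirty_le
    refine wp_const hB (by omega) fun hB => ⟨⟨⟨lv, hlv.congr ((Same.refl 4 υ).setReg
      (by decide) _)⟩, hυ.samples, by simpa using hυ.dirty_le, by simpa using hυ.dirty,
      hυ.queries⟩, by simp [hfinυ], ?_⟩
    have : υ.reg rDirty = 1 := by omega
    simp [Stops, ← hυ.dirty, this, hfinυ]
  · have hmem : t + 1 ∉ ends := by
      simpa [Test.holds, hE, windowTest, hυ.samples] using ht
    refine WP.mono (n := 1) (wp_const hB (by omega) fun hB => ⟨⟨⟨lv, hlv.congr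
      ((Same.refl 4 υ).setReg (by decide) _)⟩, hυ.samples, by simpa using hυ.dirty_le,
      by simpa using hυ.dirty, hυ.queries⟩, by simp [hfinυ], ?_⟩) (by omega) fun _ _ h => h
    simp [Stops, hmem, hfinυ]


/-! ### From the training loop to complete runs of the learner -/

/-- The state in which the training loop is entered. -/
def startState (d : ℕ) : State d 14 :=
  ((State.init.setReg rOne 1).setReg rDim d).setReg rWidth (d + d)

theorem path_startState (E : Env d) (hd : 1 ≤ d) :
    Path E (Bdd (tapeBound T)) ([trainProg], State.init) 6 ([mainLoop], startState d) := by
  have h0 : Bdd (tapeBound T) (State.init : State d 14) :=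
    ⟨by simp [State.init], by simp [State.init], by simp [State.init]⟩
  have h1 := h0.setReg (v := 1) (by unfold tapeBound; omega) rOne
  have h2 := h1.setReg (v := d) (by unfold tapeBound; omega) rDim
  have h3 := h2.setReg (v := d + d) (by unfold tapeBound; omega) rWidth
  exact (((((Path.single rfl h0 h0).trans (Path.single rfl h0 h1)).trans
    (Path.single rfl h1 h1)).trans (Path.single rfl h1 h2)).trans (Path.single rfl h2 h2)).trans
    (Path.single rfl h2 h3)

theorem trainInv_startState : TrainInv T ω starts 0 (startState d) := by
  refine ⟨⟨[], ⟨⟨?_, ?_, ?_, ?_⟩, rfl, ?_, List.nodup_nil, rfl, ?_, ?_⟩⟩, rfl, ?_, ?_, ?_⟩ <;>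
    simp [startState, State.init, seen, Dirty, two_mul]

/-- The lower bound `t ≤ n` makes these paths arbitrarily long when the learner never stops; it then
cannot halt, and each of its configurations lies on such a path. In the upper bound, 6 steps are
initialization and each round adds one loop test to the time of the body. -/
theorem exists_path_of_alive (hd : 1 ≤ d) (t : ℕ) (h : Alive T ω starts ends t) :
    ∃ n, t ≤ n ∧ n ≤ 6 + t * (processTime T + 8) ∧ ∃ σ, TrainInv T ω starts t σ ∧
      σ.reg rFin = 0 ∧ Path ⟨ω, T, windowTest starts ends⟩ (Bdd (tapeBound T))
        ([trainProg], State.init) n ([mainLoop], σ) := by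
  induction t with
  | zero => exact ⟨6, by simp, by simp, _, trainInv_startState,
      by simp [startState, State.init], path_startState _ hd⟩
  | succ t ih =>
    obtain ⟨n, hn, hn', σ, hσ, hfin, hp⟩ := ih (h.mono (by omega))
    obtain ⟨k, hk, τ, ⟨hτ, hle, hhalt⟩, hb⟩ := bodyProg_wp (ends := ends) hd hp.finish hσ hfin
    obtain ⟨lv, hlv⟩ := hσ.stored
    refine ⟨n + (1 + k), by omega, by rw [Nat.succ_mul]; omega, τ, hτ, ?_, hp.trans
      (Path.loop_iter hp.finish (by simp [Test.holds, hfin, hlv.fixed.one]) hb [])⟩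
    have : τ.reg rFin ≠ 1 := fun h1 => h t (by omega) (hhalt.1 h1)
    omega

theorem exists_path_of_stops (hd : 1 ≤ d) (t : ℕ) (h : Alive T ω starts ends t)
    (hs : Stops T ω starts ends (t + 1)) :
    ∃ n ≤ 7 + (t + 1) * (processTime T + 8), ∃ σ, TrainInv T ω starts (t + 1) σ ∧
      Path ⟨ω, T, windowTest starts ends⟩ (Bdd (tapeBound T))
        ([trainProg], State.init) n ([], σ) := by
  obtain ⟨n, hn, hn', σ, hσ, hfin, hp⟩ := exists_path_of_alive hd t h
  obtain ⟨k, hk, τ, ⟨hτ, hle, hhalt⟩, hb⟩ := bodyProg_wp (ends := ends) hd hp.finish hσ hfin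
  obtain ⟨lv, hlv⟩ := hσ.stored
  obtain ⟨lv', hlv'⟩ := hτ.stored
  have hp' := hp.trans
    (Path.loop_iter hp.finish (by simp [Test.holds, hfin, hlv.fixed.one]) hb [])
  refine ⟨n + (1 + k) + 1, by rw [Nat.succ_mul]; omega, τ, hτ, hp'.trans
    (Path.loop_exit hp'.finish ?_ [])⟩
  simp [Test.holds, hlv'.fixed.one, hhalt.2 hs]

theorem alive_or_stops : (∀ t, Alive T ω starts ends t) ∨
    ∃ t, Alive T ω starts ends t ∧ Stops T ω starts ends (t + 1) := by
  classical
  by_cases h : ∃ t, Stops T ω starts ends (t + 1)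
  · exact .inr ⟨Nat.find h, fun j hj => Nat.find_min h hj, Nat.find_spec h⟩
  · push Not at h
    exact .inl fun t j _ => h j

/-- Each configuration lies on a path along which the bound is an invariant, or repeats the last one
of a halting path. -/
theorem bdd_config (hd : 1 ≤ d) (n : ℕ) :
    Bdd (tapeBound T) (boxLearner.config ⟨ω, T, windowTest starts ends⟩ n).2 := by
  rcases alive_or_stops (T := T) (ω := ω) (starts := starts) (ends := ends) with h | ⟨t, h, hs⟩
  · obtain ⟨m, hm, -, σ, -, -, hp⟩ := exists_path_of_alive hd n (h n)
    exact hp.2 n hm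
  · obtain ⟨m, -, σ, -, hp⟩ := exists_path_of_stops hd t h hs
    rcases le_total n m with hnm | hnm
    · exact hp.2 n hnm
    · obtain ⟨k, rfl⟩ := Nat.exists_eq_add_of_le hnm
      have : boxLearner.config ⟨ω, T, windowTest starts ends⟩ (m + k) = ([], σ) := by
        change (step _)^[m + k] ([trainProg], State.init) = _
        rw [Nat.add_comm, Function.iterate_add_apply, hp.1, iterate_halted]
        rfl
      rw [this]
      exact hp.finish

theorem memoryUsage_le (hd : 1 ≤ d) :
    boxLearner.memoryUsage ⟨ω, T, windowTest starts ends⟩ ≤ ((16 * tapeBound T : ℕ) : ℝ≥0∞) :=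
  iSup_le fun n => Nat.cast_le.2 (bdd_config hd n).memory_le

-- Passing to a sum over all samples removes the random stopping time, so that the expectation can
-- be taken term by term.
open Classical in
theorem queryBound_le {t : ℕ} (h : ∀ i < t, Alive T ω starts ends i) :
    (queryBound T ω t : ℝ≥0∞) ≤ ∑' i, {ω | New T ω i ∧ Alive T ω starts ends i}.indicator
      (fun _ => ((T.size + 1 : ℕ) : ℝ≥0∞)) ω := by
  refine le_trans (le_of_eq ?_) (ENNReal.sum_le_tsum (Finset.range t))
  rw [queryBound, Nat.cast_sum]
  refine Finset.sum_congr rfl fun i hi => ?_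
  have := h i (Finset.mem_range.1 hi)
  by_cases hn : New T ω i <;> simp [hn, this]

theorem queryCount_le (hd : 1 ≤ d) :
    boxLearner.queryCount ⟨ω, T, windowTest starts ends⟩ ≤
      ∑' i, {ω | New T ω i ∧ Alive T ω starts ends i}.indicator
        (fun _ => ((T.size + 1 : ℕ) : ℝ≥0∞)) ω := by
  refine iSup_le fun n => ?_
  rcases alive_or_stops (T := T) (ω := ω) (starts := starts) (ends := ends) with h | ⟨t, h, hs⟩
  · obtain ⟨m, hm, -, σ, hσ, -, hp⟩ := exists_path_of_alive hd n (h n)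
    refine le_trans (Nat.cast_le.2 ?_) (queryBound_le (t := n) fun i _ => h i)
    refine (iterate_queries_mono _ hm).trans ?_
    exact (congrArg (fun a => a.2.queries) hp.1).le.trans hσ.queries
  · obtain ⟨m, -, σ, hσ, hp⟩ := exists_path_of_stops hd t h hs
    refine le_trans (Nat.cast_le.2 ?_)
      (queryBound_le (t := t + 1) fun i hi => h.mono (Nat.lt_succ_iff.1 hi))
    refine (iterate_queries_mono _ (Nat.le_add_right n m)).trans ?_
    have : (step ⟨ω, T, windowTest starts ends⟩)^[n + m] ([trainProg], State.init) = ([], σ) := by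
      rw [Function.iterate_add_apply, hp.1, iterate_halted]
    exact (congrArg (fun a => a.2.queries) this).le.trans hσ.queries

/-- If the learner never stops, the sum on the right is infinite and there is nothing to show. -/
theorem runningTime_le (hd : 1 ≤ d) :
    boxLearner.runningTime ⟨ω, T, windowTest starts ends⟩ ≤
      7 + ∑' i, {ω | Alive T ω starts ends i}.indicator
        (fun _ => ((processTime T + 8 : ℕ) : ℝ≥0∞)) ω := by
  rcases alive_or_stops (T := T) (ω := ω) (starts := starts) (ends := ends) with h | ⟨t, h, hs⟩
  · have : ∑' i, {ω | Alive T ω starts ends i}.indicator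
        (fun _ => ((processTime T + 8 : ℕ) : ℝ≥0∞)) ω = ⊤ := by
      simp only [Set.indicator, Set.mem_ofPred_eq, h, if_true]
      exact ENNReal.tsum_const_eq_top_of_ne_zero (by simp)
    rw [this]
    simp
  · obtain ⟨m, hm, σ, hσ, hp⟩ := exists_path_of_stops hd t h hs
    refine (iInf₂_le m (by rw [HaltsWithin, run]; exact congrArg Prod.fst hp.1)).trans ?_
    refine le_trans (Nat.cast_le.2 hm) ?_
    rw [Nat.cast_add]
    refine add_le_add (by simp) (le_trans (le_of_eq ?_)
      (ENNReal.sum_le_tsum (Finset.range (t + 1))))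
    rw [Finset.sum_congr rfl fun i hi => Set.indicator_of_mem (s := {ω | Alive T ω starts ends i})
      (h.mono (Nat.lt_succ_iff.1 (Finset.mem_range.1 hi))) _]
    simp only [Finset.sum_const, Finset.card_range, nsmul_eq_mul]
    push_cast
    ring

theorem classifier_of_alive (hd : 1 ≤ d) (h : ∀ t, Alive T ω starts ends t) (x : Fin d → ℝ) :
    boxLearner.classifier ⟨ω, T, windowTest starts ends⟩ x = none := by
  have hnone : finalState ⟨ω, T, windowTest starts ends⟩ boxLearner.train State.init = none := by
    rw [finalState, dif_neg]
    rintro ⟨n, hn⟩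
    obtain ⟨m, hm, -, σ, -, -, hp⟩ := exists_path_of_alive hd n (h n)
    obtain ⟨k, rfl⟩ := Nat.exists_eq_add_of_le hm
    have h1 := hp.1
    rw [Nat.add_comm, Function.iterate_add_apply] at h1
    replace hn : ((step ⟨ω, T, windowTest starts ends⟩)^[n] ([trainProg], State.init)).1 = [] := hn
    generalize (step _)^[n] ([trainProg], State.init) = b at hn h1
    obtain ⟨b1, b2⟩ := b
    obtain rfl : b1 = [] := hn
    rw [iterate_halted] at h1
    simp at h1
  simp [Learner.classifier, hnone]

theorem classifier_of_stops (hd : 1 ≤ d) {t : ℕ} (h : Alive T ω starts ends t)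
    (hs : Stops T ω starts ends (t + 1)) (x : Fin d → ℝ) :
    (InHull T (seen ω (t + 1)) x →
      boxLearner.classifier ⟨ω, T, windowTest starts ends⟩ x = some (T.label x)) ∧
    (¬ InHull T (seen ω (t + 1)) x →
      boxLearner.classifier ⟨ω, T, windowTest starts ends⟩ x = none) := by
  obtain ⟨m, -, σ, hσ, hp⟩ := exists_path_of_stops hd t h hs
  obtain ⟨lv, hlv⟩ := hσ.stored
  obtain ⟨n, hn⟩ := classifyProg_wp (E := ⟨ω, T, windowTest starts ends⟩) hd hp.finish hlv x
  obtain ⟨τ, ⟨h1, h2⟩, hτ⟩ := hn.finalState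
  have hfin : finalState ⟨ω, T, windowTest starts ends⟩ boxLearner.train State.init = some σ :=
    finalState_eq hp.1
  have hτ' : finalState ⟨ω, T, windowTest starts ends⟩ boxLearner.classify
    { σ with queryTape := σ.queryTape ++ [x] } = some τ := hτ
  simp only [Learner.classifier, hfin, hτ']
  change (_ → (if τ.reg rOut = 1 then some false else if τ.reg rOut = 2 then some true else none)
    = _) ∧ (_ → (if τ.reg rOut = 1 then some false else if τ.reg rOut = 2 then some true else none)
    = _)
  refine ⟨fun hin => ?_, fun hn => ?_⟩
  · rw [h1 hin]
    cases T.label x <;> simp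
  · rw [h2 hn]
    simp

end Training

/-! ### Symmetries of product measures -/

section ProductMeasure

variable {X : Type*} [MeasurableSpace X] (D : Measure X) [IsProbabilityMeasure D]

/-- Exchangeability of i.i.d. samples, checked on finite cylinders. -/
theorem map_comp_perm_infinitePi (e : Equiv.Perm ℕ) :
    (Measure.infinitePi fun _ : ℕ => D).map (fun ω => ω ∘ e) =
      Measure.infinitePi fun _ : ℕ => D := by
  refine Measure.eq_infinitePi _ fun s B hB => ?_
  rw [Measure.map_apply (by fun_prop) (MeasurableSet.pi s.countable_toSet fun i _ => hB i)]
  have : (fun ω : ℕ → X => ω ∘ e) ⁻¹' Set.pi s B =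
      Set.pi (s.map e.toEmbedding : Finset ℕ) fun j => B (e.symm j) := by
    ext ω
    simp only [Set.mem_preimage, Set.mem_pi, Finset.coe_map, Equiv.coe_toEmbedding,
      Set.forall_mem_image, Equiv.symm_apply_apply, Function.comp_apply]
  rw [this, Measure.infinitePi_pi _ fun i _ => hB _, Finset.prod_map]
  simp

/-- Redrawing one sample independently keeps the law; this allows integrating over sample `t` with
all the others fixed. -/
theorem map_update_infinitePi (t : ℕ) :
    ((Measure.infinitePi fun _ : ℕ => D).prod D).map
      (fun p : (ℕ → X) × X => Function.update p.1 t p.2) = Measure.infinitePi fun _ : ℕ => D := by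
  classical
  have hm : Measurable fun p : (ℕ → X) × X => Function.update p.1 t p.2 := by
    refine measurable_pi_iff.2 fun i => ?_
    by_cases h : i = t
    · subst h; simpa using measurable_snd
    · simp only [Function.update_of_ne h]
      exact (measurable_pi_apply i).comp measurable_fst
  refine Measure.eq_infinitePi _ fun s B hB => ?_
  rw [Measure.map_apply hm (MeasurableSet.pi s.countable_toSet fun i _ => hB i)]
  have : (fun p : (ℕ → X) × X => Function.update p.1 t p.2) ⁻¹' Set.pi s B =
      Set.pi (s.erase t : Finset ℕ) B ×ˢ (if t ∈ s then B t else Set.univ) := by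
    ext ⟨ω, x⟩
    simp only [Set.mem_preimage, Set.mem_pi, Set.mem_prod, Finset.mem_coe, Finset.mem_erase]
    constructor
    · refine fun h => ⟨fun i hi => by simpa [hi.1] using h i hi.2, ?_⟩
      split_ifs with hs
      · simpa using h t hs
      · trivial
    · rintro ⟨h, h'⟩ i hi
      by_cases hit : i = t
      · subst hit; simpa [hi] using h'
      · simpa [hit] using h i ⟨hit, hi⟩
  rw [this, Measure.prod_prod, Measure.infinitePi_pi _ fun i _ => hB _]
  split_ifs with hs
  · rw [Finset.prod_erase_mul _ _ hs]
  · rw [Finset.erase_eq_of_notMem hs]; simp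

end ProductMeasure

/-! ### New samples are rare -/

section Rare

variable {d : ℕ} {T : DecisionTree d}

/-- Adding points of the hull does not enlarge the hull. -/
theorem InHull.trans {S S' : Set (Fin d → ℝ)} {x : Fin d → ℝ} (h : InHull T S' x)
    (hS : ∀ y ∈ S', y ∈ S ∨ InHull T S y) : InHull T S x := by
  refine fun c => ⟨?_, ?_⟩
  · obtain ⟨y, hy, hyx, hc⟩ := (h c).1
    rcases hS y hy with hy | hy
    · exact ⟨y, hy, hyx, hc⟩
    · obtain ⟨z, hz, hzy, hc'⟩ := (hy c).1
      exact ⟨z, hz, hzy.trans hyx, hc'.trans hc⟩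
  · obtain ⟨y, hy, hyx, hc⟩ := (h c).2
    rcases hS y hy with hy | hy
    · exact ⟨y, hy, hyx, hc⟩
    · obtain ⟨z, hz, hzy, hc'⟩ := (hy c).2
      exact ⟨z, hz, hzy.trans hyx, hc.trans hc'⟩

theorem measurableSet_leafOf_eq (T : DecisionTree d) (l : List Bool) :
    MeasurableSet {x | T.leafOf x = l} := by
  have key : ∀ (p q : DecisionTree d) (A : Set (Fin d → ℝ)), MeasurableSet A →
      (∀ l, MeasurableSet {x | p.leafOf x = l}) → (∀ l, MeasurableSet {x | q.leafOf x = l}) →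
      ∀ l, MeasurableSet ((A ∩ {x | true :: p.leafOf x = l}) ∪
        (Aᶜ ∩ {x | false :: q.leafOf x = l})) := by
    intro p q A hA hp hq l
    refine (hA.inter ?_).union (hA.compl.inter ?_)
    · rcases l with _ | ⟨_ | _, l⟩
      · simp
      · simp
      · simpa using hp l
    · rcases l with _ | ⟨_ | _, l⟩
      · simp
      · simpa using hq l
      · simp
  induction T generalizing l with
  | leaf z => exact MeasurableSet.const ([] = l)
  | nodeGe i b p q hp hq =>
    convert key p q {x | b ≤ x i} (measurableSet_le measurable_const (measurable_pi_apply i)) hp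
      hq l using 1
    ext x
    by_cases h : b ≤ x i <;> simp [DecisionTree.leafOf, h]
  | nodeLe i b p q hp hq =>
    convert key p q {x | x i ≤ b} (measurableSet_le (measurable_pi_apply i) measurable_const) hp
      hq l using 1
    ext x
    by_cases h : x i ≤ b <;> simp [DecisionTree.leafOf, h]

theorem measurableSet_leafOf_eq_leafOf {Y : Type*} [MeasurableSpace Y] {f g : Y → Fin d → ℝ}
    (hf : Measurable f) (hg : Measurable g) (T : DecisionTree d) :
    MeasurableSet {y | T.leafOf (f y) = T.leafOf (g y)} := by
  have : {y | T.leafOf (f y) = T.leafOf (g y)} =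
      ⋃ l : List Bool, {y | T.leafOf (f y) = l} ∩ {y | T.leafOf (g y) = l} := by
    ext y
    simp [eq_comm]
  rw [this]
  exact MeasurableSet.iUnion fun l =>
    (hf (measurableSet_leafOf_eq T l)).inter (hg (measurableSet_leafOf_eq T l))

theorem inHull_seen_iff {ω : ℕ → Fin d → ℝ} {t : ℕ} {x : Fin d → ℝ} :
    InHull T (seen ω t) x ↔ ∀ c, (∃ i < t, T.leafOf (ω i) = T.leafOf x ∧ ω i c ≤ x c) ∧
      ∃ i < t, T.leafOf (ω i) = T.leafOf x ∧ x c ≤ ω i c := by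
  refine forall_congr' fun c => and_congr ?_ ?_
  all_goals
    constructor
    · rintro ⟨y, ⟨i, hi, rfl⟩, h⟩
      exact ⟨i, hi, h⟩
    · rintro ⟨i, hi, h⟩
      exact ⟨_, ⟨i, hi, rfl⟩, h⟩

theorem measurableSet_inHull (T : DecisionTree d) (t : ℕ) :
    MeasurableSet {p : (ℕ → Fin d → ℝ) × (Fin d → ℝ) | InHull T (seen p.1 t) p.2} := by
  have hm : ∀ i, Measurable fun p : (ℕ → Fin d → ℝ) × (Fin d → ℝ) => p.1 i :=
    fun i => (measurable_pi_apply i).comp measurable_fst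
  have hc : ∀ i c, Measurable fun p : (ℕ → Fin d → ℝ) × (Fin d → ℝ) => p.1 i c :=
    fun i c => (measurable_pi_apply c).comp (hm i)
  have hc' : ∀ c, Measurable fun p : (ℕ → Fin d → ℝ) × (Fin d → ℝ) => p.2 c :=
    fun c => (measurable_pi_apply c).comp measurable_snd
  have hl := fun i => measurableSet_leafOf_eq_leafOf (hm i) measurable_snd T
  simp only [inHull_seen_iff]
  refine MeasurableSet.congr (s := ⋂ c, ((⋃ i, ⋃ (_ : i < t),
    {p : (ℕ → Fin d → ℝ) × (Fin d → ℝ) | T.leafOf (p.1 i) = T.leafOf p.2} ∩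
      {p | p.1 i c ≤ p.2 c}) ∩ ⋃ i, ⋃ (_ : i < t),
    {p : (ℕ → Fin d → ℝ) × (Fin d → ℝ) | T.leafOf (p.1 i) = T.leafOf p.2} ∩
      {p | p.2 c ≤ p.1 i c})) ?_ ?_
  · refine MeasurableSet.iInter fun c => MeasurableSet.inter ?_ ?_
    · exact MeasurableSet.iUnion fun i => MeasurableSet.iUnion fun _ =>
        (hl i).inter (measurableSet_le (hc i c) (hc' c))
    · exact MeasurableSet.iUnion fun i => MeasurableSet.iUnion fun _ =>
        (hl i).inter (measurableSet_le (hc' c) (hc i c))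
  · ext p
    simp only [Set.mem_iInter, Set.mem_inter_iff, Set.mem_iUnion, exists_prop, Set.mem_ofPred_eq]

theorem measurableSet_new (T : DecisionTree d) (t : ℕ) : MeasurableSet {ω | New T ω t} :=
  (measurable_id.prodMk (measurable_pi_apply t)) (measurableSet_inHull T t).compl

/-- After the exchange, `ω i` comes last and all other samples up to `t` come before it. Missing
their box means being strictly beyond all of those in the same leaf, in some direction. -/
theorem new_swap {ω : ℕ → Fin d → ℝ} {t i : ℕ} (hi : i ≤ t) (h : New T (ω ∘ Equiv.swap i t) t) :
    ∃ c, (∀ j ≤ t, j ≠ i → T.leafOf (ω j) = T.leafOf (ω i) → ω i c < ω j c) ∨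
      ∀ j ≤ t, j ≠ i → T.leafOf (ω j) = T.leafOf (ω i) → ω j c < ω i c := by
  rw [New, InHull] at h
  push Not at h
  obtain ⟨c, hc⟩ := h
  refine ⟨c, ?_⟩
  have hseen : ∀ j ≤ t, j ≠ i → ω j ∈ seen (ω ∘ Equiv.swap i t) t := by
    intro j hj hji
    rcases eq_or_ne j t with rfl | hjt
    · exact ⟨i, by omega, by simp⟩
    · exact ⟨j, by omega, by simp [Equiv.swap_apply_of_ne_of_ne hji hjt]⟩
  have ht : (ω ∘ Equiv.swap i t) t = ω i := by simp
  rw [ht] at hc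
  by_cases hl : ∃ y ∈ seen (ω ∘ Equiv.swap i t) t, T.leafOf y = T.leafOf (ω i) ∧ y c ≤ ω i c
  · exact .inr fun j hj hji hjl => hc hl _ (hseen j hj hji) hjl
  · push Not at hl
    exact .inl fun j hj hji hjl => hl _ (hseen j hj hji) hjl

-- Send `i` to the leaf of `ω i` and a direction in which it is strictly extreme there. Two indices
-- with the same image would each lie strictly beyond the other, so this is injective, and there are
-- `2d` directions for each leaf.
open Classical in
theorem card_new_swap_le (hd : 1 ≤ d) (T : DecisionTree d) (ω : ℕ → Fin d → ℝ) (t : ℕ) :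
    ((Finset.range (t + 1)).filter fun i => New T (ω ∘ Equiv.swap i t) t).card ≤
      2 * d * T.size := by
  have h : ∀ i, ∃ cb : Fin d × Bool, i ≤ t → New T (ω ∘ Equiv.swap i t) t →
      ∀ j ≤ t, j ≠ i → T.leafOf (ω j) = T.leafOf (ω i) →
        if cb.2 then ω i cb.1 < ω j cb.1 else ω j cb.1 < ω i cb.1 := by
    intro i
    by_cases hi : i ≤ t ∧ New T (ω ∘ Equiv.swap i t) t
    · obtain ⟨c, h | h⟩ := new_swap hi.1 hi.2
      · exact ⟨(c, true), fun _ _ => by simpa using h⟩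
      · exact ⟨(c, false), fun _ _ => by simpa using h⟩
    · exact ⟨(⟨0, hd⟩, true), fun h h' => absurd ⟨h, h'⟩ hi⟩
  choose cb hcb using h
  have hcard : (T.leafNames ×ˢ (Finset.univ : Finset (Fin d × Bool))).card ≤ 2 * d * T.size := by
    simp only [Finset.card_product, Finset.card_univ, Fintype.card_prod, Fintype.card_fin,
      Fintype.card_bool]
    have := Nat.mul_le_mul_right (d * 2) T.card_leafNames_le
    linarith
  refine le_trans (Finset.card_le_card_of_injOn (fun i => (T.leafOf (ω i), cb i))
    (fun i _ => by simp [T.leafOf_mem_leafNames]) ?_) hcard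
  intro i hi j hj hij
  simp only [Finset.coe_filter, Finset.mem_range, Set.mem_ofPred_eq, Nat.lt_succ_iff] at hi hj
  simp only [Prod.mk.injEq] at hij
  by_contra hne
  have h1 := hcb i hi.1 hi.2 j hj.1 (Ne.symm hne) hij.1.symm
  have h2 := hcb j hj.1 hj.2 i hi.1 hne hij.1
  rw [hij.2] at h1
  split_ifs at h1 h2
  · exact lt_asymm h1 h2
  · exact lt_asymm h1 h2

variable (D : Measure (Fin d → ℝ)) [IsProbabilityMeasure D]

/-- A sample is new with probability at most `2 * d * T.size / (t + 1)`, even conditionally on an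
event that does not depend on the order of the samples up to it. -/
theorem measure_new_inter_le (hd : 1 ≤ d) (T : DecisionTree d) (t : ℕ) {F : Set (ℕ → Fin d → ℝ)}
    (hF : MeasurableSet F) (hinv : ∀ i ≤ t, ∀ ω, ω ∘ Equiv.swap i t ∈ F ↔ ω ∈ F) :
    (Measure.infinitePi fun _ : ℕ => D).real ({ω | New T ω t} ∩ F) ≤
      2 * d * T.size / (t + 1) * (Measure.infinitePi fun _ : ℕ => D).real F := by
  classical
  set P := Measure.infinitePi fun _ : ℕ => D
  have hnew := measurableSet_new T t
  have hcomp : ∀ i : ℕ, Measurable fun ω : ℕ → Fin d → ℝ => ω ∘ Equiv.swap i t :=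
    fun i => by fun_prop
  -- All `t + 1` choices of the sample that comes last give the same probability, since neither `P`
  -- nor `F` notices the exchange.
  have hswap : ∀ i ∈ Finset.range (t + 1), P ({ω | New T ω t} ∩ F) =
      ∫⁻ ω, ({ω | New T (ω ∘ Equiv.swap i t) t} ∩ F).indicator 1 ω ∂P := by
    intro i hi
    have hmeas : MeasurableSet ({ω | New T (ω ∘ Equiv.swap i t) t} ∩ F) :=
      (hcomp i hnew).inter hF
    rw [lintegral_indicator_one hmeas]
    conv_lhs => rw [show P = P.map (fun ω => ω ∘ Equiv.swap i t) from
      (map_comp_perm_infinitePi D (Equiv.swap i t)).symm]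
    rw [Measure.map_apply (hcomp i) (hnew.inter hF)]
    congr 1
    ext ω
    exact and_congr_right fun _ => hinv i (Nat.lt_succ_iff.1 (Finset.mem_range.1 hi)) ω
  -- Summing over these choices inside the integral replaces probabilities by the pointwise count.
  have hsum : ((t + 1 : ℕ) : ℝ≥0∞) * P ({ω | New T ω t} ∩ F) ≤
      ((2 * d * T.size : ℕ) : ℝ≥0∞) * P F := by
    calc ((t + 1 : ℕ) : ℝ≥0∞) * P ({ω | New T ω t} ∩ F)
        = ∑ i ∈ Finset.range (t + 1), P ({ω | New T ω t} ∩ F) := by simp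
      _ = ∫⁻ ω, ∑ i ∈ Finset.range (t + 1),
            ({ω | New T (ω ∘ Equiv.swap i t) t} ∩ F).indicator 1 ω ∂P := by
          rw [Finset.sum_congr rfl hswap, lintegral_finsetSum]
          exact fun i _ => measurable_one.indicator ((hcomp i hnew).inter hF)
      _ ≤ ∫⁻ ω, F.indicator (fun _ => ((2 * d * T.size : ℕ) : ℝ≥0∞)) ω ∂P := by
          refine lintegral_mono fun ω => ?_
          by_cases hω : ω ∈ F
          · rw [Set.indicator_of_mem hω]
            refine le_trans (le_of_eq ?_) (Nat.cast_le.2 (card_new_swap_le hd T ω t))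
            rw [Finset.card_filter, Nat.cast_sum]
            refine Finset.sum_congr rfl fun i _ => ?_
            by_cases hn : New T (ω ∘ Equiv.swap i t) t <;> simp [hn, hω]
          · rw [Set.indicator_of_notMem hω]
            simp [hω]
      _ = ((2 * d * T.size : ℕ) : ℝ≥0∞) * P F := by rw [lintegral_indicator_const hF]
  have hreal := ENNReal.toReal_mono
    (ENNReal.mul_ne_top (ENNReal.natCast_ne_top _) (measure_ne_top P F)) hsum
  rw [ENNReal.toReal_mul, ENNReal.toReal_mul, ENNReal.toReal_natCast, ENNReal.toReal_natCast]
    at hreal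
  push_cast at hreal
  rw [div_mul_eq_mul_div, le_div_iff₀ (by positivity), mul_comm]
  exact hreal

theorem measure_new_le (hd : 1 ≤ d) (T : DecisionTree d) (t : ℕ) :
    (Measure.infinitePi fun _ : ℕ => D).real {ω | New T ω t} ≤ 2 * d * T.size / (t + 1) := by
  simpa using measure_new_inter_le D hd T t MeasurableSet.univ (by simp)

/-- Only the set of the earlier samples enters. This symmetry makes a later event admissible as `F`
in the bounds for earlier samples. -/
theorem new_comp_perm_iff {ω : ℕ → Fin d → ℝ} {t : ℕ} (e : Equiv.Perm ℕ)
    (he : ∀ i, i < t ↔ e i < t) (ht : e t = t) : New T (ω ∘ e) t ↔ New T ω t := by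
  have : seen (ω ∘ e) t = seen ω t := by
    ext y
    constructor
    · rintro ⟨i, hi, rfl⟩
      exact ⟨e i, (he i).1 hi, rfl⟩
    · rintro ⟨i, hi, rfl⟩
      exact ⟨e.symm i, (he _).2 (by simpa using hi), by simp⟩
  rw [New, New, this, Function.comp_apply, ht]

theorem new_comp_swap_iff {ω : ℕ → Fin d → ℝ} {t i j : ℕ} (hi : i < t) (hj : j < t) :
    New T (ω ∘ Equiv.swap i j) t ↔ New T ω t := by
  refine new_comp_perm_iff _ (fun k => ?_) (Equiv.swap_apply_of_ne_of_ne (by omega) (by omega))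
  rw [Equiv.swap_apply_def]
  split_ifs <;> omega

/-- If the boxes of the first `a` samples miss more than `ε`, then it is unlikely that the next `m`
samples fall into them. -/
theorem measure_inHull_of_lt_le (T : DecisionTree d) (a : ℕ) (ε : ℝ≥0∞) (m : ℕ) :
    MeasurableSet {ω : ℕ → Fin d → ℝ | ε < D {x | ¬ InHull T (seen ω a) x} ∧
      ∀ i, a ≤ i → i < a + m → InHull T (seen ω a) (ω i)} ∧
    Measure.infinitePi (fun _ : ℕ => D)
      {ω | ε < D {x | ¬ InHull T (seen ω a) x} ∧
        ∀ i, a ≤ i → i < a + m → InHull T (seen ω a) (ω i)} ≤ (1 - ε) ^ m := by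
  set P := Measure.infinitePi fun _ : ℕ => D
  have hbox := measurableSet_inHull T a
  have hsec : ∀ ω, MeasurableSet {x | InHull T (seen ω a) x} :=
    fun ω => measurable_prodMk_left hbox
  have hD : Measurable fun ω : ℕ → Fin d → ℝ => D {x | ¬ InHull T (seen ω a) x} :=
    measurable_measure_prodMk_left hbox.compl
  have hmeas : ∀ m, MeasurableSet {ω : ℕ → Fin d → ℝ | ε < D {x | ¬ InHull T (seen ω a) x} ∧
      ∀ i, a ≤ i → i < a + m → InHull T (seen ω a) (ω i)} := by
    intro m
    rw [Set.ofPred_and]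
    refine (measurableSet_lt measurable_const hD).inter ?_
    refine MeasurableSet.congr (s := ⋂ i, ⋂ (_ : a ≤ i), ⋂ (_ : i < a + m),
      (fun ω : ℕ → Fin d → ℝ => (ω, ω i)) ⁻¹' {p | InHull T (seen p.1 a) p.2}) ?_ ?_
    · exact MeasurableSet.iInter fun i => MeasurableSet.iInter fun _ => MeasurableSet.iInter
        fun _ => (measurable_id.prodMk (measurable_pi_apply i)) hbox
    · ext ω
      simp
  refine ⟨hmeas m, ?_⟩
  induction m with
  | zero => simpa using prob_le_one
  | succ m ih =>
    have hup : Measurable fun p : (ℕ → Fin d → ℝ) × (Fin d → ℝ) =>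
        Function.update p.1 (a + m) p.2 := by
      refine measurable_pi_iff.2 fun i => ?_
      by_cases h : i = a + m
      · subst h; simpa using measurable_snd
      · simp only [Function.update_of_ne h]
        exact (measurable_pi_apply i).comp measurable_fst
    have hseen : ∀ (ω : ℕ → Fin d → ℝ) x, seen (Function.update ω (a + m) x) a = seen ω a := by
      intro ω x
      ext y
      refine exists_congr fun i => and_congr_right fun hi => ?_
      rw [Function.update_of_ne (by omega)]
    -- Sample `a + m` is redrawn; the boxes depend only on the first `a` samples. Given the others,
    -- it falls into the boxes with probability at most `1 - ε` on the event for `m`, while off this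
    -- event the section is empty.
    rw [show P = (P.prod D).map _ from (map_update_infinitePi D (a + m)).symm,
      Measure.map_apply hup (hmeas _),
      Measure.prod_apply (hup (hmeas _))]
    calc _ ≤ ∫⁻ ω, {ω : ℕ → Fin d → ℝ | ε < D {x | ¬ InHull T (seen ω a) x} ∧
          ∀ i, a ≤ i → i < a + m → InHull T (seen ω a) (ω i)}.indicator (fun _ => 1 - ε) ω ∂P := by
          refine lintegral_mono fun ω => ?_
          by_cases hω : ω ∈ {ω : ℕ → Fin d → ℝ | ε < D {x | ¬ InHull T (seen ω a) x} ∧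
            ∀ i, a ≤ i → i < a + m → InHull T (seen ω a) (ω i)}
          · rw [Set.indicator_of_mem hω]
            calc _ ≤ D {x | InHull T (seen ω a) x} := by
                  refine measure_mono fun x hx => ?_
                  have := hx.2 (a + m) (by omega) (by omega)
                  simpa [hseen] using this
              _ = 1 - D {x | ¬ InHull T (seen ω a) x} := by
                  have hc : {x | ¬ InHull T (seen ω a) x} = {x | InHull T (seen ω a) x}ᶜ := rfl
                  rw [hc, ← prob_compl_eq_one_sub (hsec ω).compl, compl_compl]
              _ ≤ 1 - ε := tsub_le_tsub_left hω.1.le _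
          · rw [Set.indicator_of_notMem hω, nonpos_iff_eq_zero]
            convert measure_empty (μ := D)
            refine Set.eq_empty_of_forall_notMem fun x hx => hω ?_
            have h1 := hx.1
            have h2 := hx.2
            simp only [hseen] at h1 h2
            refine ⟨h1, fun i hi hi' => ?_⟩
            have := h2 i hi (by omega)
            rwa [Function.update_of_ne (by omega)] at this
      _ ≤ (1 - ε) ^ (m + 1) := by
          rw [lintegral_indicator_const (hmeas m), pow_succ']
          gcongr

end Rare

/-! ### Windows -/

section Windows

variable {d : ℕ} {n : ℕ → ℕ}

/-- The beginning of window number `k`; its length is `n k`. -/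
def winStart (d : ℕ) (n : ℕ → ℕ) (k : ℕ) : ℕ := 2 ^ k * d * n k

def winStarts (d : ℕ) (n : ℕ → ℕ) : Set ℕ := Set.range (winStart d n)

def winEnds (d : ℕ) (n : ℕ → ℕ) : Set ℕ := Set.range fun k => winStart d n k + n k

/-- Window number `k` contains a new sample. -/
def Fail (T : DecisionTree d) (n : ℕ → ℕ) (k : ℕ) : Set (ℕ → Fin d → ℝ) :=
  {ω | ∃ t ∈ Finset.Ico (winStart d n k) (winStart d n k + n k), New T ω t}

/-- Windows are disjoint, with a gap: each ends before the next one starts. -/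
theorem winStart_add_lt (hd : 1 ≤ d) (hn : StrictMono n) (k : ℕ) :
    winStart d n k + n k < winStart d n (k + 1) := by
  have ha : 1 ≤ 2 ^ k * d := Nat.one_le_iff_ne_zero.2 (by positivity)
  have hk : n k + 1 ≤ n (k + 1) := hn (Nat.lt_succ_self k)
  calc winStart d n k + n k < 2 ^ k * d * n k + 2 ^ k * d * (n k + 1) := by
        have := Nat.mul_le_mul_right (n k + 1) ha
        rw [winStart]; omega
    _ ≤ 2 ^ k * d * n (k + 1) + 2 ^ k * d * n (k + 1) := by gcongr; omega
    _ = winStart d n (k + 1) := by rw [winStart, pow_succ]; ring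

theorem winStart_strictMono (hd : 1 ≤ d) (hn : StrictMono n) : StrictMono (winStart d n) :=
  strictMono_nat_of_lt_succ fun k => (Nat.le_add_right _ _).trans_lt (winStart_add_lt hd hn k)

variable {T : DecisionTree d} {ω : ℕ → Fin d → ℝ}

/-- Getting past the end of window `k` requires a new sample since the last reset, hence one that is
not older than the start of this window. -/
theorem mem_fail_of_alive (h1 : ∀ k, 1 ≤ n k) {t k : ℕ}
    (h : Alive T ω (winStarts d n) (winEnds d n) t) (hk : winStart d n k + n k ≤ t) :
    ω ∈ Fail T n k := by
  have hpos := h1 k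
  -- `Alive` speaks of stopping after `j + 1` samples, so `j` is one less than the end of the
  -- window.
  have hs := h (winStart d n k + n k - 1) (by omega)
  rw [Nat.sub_add_cancel (by omega)] at hs
  have hdirty : Dirty T ω (winStarts d n) (winStart d n k + n k) := by
    by_contra hn
    exact hs ⟨⟨k, rfl⟩, hn⟩
  obtain ⟨i, hi, hnew, ha⟩ := hdirty
  have := ha _ ⟨k, rfl⟩
  exact ⟨i, Finset.mem_Ico.2 ⟨by omega, hi⟩, hnew⟩

/-- A new sample in the window would leave the flag set, since the only resets after it belong to
later windows, which start after this end. -/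
theorem exists_window_of_stops (hd : 1 ≤ d) (hn : StrictMono n) {t : ℕ}
    (h : Stops T ω (winStarts d n) (winEnds d n) t) :
    ∃ k, winStart d n k + n k = t ∧ ∀ i, winStart d n k ≤ i → i < winStart d n k + n k →
      InHull T (seen ω i) (ω i) := by
  obtain ⟨⟨k, rfl⟩, hdirty⟩ := h
  refine ⟨k, rfl, fun i hi hi' => ?_⟩
  by_contra hnew
  refine hdirty ⟨i, hi', hnew, ?_⟩
  rintro _ ⟨j, rfl⟩ ⟨hij, hj⟩
  have hkj : k < j := (winStart_strictMono hd hn).lt_iff_lt.1 (hi.trans_lt hij)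
  have := (winStart_strictMono hd hn).monotone (Nat.succ_le_of_lt hkj)
  have := winStart_add_lt hd hn k
  simp only [Nat.succ_eq_add_one] at *
  omega

theorem seen_mono (ω : ℕ → Fin d → ℝ) {s t : ℕ} (h : s ≤ t) : seen ω s ⊆ seen ω t :=
  fun _ ⟨i, hi, hy⟩ => ⟨i, hi.trans_le h, hy⟩

/-- If no sample between `a` and `b` is new, then the boxes do not change. -/
theorem inHull_of_forall_inHull {a b : ℕ}
    (h : ∀ i, a ≤ i → i < b → InHull T (seen ω i) (ω i)) :
    (∀ i, a ≤ i → i < b → InHull T (seen ω a) (ω i)) ∧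
      ∀ x, InHull T (seen ω b) x → InHull T (seen ω a) x := by
  have key : ∀ m, ∀ i < m, a ≤ i → i < b → InHull T (seen ω a) (ω i) := by
    intro m
    induction m with
    | zero => intro i hi; omega
    | succ m ih =>
      intro i hi hai hib
      refine (h i hai hib).trans ?_
      rintro y ⟨j, hj, rfl⟩
      rcases lt_or_ge j a with hja | hja
      · exact .inl ⟨j, hja, rfl⟩
      · exact .inr (ih j (by omega) hja (by omega))
  refine ⟨fun i => key (i + 1) i (by omega), fun x hx => hx.trans ?_⟩
  rintro y ⟨j, hj, rfl⟩
  rcases lt_or_ge j a with hja | hja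
  · exact .inl ⟨j, hja, rfl⟩
  · exact .inr (key (j + 1) j (by omega) hja hj)

theorem measurableSet_fail (T : DecisionTree d) (n : ℕ → ℕ) (k : ℕ) :
    MeasurableSet (Fail T n k) := by
  have : Fail T n k = ⋃ t ∈ Finset.Ico (winStart d n k) (winStart d n k + n k),
      {ω | New T ω t} := by
    ext ω; simp [Fail]
  rw [this]
  exact Finset.measurableSet_biUnion _ fun t _ => measurableSet_new T t

theorem measurableSet_alive (T : DecisionTree d) (starts ends : Set ℕ) (t : ℕ) :
    MeasurableSet {ω | Alive T ω starts ends t} := by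
  have hdirty : ∀ j, MeasurableSet {ω | Dirty T ω starts j} := by
    intro j
    have : {ω | Dirty T ω starts j} =
        ⋃ i, ⋃ (_ : i < j), ⋃ (_ : ∀ a ∈ starts, ¬ (i < a ∧ a ≤ j)), {ω | New T ω i} := by
      ext ω
      simp only [Dirty, Set.mem_ofPred_eq, Set.mem_iUnion, exists_prop]
      exact exists_congr fun i => and_congr_right fun _ => and_comm
    rw [this]
    exact MeasurableSet.iUnion fun i => MeasurableSet.iUnion fun _ => MeasurableSet.iUnion
      fun _ => measurableSet_new T i
  have : {ω | Alive T ω starts ends t} =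
      ⋂ j, ⋂ (_ : j < t), ⋂ (_ : j + 1 ∈ ends), {ω | Dirty T ω starts (j + 1)} := by
    ext ω
    simp only [Alive, Stops, Set.mem_ofPred_eq, Set.mem_iInter, not_and, not_not]
  rw [this]
  exact MeasurableSet.iInter fun j => MeasurableSet.iInter fun _ => MeasurableSet.iInter
    fun _ => hdirty _

/-! ### Probabilities of failed windows and of survival -/

variable (D : Measure (Fin d → ℝ)) [IsProbabilityMeasure D]

local notation "ℙ" => Measure.infinitePi (fun _ : ℕ => D)

/-- A union bound over `n k` samples, each new with probability at most `2ds/(2^k d n_k)` relative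
to `F`. The factors `d` and `n k` in `winStart` are there to cancel. -/
theorem measure_fail_inter_le (hd : 1 ≤ d) (h1 : ∀ k, 1 ≤ n k) (T : DecisionTree d) (k : ℕ)
    {F : Set (ℕ → Fin d → ℝ)} (hF : MeasurableSet F)
    (hinv : ∀ i j, i < winStart d n k + n k → j < winStart d n k + n k →
      ∀ ω, ω ∘ Equiv.swap i j ∈ F ↔ ω ∈ F) :
    (ℙ).real (Fail T n k ∩ F) ≤ 2 * T.size / 2 ^ k * (ℙ).real F := by
  have hsub : Fail T n k ∩ F ⊆ ⋃ t ∈ Finset.Ico (winStart d n k) (winStart d n k + n k),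
      ({ω | New T ω t} ∩ F) := by
    rintro ω ⟨⟨t, ht, hnew⟩, hω⟩
    exact Set.mem_biUnion ht ⟨hnew, hω⟩
  have hd' : (1 : ℝ) ≤ d := by exact_mod_cast hd
  have hn' : (1 : ℝ) ≤ n k := by exact_mod_cast h1 k
  have hstart : (winStart d n k : ℝ) = 2 ^ k * d * n k := by simp [winStart]
  have hpos : (0 : ℝ) < 2 ^ k * d * n k := by positivity
  calc (ℙ).real (Fail T n k ∩ F)
      ≤ (ℙ).real (⋃ t ∈ Finset.Ico (winStart d n k) (winStart d n k + n k),
          ({ω | New T ω t} ∩ F)) := measureReal_mono hsub (measure_ne_top _ _)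
    _ ≤ ∑ t ∈ Finset.Ico (winStart d n k) (winStart d n k + n k),
          (ℙ).real ({ω | New T ω t} ∩ F) := measureReal_biUnion_finset_le _ _
    _ ≤ ∑ t ∈ Finset.Ico (winStart d n k) (winStart d n k + n k),
          2 * d * T.size / (2 ^ k * d * n k) * (ℙ).real F := by
        refine Finset.sum_le_sum fun t ht => ?_
        obtain ⟨ht1, ht2⟩ := Finset.mem_Ico.1 ht
        refine (measure_new_inter_le D hd T t hF fun i hi ω => hinv i t (by omega) ht2 ω).trans ?_
        have : (winStart d n k : ℝ) ≤ t := by exact_mod_cast ht1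
        gcongr
        linarith
    _ = 2 * T.size / 2 ^ k * (ℙ).real F := by
        rw [Finset.sum_const, Nat.card_Ico, Nat.add_sub_cancel_left, nsmul_eq_mul]
        field_simp

theorem measure_fail_le (hd : 1 ≤ d) (h1 : ∀ k, 1 ≤ n k) (T : DecisionTree d) (k : ℕ) :
    (ℙ).real (Fail T n k) ≤ 2 * T.size / 2 ^ k := by
  simpa using measure_fail_inter_le D hd h1 T k MeasurableSet.univ (by simp)

/-- Survival until `t` forces window `k` to fail. Novelty of sample `t` is symmetric in the samples
up to the end of that window, so the two bounds multiply. -/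
theorem measure_new_alive_le (hd : 1 ≤ d) (hn : StrictMono n) (h1 : ∀ k, 1 ≤ n k)
    (T : DecisionTree d) {k t : ℕ} (ht : winStart d n (k + 1) ≤ t) :
    (ℙ).real {ω | New T ω t ∧ Alive T ω (winStarts d n) (winEnds d n) t} ≤
      2 * T.size / 2 ^ k * (2 * d * T.size / (t + 1)) := by
  have hlt := winStart_add_lt hd hn k
  calc _ ≤ (ℙ).real (Fail T n k ∩ {ω | New T ω t}) :=
        measureReal_mono fun ω hω => ⟨mem_fail_of_alive h1 hω.2 (by omega), hω.1⟩
    _ ≤ 2 * T.size / 2 ^ k * (ℙ).real {ω | New T ω t} :=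
        measure_fail_inter_le D hd h1 T k (measurableSet_new T t) fun i j hi hj ω =>
          new_comp_swap_iff (by omega) (by omega)
    _ ≤ _ := by
        gcongr
        exact measure_new_le D hd T t

/-- Two failed windows are used because the decay `4^-k` must beat the growth of `winStart`, which
contains `2^k`. -/
theorem measure_alive_le (hd : 1 ≤ d) (hn : StrictMono n) (h1 : ∀ k, 1 ≤ n k)
    (T : DecisionTree d) {k t : ℕ} (ht : winStart d n (k + 2) ≤ t) :
    (ℙ).real {ω | Alive T ω (winStarts d n) (winEnds d n) t} ≤
      2 * T.size / 2 ^ k * (2 * T.size / 2 ^ (k + 1)) := by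
  have hlt := winStart_add_lt hd hn k
  have hlt' : _ < winStart d n (k + 2) := winStart_add_lt hd hn (k + 1)
  calc _ ≤ (ℙ).real (Fail T n k ∩ Fail T n (k + 1)) :=
        measureReal_mono fun ω hω => ⟨mem_fail_of_alive h1 hω (by omega),
          mem_fail_of_alive h1 hω (by omega)⟩
    _ ≤ 2 * T.size / 2 ^ k * (ℙ).real (Fail T n (k + 1)) := by
        refine measure_fail_inter_le D hd h1 T k (measurableSet_fail T n _) fun i j hi hj ω =>
          exists_congr fun t => and_congr_right fun ht => ?_
        have := (Finset.mem_Ico.1 ht).1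
        exact new_comp_swap_iff (by omega) (by omega)
    _ ≤ _ := by
        gcongr
        exact measure_fail_le D hd h1 T _

theorem measure_forall_alive (hd : 1 ≤ d) (h1 : ∀ k, 1 ≤ n k) (T : DecisionTree d) :
    (ℙ) {ω | ∀ t, Alive T ω (winStarts d n) (winEnds d n) t} = 0 := by
  rw [← measureReal_eq_zero_iff]
  refine le_antisymm (ge_of_tendsto' (x := Filter.atTop)
    (f := fun k : ℕ => 2 * (T.size : ℝ) * (1 / 2) ^ k) ?_ fun k => ?_) measureReal_nonneg
  · simpa using (tendsto_pow_atTop_nhds_zero_of_lt_one (r := (1 / 2 : ℝ)) (by norm_num)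
      (by norm_num)).const_mul (2 * (T.size : ℝ))
  · refine (measureReal_mono fun ω hω => ?_).trans ((measure_fail_le D hd h1 T k).trans_eq ?_)
    · exact mem_fail_of_alive h1 (hω _) le_rfl
    · rw [one_div, inv_pow, div_eq_mul_inv]

/-! ### Summing the probabilities over all samples -/

theorem lintegral_tsum_indicator_le {Ω : Type*} [MeasurableSpace Ω] {P : Measure Ω}
    [IsFiniteMeasure P] {f : ℕ → Set Ω} (hf : ∀ t, MeasurableSet (f t)) (c : ℕ) {b : ℝ}
    (h : ∀ N, ∑ t ∈ Finset.range N, P.real (f t) ≤ b) :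
    ∫⁻ ω, ∑' t, (f t).indicator (fun _ => (c : ℝ≥0∞)) ω ∂P ≤ ENNReal.ofReal (c * b) := by
  rw [lintegral_tsum fun t => (measurable_const.indicator (hf t)).aemeasurable]
  simp only [lintegral_indicator_const (hf _), ENNReal.tsum_mul_left]
  rw [ENNReal.ofReal_mul (by positivity), ENNReal.ofReal_natCast]
  gcongr
  refine ENNReal.tsum_le_of_sum_range_le fun N => ?_
  calc ∑ t ∈ Finset.range N, P (f t) = ENNReal.ofReal (∑ t ∈ Finset.range N, P.real (f t)) := by
        rw [ENNReal.ofReal_sum_of_nonneg fun _ _ => measureReal_nonneg]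
        exact Finset.sum_congr rfl fun t _ => (ofReal_measureReal).symm
    _ ≤ ENNReal.ofReal b := ENNReal.ofReal_le_ofReal (h N)

/-- The first `a` terms are bounded by 1; from there on, `1/(N+1) ≤ log((N+1)/N)` telescopes.
Starting at `a` puts the quotient `N / a` into the logarithm. -/
theorem sum_range_le_log {u : ℕ → ℝ} {a N : ℕ} (ha : 1 ≤ a) (hN : a ≤ N) (h1 : ∀ t, u t ≤ 1)
    (hu : ∀ t : ℕ, u t ≤ a / (t + 1)) :
    ∑ t ∈ Finset.range N, u t ≤ a + a * Real.log (N / a) := by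
  have ha' : (0 : ℝ) < a := by exact_mod_cast ha
  induction N, hN using Nat.le_induction with
  | base =>
    rw [div_self ha'.ne', Real.log_one, mul_zero, add_zero]
    exact (Finset.sum_le_sum fun t _ => h1 t).trans (by simp)
  | succ N hN ih =>
    have hN' : (0 : ℝ) < N := ha'.trans_le (by exact_mod_cast hN)
    rw [Finset.sum_range_succ]
    have h2 := Real.one_sub_inv_le_log_of_pos (x := ((N : ℝ) + 1) / N) (by positivity)
    have h3 : 1 - (((N : ℝ) + 1) / N)⁻¹ = 1 / (N + 1) := by field_simp; ring
    have h4 : Real.log (((N + 1 : ℕ) : ℝ) / a) = Real.log (N / a) + Real.log ((N + 1) / N) := by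
      rw [← Real.log_mul (by positivity) (by positivity)]
      congr 1
      push_cast
      field_simp
    rw [h4]
    have h5 : u N ≤ a * Real.log ((N + 1) / N) :=
      (hu N).trans (by rw [div_eq_mul_one_div, ← h3]; gcongr)
    linarith

theorem winStart_succ_le (h2 : ∀ k, n (k + 1) ≤ 2 * n k) (k : ℕ) :
    winStart d n (k + 1) ≤ 4 * winStart d n k :=
  calc winStart d n (k + 1) ≤ 2 ^ (k + 1) * d * (2 * n k) := Nat.mul_le_mul_left _ (h2 k)
    _ = 4 * winStart d n k := by rw [winStart, pow_succ]; ring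

/-- Before `winStart d n (k + 1)` the harmonic sum is used. The blocks between later window starts
add at most `12ds/2^m`, because `2^k` absorbs one factor `s`; their total `24ds` accounts for 12 of
the 13. -/
theorem sum_measure_new_alive_le (hd : 1 ≤ d) (hn : StrictMono n) (h1 : ∀ k, 1 ≤ n k)
    (h2 : ∀ k, n (k + 1) ≤ 2 * n k) (T : DecisionTree d) {k : ℕ} (hk : T.size ≤ 2 ^ k) (N : ℕ) :
    ∑ t ∈ Finset.range N, (ℙ).real {ω | New T ω t ∧ Alive T ω (winStarts d n) (winEnds d n) t} ≤
      2 * d * T.size * (13 + Real.log (winStart d n (k + 1) / (2 * d * T.size))) := by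
  set u : ℕ → ℝ := fun t =>
    (ℙ).real {ω | New T ω t ∧ Alive T ω (winStarts d n) (winEnds d n) t} with hu
  have hs := T.size_pos
  have hs' : (1 : ℝ) ≤ T.size := by exact_mod_cast hs
  have hd' : (1 : ℝ) ≤ d := by exact_mod_cast hd
  have hk' : (T.size : ℝ) ≤ 2 ^ k := by exact_mod_cast hk
  have hbase : ∑ t ∈ Finset.range (winStart d n (k + 1)), u t ≤
      2 * d * T.size * (1 + Real.log (winStart d n (k + 1) / (2 * d * T.size))) := by
    have := sum_range_le_log (u := u) (a := 2 * d * T.size) (N := winStart d n (k + 1))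
      (Nat.one_le_iff_ne_zero.2 (by positivity)) ?_ (fun t => measureReal_le_one) fun t => ?_
    · push_cast at this
      linarith
    · calc 2 * d * T.size ≤ 2 * d * 2 ^ k * 1 := by rw [mul_one]; gcongr
        _ ≤ 2 * d * 2 ^ k * n (k + 1) := Nat.mul_le_mul_left _ (h1 _)
        _ = winStart d n (k + 1) := by rw [winStart, pow_succ]; ring
    · push_cast
      exact (measureReal_mono fun ω hω => hω.1).trans (measure_new_le D hd T t)
  have hblock : ∀ j, ∑ t ∈ Finset.Ico (winStart d n (j + 1)) (winStart d n (j + 2)), u t ≤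
      12 * d * T.size ^ 2 / 2 ^ j := by
    intro j
    have hpos : (0 : ℝ) < winStart d n (j + 1) := by
      have := h1 (j + 1)
      rw [winStart]; positivity
    calc _ ≤ ∑ t ∈ Finset.Ico (winStart d n (j + 1)) (winStart d n (j + 2)),
          2 * T.size / 2 ^ j * (2 * d * T.size / (winStart d n (j + 1) : ℝ)) := by
          refine Finset.sum_le_sum fun t ht => ?_
          have ht1 := (Finset.mem_Ico.1 ht).1
          refine (measure_new_alive_le D hd hn h1 T ht1).trans ?_
          have : (winStart d n (j + 1) : ℝ) ≤ t := by exact_mod_cast ht1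
          gcongr
          linarith
      _ = ((winStart d n (j + 2) - winStart d n (j + 1) : ℕ) : ℝ) *
          (2 * T.size / 2 ^ j * (2 * d * T.size / (winStart d n (j + 1) : ℝ))) := by
          rw [Finset.sum_const, Nat.card_Ico, nsmul_eq_mul]
      _ ≤ (3 * winStart d n (j + 1) : ℝ) *
          (2 * T.size / 2 ^ j * (2 * d * T.size / (winStart d n (j + 1) : ℝ))) := by
          have : winStart d n (j + 2) ≤ _ := winStart_succ_le (d := d) h2 (j + 1)
          have h3 : winStart d n (j + 2) - winStart d n (j + 1) ≤ 3 * winStart d n (j + 1) := by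
            omega
          have : ((winStart d n (j + 2) - winStart d n (j + 1) : ℕ) : ℝ) ≤
            3 * winStart d n (j + 1) := by exact_mod_cast h3
          gcongr
      _ = _ := by field_simp; ring
  have hall : ∀ m, ∑ t ∈ Finset.range (winStart d n (k + 1 + m)), u t ≤
      2 * d * T.size * (1 + Real.log (winStart d n (k + 1) / (2 * d * T.size))) +
        24 * d * T.size * (1 - 1 / 2 ^ m) := by
    intro m
    induction m with
    | zero => simpa using hbase
    | succ m ih =>
      have hmono := (winStart_strictMono hd hn).monotone (show k + 1 + m ≤ k + 1 + (m + 1) by omega)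
      rw [← Finset.sum_range_add_sum_Ico _ hmono]
      have hb := hblock (k + m)
      rw [show k + m + 1 = k + 1 + m by ring, show k + m + 2 = k + 1 + (m + 1) by ring] at hb
      have : 12 * (d : ℝ) * T.size ^ 2 / 2 ^ (k + m) ≤ 12 * d * T.size / 2 ^ m := by
        rw [div_le_div_iff₀ (by positivity) (by positivity), pow_add]
        calc 12 * (d : ℝ) * T.size ^ 2 * 2 ^ m = 12 * d * T.size * (T.size * 2 ^ m) := by ring
          _ ≤ 12 * d * T.size * (2 ^ k * 2 ^ m) := by gcongr
      have h6 : 24 * (d : ℝ) * T.size * (1 - 1 / 2 ^ (m + 1)) =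
          24 * d * T.size * (1 - 1 / 2 ^ m) + 12 * d * T.size / 2 ^ m := by
        rw [pow_succ]; field_simp; ring
      rw [h6]
      linarith
  have hN : N ≤ winStart d n (k + 1 + N) := by
    have := (winStart_strictMono hd hn).le_apply (x := k + 1 + N)
    omega
  calc ∑ t ∈ Finset.range N, u t ≤ ∑ t ∈ Finset.range (winStart d n (k + 1 + N)), u t :=
        Finset.sum_le_sum_of_subset_of_nonneg (Finset.range_mono hN) fun _ _ _ => measureReal_nonneg
    _ ≤ _ := hall N
    _ ≤ _ := by
        have : 24 * (d : ℝ) * T.size * (1 - 1 / 2 ^ N) ≤ 24 * d * T.size * 1 := by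
          gcongr
          have : (0 : ℝ) < 1 / 2 ^ N := by positivity
          linarith
        linarith

/-- Samples before window 2 are counted in full. Between the starts of windows `j + 2` and `j + 3`
there are at most `3 · 2^(j+2) d n_(j+2)` samples, each reached with probability at most `2s²/4^j`.
-/
theorem sum_measure_alive_le (hd : 1 ≤ d) (hn : StrictMono n) (h1 : ∀ k, 1 ≤ n k)
    (h2 : ∀ k, n (k + 1) ≤ 2 * n k) (T : DecisionTree d) {L e : ℝ} (hL : 0 ≤ L) (he : 0 ≤ e)
    (hle : ∀ k : ℕ, (n k : ℝ) ≤ (L + k + 3) * e) (N : ℕ) :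
    ∑ t ∈ Finset.range N, (ℙ).real {ω | Alive T ω (winStarts d n) (winEnds d n) t} ≤
      4 * d * ((L + 5) * e) + 24 * d * T.size ^ 2 * ((2 * L + 12) * e) := by
  set u : ℕ → ℝ := fun t => (ℙ).real {ω | Alive T ω (winStarts d n) (winEnds d n) t} with hu
  have hblock : ∀ j : ℕ, ∑ t ∈ Finset.Ico (winStart d n (j + 2)) (winStart d n (j + 3)), u t ≤
      24 * d * T.size ^ 2 * ((L + j + 5) / 2 ^ j * e) := by
    intro j
    calc _ ≤ ∑ t ∈ Finset.Ico (winStart d n (j + 2)) (winStart d n (j + 3)),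
          2 * T.size / 2 ^ j * (2 * (T.size : ℝ) / 2 ^ (j + 1)) :=
          Finset.sum_le_sum fun t ht => measure_alive_le D hd hn h1 T (Finset.mem_Ico.1 ht).1
      _ = ((winStart d n (j + 3) - winStart d n (j + 2) : ℕ) : ℝ) *
          (2 * T.size / 2 ^ j * (2 * (T.size : ℝ) / 2 ^ (j + 1))) := by
          rw [Finset.sum_const, Nat.card_Ico, nsmul_eq_mul]
      _ ≤ (3 * (2 ^ (j + 2) * d * ((L + j + 5) * e))) *
          (2 * T.size / 2 ^ j * (2 * (T.size : ℝ) / 2 ^ (j + 1))) := by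
          have : winStart d n (j + 3) ≤ _ := winStart_succ_le (d := d) h2 (j + 2)
          have h3 : winStart d n (j + 3) - winStart d n (j + 2) ≤ 3 * winStart d n (j + 2) := by
            omega
          have h4 : ((winStart d n (j + 3) - winStart d n (j + 2) : ℕ) : ℝ) ≤
            3 * (2 ^ (j + 2) * d * n (j + 2)) := by
              refine (Nat.cast_le.2 h3).trans_eq ?_
              simp [winStart]
          have h5 := hle (j + 2)
          push_cast at h5
          refine mul_le_mul_of_nonneg_right (h4.trans ?_) (by positivity)
          gcongr
          linarith
      _ = _ := by
          rw [pow_add, pow_add]; field_simp; ring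
  -- The subtracted term is the tail: `(2L + 2m + 12)/2^m` is the sum of `(L + j + 5)/2^j` over `j ≥
  -- m`.
  have hall : ∀ m : ℕ, ∑ t ∈ Finset.range (winStart d n (m + 2)), u t ≤
      4 * d * ((L + 5) * e) + 24 * d * T.size ^ 2 * ((2 * L + 12) * e) -
        24 * d * T.size ^ 2 * ((2 * L + 2 * m + 12) / 2 ^ m * e) := by
    intro m
    induction m with
    | zero =>
      have h5 := hle 2
      push_cast at h5
      calc ∑ t ∈ Finset.range (winStart d n (0 + 2)), u t
          ≤ ∑ t ∈ Finset.range (winStart d n (0 + 2)), 1 :=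
            Finset.sum_le_sum fun t _ => measureReal_le_one
        _ = 4 * d * n 2 := by simp [winStart]
        _ ≤ 4 * d * ((L + 5) * e) := by gcongr; linarith
        _ = _ := by simp
    | succ m ih =>
      have hmono := (winStart_strictMono hd hn).monotone (show m + 2 ≤ m + 3 by omega)
      rw [show m + 1 + 2 = m + 3 by ring, ← Finset.sum_range_add_sum_Ico _ hmono]
      have hb := hblock m
      have h6 : 24 * (d : ℝ) * T.size ^ 2 * ((2 * L + 2 * m + 12) / 2 ^ m * e) =
          24 * d * T.size ^ 2 * ((2 * L + 2 * ((m + 1 : ℕ) : ℝ) + 12) / 2 ^ (m + 1) * e) +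
          24 * d * T.size ^ 2 * ((L + m + 5) / 2 ^ m * e) := by
        rw [pow_succ]; push_cast; field_simp; ring
      linarith
  have hN : N ≤ winStart d n (N + 2) := by
    have := (winStart_strictMono hd hn).le_apply (x := N + 2)
    omega
  calc ∑ t ∈ Finset.range N, u t ≤ ∑ t ∈ Finset.range (winStart d n (N + 2)), u t :=
        Finset.sum_le_sum_of_subset_of_nonneg (Finset.range_mono hN) fun _ _ _ => measureReal_nonneg
    _ ≤ _ := hall N
    _ ≤ _ := sub_le_self _ (by positivity)

end Windows

/-! ### The choice of the windows -/

section Final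

/-- The length of window number `k`. -/
noncomputable def winLen (ε δ : ℝ) (k : ℕ) : ℕ := ⌈(Real.log δ⁻¹ + k + 2) / ε⌉₊

variable {ε δ : ℝ}

theorem log_inv_nonneg (hδ : 0 < δ) (hδ1 : δ < 1) : 0 ≤ Real.log δ⁻¹ :=
  Real.log_nonneg ((one_le_inv₀ hδ).2 hδ1.le)

theorem winLen_strictMono (hε : 0 < ε) (hε1 : ε < 1) (hδ : 0 < δ) (hδ1 : δ < 1) :
    StrictMono (winLen ε δ) := by
  refine strictMono_nat_of_lt_succ fun k => Nat.lt_of_succ_le ?_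
  have hL := log_inv_nonneg hδ hδ1
  rw [winLen, winLen, Nat.succ_eq_add_one, ← Nat.ceil_add_one (by positivity)]
  refine Nat.ceil_mono ?_
  rw [div_add_one hε.ne', div_le_div_iff_of_pos_right hε]
  push_cast
  linarith

theorem one_le_winLen (hε : 0 < ε) (hδ : 0 < δ) (hδ1 : δ < 1) (k : ℕ) : 1 ≤ winLen ε δ k := by
  have hL := log_inv_nonneg hδ hδ1
  exact Nat.ceil_pos.2 (by positivity)

theorem winLen_succ_le (hε : 0 < ε) (hδ : 0 < δ) (hδ1 : δ < 1) (k : ℕ) :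
    winLen ε δ (k + 1) ≤ 2 * winLen ε δ k := by
  have hL := log_inv_nonneg hδ hδ1
  refine Nat.ceil_le.2 ?_
  calc (Real.log δ⁻¹ + (k + 1 : ℕ) + 2) / ε ≤ 2 * ((Real.log δ⁻¹ + k + 2) / ε) := by
        rw [← mul_div_assoc, div_le_div_iff_of_pos_right hε]
        push_cast
        have : (0 : ℝ) ≤ k := k.cast_nonneg
        linarith
    _ ≤ ((2 * winLen ε δ k : ℕ) : ℝ) := by
        rw [Nat.cast_mul, Nat.cast_ofNat]
        gcongr
        exact Nat.le_ceil _

theorem winLen_le (hε : 0 < ε) (hε1 : ε < 1) (hδ : 0 < δ) (hδ1 : δ < 1) (k : ℕ) :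
    (winLen ε δ k : ℝ) ≤ (Real.log δ⁻¹ + k + 3) * ε⁻¹ := by
  have hL := log_inv_nonneg hδ hδ1
  have h := (Nat.ceil_lt_add_one (a := (Real.log δ⁻¹ + k + 2) / ε) (by positivity)).le
  have h1 := (one_le_inv₀ hε).2 hε1.le
  rw [div_eq_mul_inv] at h
  rw [winLen, div_eq_mul_inv]
  linarith

/-- By `1 - ε ≤ exp(-ε)` and the choice of `winLen`, the power is at most `δ exp(-(k+2))`. The `k`
makes the errors summable over the windows; the `2` brings their sum down to `δ/2`, strictly below
`δ`. -/
theorem one_sub_pow_winLen_le (hε : 0 < ε) (hε1 : ε < 1) (hδ : 0 < δ) (k : ℕ) :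
    (1 - ENNReal.ofReal ε) ^ winLen ε δ k ≤ ENNReal.ofReal (δ / 2 / 2 * (1 / 2) ^ k) := by
  rw [← ENNReal.ofReal_one, ← ENNReal.ofReal_sub _ hε.le, ← ENNReal.ofReal_pow (by linarith)]
  refine ENNReal.ofReal_le_ofReal ?_
  have h2 : (2 : ℝ) ≤ Real.exp 1 := by
    have := Real.add_one_le_exp (1 : ℝ)
    linarith
  calc (1 - ε) ^ winLen ε δ k ≤ Real.exp (-ε) ^ winLen ε δ k := by
        have := Real.add_one_le_exp (-ε)
        exact pow_le_pow_left₀ (by linarith) (by linarith) _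
    _ = Real.exp (-(ε * winLen ε δ k)) := by rw [← Real.exp_nat_mul]; congr 1; ring
    _ ≤ Real.exp (-(Real.log δ⁻¹ + k + 2)) := by
        gcongr
        have := Nat.le_ceil ((Real.log δ⁻¹ + k + 2) / ε)
        rw [div_le_iff₀ hε, mul_comm] at this
        exact this
    _ = δ * (Real.exp 1 ^ (k + 2))⁻¹ := by
        rw [← Real.exp_nat_mul, ← Real.exp_neg, Real.log_inv]
        conv_rhs => enter [1]; rw [← Real.exp_log hδ]
        rw [← Real.exp_add]
        congr 1
        push_cast
        ring
    _ ≤ δ * (2 ^ (k + 2))⁻¹ := by gcongr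
    _ = δ / 2 / 2 * (1 / 2) ^ k := by rw [pow_add, one_div, inv_pow]; field_simp

/-! ### Correctness and the three resource bounds -/

/-- The counter tests of the learner. -/
noncomputable def boxTest (d : ℕ) (ε δ : ℝ) : ℕ → ℕ → ℕ → Bool :=
  windowTest (winStarts d (winLen ε δ)) (winEnds d (winLen ε δ))

theorem boxLearner_rpuLearns (hε : 0 < ε) (hε1 : ε < 1) (hδ : 0 < δ) (hδ1 : δ < 1)
    {d : ℕ} (hd : 1 ≤ d) :
    boxLearner.RPULearns (boxTest d ε δ) d ε δ := by
  set n := winLen ε δ with hn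
  have hmono : StrictMono n := winLen_strictMono hε hε1 hδ hδ1
  have h1 : ∀ k, 1 ≤ n k := one_le_winLen hε hδ hδ1
  intro D _ T
  refine ⟨?_, fun ω x hx => ?_⟩
  · calc _ ≤ Measure.infinitePi (fun _ : ℕ => D)
          ({ω | ∀ t, Alive T ω (winStarts d n) (winEnds d n) t} ∪
            ⋃ k, {ω | ENNReal.ofReal ε < D {x | ¬ InHull T (seen ω (winStart d n k)) x} ∧
              ∀ i, winStart d n k ≤ i → i < winStart d n k + n k →
                InHull T (seen ω (winStart d n k)) (ω i)}) := by
          refine measure_mono fun ω hω => ?_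
          rcases alive_or_stops (T := T) (ω := ω) (starts := winStarts d n)
            (ends := winEnds d n) with h | ⟨t, h, hs⟩
          · exact .inl h
          · refine .inr (Set.mem_iUnion.2 ?_)
            obtain ⟨k, hk, hin⟩ := exists_window_of_stops hd hmono hs
            obtain ⟨hin1, hin2⟩ := inHull_of_forall_inHull hin
            -- The boxes at the start of the window lie within the final ones, so whatever the
            -- classifier leaves open was already missed at the start.
            refine ⟨k, lt_of_lt_of_le hω (measure_mono fun x hx hx' => ?_), hin1⟩
            have hcl := (classifier_of_stops hd h hs x).1 (by
              rw [← hk]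
              exact hx'.mono (seen_mono ω (Nat.le_add_right _ _)))
            have hx : boxLearner.classifier ⟨ω, T, windowTest (winStarts d n) (winEnds d n)⟩ x =
              none := hx
            rw [hcl] at hx
            simp at hx
      _ ≤ 0 + ∑' k, ENNReal.ofReal (δ / 2 / 2 * (1 / 2) ^ k) := by
          refine (measure_union_le _ _).trans (add_le_add
            (measure_forall_alive D hd h1 T).le ((measure_iUnion_le _).trans
            (ENNReal.tsum_le_tsum fun k => ?_)))
          exact (measure_inHull_of_lt_le D T _ _ _).2.trans (one_sub_pow_winLen_le hε hε1 hδ k)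
      _ = ENNReal.ofReal (δ / 2) := by
          rw [zero_add, ← ENNReal.ofReal_tsum_of_nonneg (fun k => by positivity)
            (summable_geometric_two.mul_left _), tsum_mul_left, tsum_geometric_two]
          congr 1
          ring
      _ < ENNReal.ofReal δ := (ENNReal.ofReal_lt_ofReal_iff hδ).2 (by linarith)
  · change boxLearner.classifier ⟨ω, T, windowTest (winStarts d n) (winEnds d n)⟩ x ≠ none at hx
    change boxLearner.classifier ⟨ω, T, windowTest (winStarts d n) (winEnds d n)⟩ x = _
    rcases alive_or_stops (T := T) (ω := ω) (starts := winStarts d n)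
      (ends := winEnds d n) with h | ⟨t, h, hs⟩
    · exact absurd (classifier_of_alive hd h x) hx
    · have hcl := classifier_of_stops hd h hs x
      by_cases hin : InHull T (seen ω (t + 1)) x
      · exact hcl.1 hin
      · exact absurd (hcl.2 hin) hx

theorem exists_pow_two_between {s : ℕ} (hs : 1 ≤ s) : ∃ k, s ≤ 2 ^ k ∧ 2 ^ k ≤ 2 * s := by
  obtain ⟨k, h1, h2⟩ := exists_nat_pow_near (x := s) (y := 2) hs (by norm_num)
  exact ⟨k + 1, h2.le, by rw [pow_succ]; omega⟩

/-- Take `k` with `s ≤ 2^k ≤ 2s`. The start of window `k + 1` enters only through a logarithm, so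
crude bounds such as `k ≤ 2s` and `log δ⁻¹ ≤ δ⁻¹ - 1` cost only constants; `96 = 2 · 2 · 24`. -/
theorem lintegral_queryCount_le (hε : 0 < ε) (hε1 : ε < 1) (hδ : 0 < δ) (hδ1 : δ < 1)
    {d : ℕ} (hd : 1 ≤ d) (D : Measure (Fin d → ℝ)) [IsProbabilityMeasure D] (T : DecisionTree d) :
    ∫⁻ ω, boxLearner.queryCount ⟨ω, T, boxTest d ε δ⟩ ∂(Measure.infinitePi fun _ : ℕ => D) ≤
      ENNReal.ofReal (96 * (d * T.size ^ 2 * (1 + Real.log (T.size / (ε * δ))))) := by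
  set n := winLen ε δ with hn
  have hmono : StrictMono n := winLen_strictMono hε hε1 hδ hδ1
  have h1 : ∀ k, 1 ≤ n k := one_le_winLen hε hδ hδ1
  have h2 : ∀ k, n (k + 1) ≤ 2 * n k := winLen_succ_le hε hδ hδ1
  have hs := T.size_pos
  have hs' : (1 : ℝ) ≤ T.size := by exact_mod_cast hs
  have hd' : (1 : ℝ) ≤ d := by exact_mod_cast hd
  have hεδ : ε * δ ≤ 1 := by nlinarith
  have hlog : 0 ≤ Real.log (T.size / (ε * δ)) :=
    Real.log_nonneg ((one_le_div (by positivity)).2 (hεδ.trans hs'))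
  obtain ⟨k, hk, hk'⟩ := exists_pow_two_between hs
  refine (lintegral_mono fun ω => queryCount_le hd).trans
    ((lintegral_tsum_indicator_le (fun t => (measurableSet_new T t).inter
      (measurableSet_alive T _ _ t)) (T.size + 1)
      (sum_measure_new_alive_le D hd hmono h1 h2 T hk)).trans (ENNReal.ofReal_le_ofReal ?_))
  have hkr : (k : ℝ) ≤ 2 * T.size := by
    have := (Nat.lt_two_pow_self (n := k)).le.trans hk'
    exact_mod_cast this
  have hk2 : (2 : ℝ) ^ k ≤ 2 * T.size := by exact_mod_cast hk'
  have hL : Real.log δ⁻¹ ≤ δ⁻¹ - 1 := Real.log_le_sub_one_of_pos (by positivity)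
  have hδi : 1 ≤ δ⁻¹ := (one_le_inv₀ hδ).2 hδ1.le
  have hlen : (n (k + 1) : ℝ) ≤ 6 * T.size * δ⁻¹ * ε⁻¹ := by
    refine (winLen_le hε hε1 hδ hδ1 (k + 1)).trans ?_
    push_cast
    gcongr
    nlinarith
  have hstart : (winStart d n (k + 1) : ℝ) / (2 * d * T.size) ≤ 12 * (T.size / (ε * δ)) := by
    rw [div_le_iff₀ (by positivity)]
    calc (winStart d n (k + 1) : ℝ) = 2 * 2 ^ k * d * n (k + 1) := by
          rw [winStart]; push_cast; ring
      _ ≤ 2 * (2 * T.size) * d * (6 * T.size * δ⁻¹ * ε⁻¹) := by gcongr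
      _ = 12 * (T.size / (ε * δ)) * (2 * d * T.size) := by field_simp; ring
  have hpos : (0 : ℝ) < winStart d n (k + 1) := by
    have := h1 (k + 1)
    rw [winStart]; positivity
  have hlog' : Real.log (winStart d n (k + 1) / (2 * d * T.size)) ≤
      11 + Real.log (T.size / (ε * δ)) := by
    refine (Real.log_le_log (by positivity) hstart).trans ?_
    rw [Real.log_mul (by norm_num) (by positivity)]
    have := Real.log_le_sub_one_of_pos (x := 12) (by norm_num)
    linarith
  calc ((T.size + 1 : ℕ) : ℝ) *
        (2 * d * T.size * (13 + Real.log (winStart d n (k + 1) / (2 * d * T.size))))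
      ≤ (2 * T.size) * (2 * d * T.size * (24 + 24 * Real.log (T.size / (ε * δ)))) := by
        have h3 : ((T.size + 1 : ℕ) : ℝ) ≤ 2 * T.size := by push_cast; linarith
        refine mul_le_mul h3 ?_ ?_ (by positivity)
        · refine mul_le_mul_of_nonneg_left ?_ (by positivity)
          linarith
        -- Multiplying the two estimates needs this factor to be nonnegative; it is, since `s ≤ 2^k`
        -- puts the window start at or beyond `2ds`.
        · have : 0 ≤ Real.log (winStart d n (k + 1) / (2 * d * T.size)) := by
            refine Real.log_nonneg ((one_le_div (by positivity)).2 ?_)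
            have hn1 : (1 : ℝ) ≤ n (k + 1) := by exact_mod_cast h1 (k + 1)
            have hk1 : (T.size : ℝ) ≤ 2 ^ k := by exact_mod_cast hk
            calc (2 * d * T.size : ℝ) = 2 * T.size * d * 1 := by ring
              _ ≤ 2 * 2 ^ k * d * n (k + 1) := by gcongr
              _ = winStart d n (k + 1) := by rw [winStart]; push_cast; ring
          positivity
    _ = 96 * (d * T.size ^ 2 * (1 + Real.log (T.size / (ε * δ)))) := by ring

/-- A bound for the running time in terms of size, dimension, `ε⁻¹` and `log δ⁻¹`. -/
noncomputable def timePoly : MvPolynomial (Fin 4) ℝ :=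
  open MvPolynomial in
  7 + (X 0 * (34 * X 1 + 28) + 8 * X 1 + 48) *
    (4 * X 1 * ((X 3 + 5) * X 2) + 24 * X 1 * X 0 ^ 2 * ((2 * X 3 + 12) * X 2))

theorem lintegral_runningTime_le (hε : 0 < ε) (hε1 : ε < 1) (hδ : 0 < δ) (hδ1 : δ < 1)
    {d : ℕ} (hd : 1 ≤ d) (D : Measure (Fin d → ℝ)) [IsProbabilityMeasure D] (T : DecisionTree d) :
    ∫⁻ ω, boxLearner.runningTime ⟨ω, T, boxTest d ε δ⟩ ∂(Measure.infinitePi fun _ : ℕ => D) ≤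
      ENNReal.ofReal
        (MvPolynomial.eval ![(T.size : ℝ), (d : ℝ), ε⁻¹, Real.log δ⁻¹] timePoly) := by
  have hL := log_inv_nonneg hδ hδ1
  have hpoly : MvPolynomial.eval ![(T.size : ℝ), (d : ℝ), ε⁻¹, Real.log δ⁻¹] timePoly =
      7 + ((processTime T + 8 : ℕ) : ℝ) * (4 * d * ((Real.log δ⁻¹ + 5) * ε⁻¹) +
        24 * d * T.size ^ 2 * ((2 * Real.log δ⁻¹ + 12) * ε⁻¹)) := by
    simp only [timePoly, processTime, map_add, map_mul, map_pow, map_ofNat, MvPolynomial.eval_X]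
    simp only [Matrix.cons_val]
    push_cast
    ring
  rw [hpoly, ENNReal.ofReal_add (by norm_num) (by positivity)]
  refine (lintegral_mono fun ω => runningTime_le hd).trans ?_
  rw [lintegral_add_left measurable_const, lintegral_const, measure_univ, mul_one]
  refine add_le_add (by simp) ?_
  exact lintegral_tsum_indicator_le (fun t => measurableSet_alive T _ _ t) _
    (sum_measure_alive_le D hd (winLen_strictMono hε hε1 hδ hδ1) (one_le_winLen hε hδ hδ1)
      (winLen_succ_le hε hδ hδ1) T hL (by positivity) (winLen_le hε hε1 hδ hδ1))

/-- The bound is deterministic: 14 registers and two tapes, each bounded by `2ds + 2d + 1 ≤ 5ds`.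
The constant 80 would do; 96 is shared with the query bound. -/
theorem lintegral_memoryUsage_le {d : ℕ} (hd : 1 ≤ d) (D : Measure (Fin d → ℝ))
    [IsProbabilityMeasure D] (T : DecisionTree d) :
    ∫⁻ ω, boxLearner.memoryUsage ⟨ω, T, boxTest d ε δ⟩ ∂(Measure.infinitePi fun _ : ℕ => D) ≤
      ENNReal.ofReal (96 * (d * T.size)) := by
  refine (lintegral_mono fun ω => memoryUsage_le hd).trans ?_
  rw [lintegral_const, measure_univ, mul_one, ← ENNReal.ofReal_natCast]
  refine ENNReal.ofReal_le_ofReal ?_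
  have hs : (1 : ℝ) ≤ T.size := by exact_mod_cast T.size_pos
  have hd' : (1 : ℝ) ≤ d := by exact_mod_cast hd
  rw [tapeBound]
  push_cast
  nlinarith

end Final

end LeafLearning

theorem mainTheorem9 :
    ∃ (L : LeafLearning.Learner) (C : ℝ) (P : MvPolynomial (Fin 4) ℝ),
      ∀ (d : ℕ), 1 ≤ d → ∀ (ε δ : ℝ), 0 < ε → ε < 1 → 0 < δ → δ < 1 →
        ∃ counterTest : ℕ → ℕ → ℕ → Bool,
          L.RPULearns counterTest d ε δ ∧
          ∀ (D : Measure (Fin d → ℝ)) [IsProbabilityMeasure D] (T : LeafLearning.DecisionTree d),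
            (∫⁻ ω, L.queryCount ⟨ω, T, counterTest⟩ ∂(Measure.infinitePi (fun _ : ℕ => D))
              ≤ ENNReal.ofReal (C * (d * T.size ^ 2 * (1 + Real.log (T.size / (ε * δ)))))) ∧
            (∫⁻ ω, L.runningTime ⟨ω, T, counterTest⟩ ∂(Measure.infinitePi (fun _ : ℕ => D))
              ≤ ENNReal.ofReal
                  (MvPolynomial.eval ![(T.size : ℝ), (d : ℝ), ε⁻¹, Real.log δ⁻¹] P)) ∧
            (∫⁻ ω, L.memoryUsage ⟨ω, T, counterTest⟩ ∂(Measure.infinitePi (fun _ : ℕ => D))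
              ≤ ENNReal.ofReal (C * (d * T.size))) :=
  ⟨LeafLearning.boxLearner, 96, LeafLearning.timePoly, fun d hd ε δ hε hε1 hδ hδ1 =>
    ⟨LeafLearning.boxTest d ε δ, LeafLearning.boxLearner_rpuLearns hε hε1 hδ hδ1 hd, fun D _ T =>
      ⟨LeafLearning.lintegral_queryCount_le hε hε1 hδ hδ1 hd D T,
        LeafLearning.lintegral_runningTime_le hε hε1 hδ hδ1 hd D T,
        LeafLearning.lintegral_memoryUsage_le hd D T⟩⟩⟩
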